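/- Let $p,q,r\ge 1$ be integers, $n=p+q$, and let $S^p\times S^q\subset\mathbb R^{p+1}\times\mathbb R^{q+1}$ carry the metric $g=-g_{S^p}+g_{S^q}$. The Lie algebra $\mathfrak g=\mathfrak{so}(p+1,q+1)$ acts on $S^p\times S^q$ (the space of rays of the null cone) by conformal vector fields $X$, $\mathcal L_Xg=2\omega_Xg$; put $K=SO(p+1)\times SO(q+1)$. Let $\Delta_{S^p},\Delta_{S^q}\ge 0$ be the Laplacians of the round spheres, $E(j)=\{f\in C^\infty(S^p):\Delta_{S^p}f=j(j+p-1)f\}$, $F(k)=\{f\in C^\infty(S^q):\Delta_{S^q}f=k(k+q-1)f\}$, $V(j,k)=E(j)\otimes F(k)$, and for $\varepsilon\in\{0,1\}$ let $\mathcal E^\varepsilon=\bigoplus_{j+k\equiv\varepsilon\,(2)}V(j,k)$. An intertwinor of order $2r$ on $\mathcal E^\varepsilon$ is a linear $K$-map $A:\mathcal E^\varepsilon\to\mathcal E^\varepsilon$ with $$A\big(\mathcal L_X+(\tfrac n2-r)\omega_X\big)=\big(\mathcal L_X+(\tfrac n2+r)\omega_X\big)A\qquad(X\in\mathfrak g);$$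 a spectral function $Z_\varepsilon(r;j,k)$ is a function such that the operator acting by $Z_\varepsilon(r;j,k)$ on each $V(j,k)\subset\mathcal E^\varepsilon$ is such an intertwinor. Write $J=j+\frac{p-1}2$, $K=k+\frac{q-1}2$. On $\bigoplus_{j,k}V(j,k)$ let $B=\sqrt{\Delta_{S^p}+(\frac{p-1}2)^2}$, $C=\sqrt{\Delta_{S^q}+(\frac{q-1}2)^2}$ and $$D=(C+B-r+1)(C+B-r+3)\cdots(C+B+r-1)\cdot(C-B-r+1)(C-B-r+3)\cdots(C-B+r-1).$$ Then: (1) $D=P(\Delta_{S^p},\Delta_{S^q})$ for a real polynomial $P$ of total degree $r$, so $D$ is a differential operator of order $2r$. On all of $C^\infty(S^p\times S^q)$ it is infinitesimally conformally covariant: $P(\Delta_{S^p},\Delta_{S^q})(\mathcal L_X+(\frac n2-r)\omega_X)=(\mathcal L_X+(\frac n2+r)\omega_X)P(\Delta_{S^p},\Delta_{S^q})$ for all $X\in\mathfrak g$. For $r=1$ it is the conformal Laplacian $-g^{ab}\nabla_a\nabla_b+\frac{n-2}{4(n-1)}\mathrm{Scal}$ of $g$. (2) On $V(j,k)$ the operator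 $D$ is multiplication by $$d(j,k)=\prod_{i=0}^{r-1}(K+J-r+1+2i)\cdot\prod_{i=0}^{r-1}(K-J-r+1+2i).$$ (3) The Gamma function expression of the spectral function (without its normalizing factor, which does not depend on $j,k$) is a constant multiple of this eigenvalue: for all $j,k\ge 0$ $$\frac{\Gamma(\frac{K+J+1+r}2)\,\Gamma(\frac{K-J+1+r}2)}{\Gamma(\frac{K+J+1-r}2)\,\Gamma(\frac{K-J+1-r}2)}=4^{-r}d(j,k),$$ where the left side is understood as the limit for $t\to0$, $t\ne 0$, of the expression with $t$ added to each of the four arguments. (4) For each $\varepsilon\in\{0,1\}$ the space $\mathcal E^\varepsilon$ is stable under $K$ and under $\mathcal L_X+a\omega_X$ for $X\in\mathfrak g$ and $a\in\mathbb R$, and $d$ is a spectral function on $\mathcal E^\varepsilon$. If moreover $\frac{q-p}2+\varepsilon+1-r$ is not an even integer (equivalently, $\frac{K-J+1-r}{2}$ is not an integer for the $V(j,k)$ in $\mathcal E^\varepsilon$), then every intertwinor of order $2r$ on $\mathcal E^\varepsilon$ is a constant multiple of $D|_{\mathcal E^\varepsilon}$, and every spectral function satisfies $Z_\varepsilon(r;j,k)=c\,d(j,k)$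 for all $j+k\equiv\varepsilon\ (2)$, with a constant $c$. -/

import Mathlib

open Filter Topology
open scoped ContDiff Manifold InnerProductSpace

noncomputable section

namespace SphereProduct

/-! ### Spheres and the spherical Laplacian -/

/-- `ℝ^{n+1}` with the Euclidean norm. -/
abbrev Amb (n : ℕ) : Type := EuclideanSpace ℝ (Fin (n + 1))

/-- The unit sphere `S^n ⊂ ℝ^{n+1}`. -/
abbrev Sph (n : ℕ) : Type := Metric.sphere (0 : Amb n) 1

/-- Radial projection of a nonzero vector onto the unit sphere. -/
def radial {n : ℕ} (v : Amb n) (hv : v ≠ 0) : Sph n :=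
  ⟨‖v‖⁻¹ • v, by
    rw [mem_sphere_zero_iff_norm, norm_smul, norm_inv, norm_norm,
      inv_mul_cancel₀ (norm_ne_zero_iff.mpr hv)]⟩

open Classical in
/-- The extension of `f : S^n → ℂ` to `ℝ^{n+1} ∖ {0}` that is homogeneous of degree `0`
(with value `0` at the origin). -/
def homExt {n : ℕ} (f : Sph n → ℂ) (v : Amb n) : ℂ :=
  if hv : v ≠ 0 then f (radial v hv) else 0

/-- Smooth complex-valued functions on `S^n`. -/
def SmoothSph {n : ℕ} (f : Sph n → ℂ) : Prop :=
  ContMDiff (𝓡 n) 𝓘(ℝ, ℂ) ∞ f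

/-- The (nonnegative) Laplacian `-g^{ab} ∇_a ∇_b` of the round sphere `S^n`: minus the Euclidean
Laplacian of the extension that is homogeneous of degree `0`. -/
def sphLap {n : ℕ} (f : Sph n → ℂ) (x : Sph n) : ℂ :=
  -(Laplacian.laplacian (homExt f) (x : Amb n))

theorem homExt_contDiffAt {n : ℕ} {f : Sph n → ℂ} (hf : SmoothSph f) {v : Amb n} (hv : v ≠ 0) :
    ContDiffAt ℝ ∞ (homExt f) v := by
  have : Fact (Module.finrank ℝ (Amb n) = n + 1) := ⟨finrank_euclideanSpace_fin⟩
  let U : TopologicalSpace.Opens (Amb n) := ⟨{v | v ≠ 0}, isOpen_ne⟩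
  let ν : U → Amb n := fun u => ‖(u : Amb n)‖⁻¹ • (u : Amb n)
  have hν : ContMDiff 𝓘(ℝ, Amb n) 𝓘(ℝ, Amb n) ∞ ν := by
    intro u
    refine (contMDiffAt_subtype_iff (f := fun u : Amb n => ‖u‖⁻¹ • u)).mpr ?_
    refine ContDiffAt.contMDiffAt ?_
    exact ((contDiffAt_norm ℝ u.2).inv (norm_ne_zero_iff.mpr u.2)).smul contDiffAt_id
  have hmem : ∀ u : U, ν u ∈ Metric.sphere (0 : Amb n) 1 := fun u => (radial u.1 u.2).2
  have h := hf.comp (hν.codRestrict_sphere hmem)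
  have h2 : ContMDiffAt 𝓘(ℝ, Amb n) 𝓘(ℝ, ℂ) ∞ (homExt f) v := by
    refine (contMDiffAt_subtype_iff (U := U) (x := ⟨v, hv⟩)).mp ?_
    convert h.contMDiffAt using 1
    funext u
    have hu : (u : Amb n) ≠ 0 := u.2
    simp only [homExt, hu, ne_eq, not_false_eq_true, dite_true, Function.comp]
    rfl
  exact contMDiffAt_iff_contDiffAt.mp h2

theorem homExt_contDiffAt_two {n : ℕ} {f : Sph n → ℂ} (hf : SmoothSph f) (x : Sph n) :
    ContDiffAt ℝ 2 (homExt f) (x : Amb n) :=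
  (contDiffAt_infty.mp (homExt_contDiffAt hf (ne_zero_of_mem_unit_sphere x))) 2

theorem sphLap_add {n : ℕ} {f g : Sph n → ℂ} (hf : SmoothSph f) (hg : SmoothSph g) :
    sphLap (f + g) = sphLap f + sphLap g := by
  have h : homExt (f + g) = homExt f + homExt g := by
    funext v; by_cases hv : v = 0 <;> simp [homExt, hv]
  funext x
  simp only [sphLap, h, Pi.add_apply,
    (homExt_contDiffAt_two hf x).laplacian_add (homExt_contDiffAt_two hg x)]
  ring

theorem sphLap_smul {n : ℕ} {f : Sph n → ℂ} (c : ℂ) (hf : SmoothSph f) :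
    sphLap (c • f) = c • sphLap f := by
  have h : homExt (c • f) = c • homExt f := by
    funext v; by_cases hv : v = 0 <;> simp [homExt, hv]
  funext x
  simp only [sphLap, h, Pi.smul_apply,
    InnerProductSpace.laplacian_smul c (homExt_contDiffAt_two hf x), smul_neg]

theorem SmoothSph.add {n : ℕ} {f g : Sph n → ℂ} (hf : SmoothSph f) (hg : SmoothSph g) :
    SmoothSph (f + g) := ContMDiff.add hf hg

theorem SmoothSph.smul {n : ℕ} {f : Sph n → ℂ} (c : ℂ) (hf : SmoothSph f) :
    SmoothSph (c • f) :=
  (contDiff_const_smul (𝕜 := ℝ) (F := ℂ) c).comp_contMDiff hf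

theorem SmoothSph.zero {n : ℕ} : SmoothSph (0 : Sph n → ℂ) := contMDiff_const

/-- Spherical harmonics of order `j` on `S^n`:
`{f ∈ C^∞(S^n) : Δ f = j (j + n - 1) f}`. -/
def sphHarm (n j : ℕ) : Submodule ℂ (Sph n → ℂ) where
  carrier := {f | SmoothSph f ∧ sphLap f = ((j : ℂ) * ((j : ℂ) + n - 1)) • f}
  add_mem' := by
    rintro f g ⟨hf, hf'⟩ ⟨hg, hg'⟩
    exact ⟨hf.add hg, by rw [sphLap_add hf hg, hf', hg', smul_add]⟩
  zero_mem' := by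
    refine ⟨SmoothSph.zero, ?_⟩
    have := sphLap_smul (0 : ℂ) (SmoothSph.zero (n := n))
    simpa using this
  smul_mem' := by
    rintro c f ⟨hf, hf'⟩
    exact ⟨hf.smul c, by rw [sphLap_smul c hf, hf', smul_comm]⟩

/-! ### The product `S^p × S^q` and its `K`-types -/

/-- `M = S^p × S^q`. -/
abbrev Prd (p q : ℕ) : Type := Sph p × Sph q

/-- Smooth complex-valued functions on `S^p × S^q`. -/
def Smooth {p q : ℕ} (f : Prd p q → ℂ) : Prop :=
  ContMDiff ((𝓡 p).prod (𝓡 q)) 𝓘(ℝ, ℂ) ∞ f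

/-- `Δ_{S^p}` acting in the first variable. -/
def lapP {p q : ℕ} (f : Prd p q → ℂ) (z : Prd p q) : ℂ :=
  sphLap (fun x => f (x, z.2)) z.1

/-- `Δ_{S^q}` acting in the second variable. -/
def lapQ {p q : ℕ} (f : Prd p q → ℂ) (z : Prd p q) : ℂ :=
  sphLap (fun y => f (z.1, y)) z.2

/-- The `K`-type `V(j,k) = E(j) ⊗ F(k)`, as a space of functions on `S^p × S^q`. -/
def kType (p q j k : ℕ) : Submodule ℂ (Prd p q → ℂ) :=
  Submodule.span ℂ {u | ∃ f ∈ sphHarm p j, ∃ g ∈ sphHarm q k, u = fun z => f z.1 * g z.2}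

/-- The space `⨁_{j,k} V(j,k)` of `K`-finite functions on `S^p × S^q`. -/
def kFinite (p q : ℕ) : Submodule ℂ (Prd p q → ℂ) :=
  ⨆ (j : ℕ) (k : ℕ), kType p q j k

/-- The space `𝓔^ε`, the sum of the `V(j,k)` with `j + k ≡ ε` modulo `2`. -/
def kFinitePar (p q : ℕ) (ε : Fin 2) : Submodule ℂ (Prd p q → ℂ) :=
  ⨆ (j : ℕ) (k : ℕ) (_ : (j + k) % 2 = (ε : ℕ)), kType p q j k

theorem kFinitePar_le (p q : ℕ) (ε : Fin 2) : kFinitePar p q ε ≤ kFinite p q :=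
  iSup_le fun j => iSup_le fun k => iSup_le fun _ => le_iSup₂_of_le j k le_rfl

/-- Functions that are smooth in each variable separately. -/
def sepSmooth (p q : ℕ) : Submodule ℂ (Prd p q → ℂ) where
  carrier := {f | (∀ y, SmoothSph fun x => f (x, y)) ∧ ∀ x, SmoothSph fun y => f (x, y)}
  add_mem' hf hg := ⟨fun y => (hf.1 y).add (hg.1 y), fun x => (hf.2 x).add (hg.2 x)⟩
  zero_mem' := ⟨fun _ => SmoothSph.zero, fun _ => SmoothSph.zero⟩
  smul_mem' c _ hf := ⟨fun y => (hf.1 y).smul c, fun x => (hf.2 x).smul c⟩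

theorem lapP_add {p q : ℕ} {f g : Prd p q → ℂ} (hf : f ∈ sepSmooth p q) (hg : g ∈ sepSmooth p q) :
    lapP (f + g) = lapP f + lapP g :=
  funext fun z => congrFun (sphLap_add (hf.1 z.2) (hg.1 z.2)) z.1

theorem lapQ_add {p q : ℕ} {f g : Prd p q → ℂ} (hf : f ∈ sepSmooth p q) (hg : g ∈ sepSmooth p q) :
    lapQ (f + g) = lapQ f + lapQ g :=
  funext fun z => congrFun (sphLap_add (hf.2 z.1) (hg.2 z.1)) z.2

theorem lapP_smul {p q : ℕ} {f : Prd p q → ℂ} (c : ℂ) (hf : f ∈ sepSmooth p q) :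
    lapP (c • f) = c • lapP f :=
  funext fun z => congrFun (sphLap_smul c (hf.1 z.2)) z.1

theorem lapQ_smul {p q : ℕ} {f : Prd p q → ℂ} (c : ℂ) (hf : f ∈ sepSmooth p q) :
    lapQ (c • f) = c • lapQ f :=
  funext fun z => congrFun (sphLap_smul c (hf.2 z.1)) z.2

theorem kType_spec {p q j k : ℕ} {u : Prd p q → ℂ} (hu : u ∈ kType p q j k) :
    u ∈ sepSmooth p q ∧ lapP u = ((j : ℂ) * ((j : ℂ) + p - 1)) • u ∧
      lapQ u = ((k : ℂ) * ((k : ℂ) + q - 1)) • u := by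
  induction hu using Submodule.span_induction with
  | mem u hu =>
    obtain ⟨f, hf, g, hg, rfl⟩ := hu
    have h1 : ∀ y, (fun x => f x * g y) = g y • f := fun y => by
      funext x; simp [mul_comm]
    have h2 : ∀ x, (fun y => f x * g y) = f x • g := fun x => by
      funext y; simp
    refine ⟨⟨fun y => ?_, fun x => ?_⟩, funext fun z => ?_, funext fun z => ?_⟩
    · simpa only [h1] using hf.1.smul (g y)
    · simpa only [h2] using hg.1.smul (f x)
    · simp only [lapP, h1, sphLap_smul _ hf.1, hf.2, Pi.smul_apply, smul_eq_mul]; ring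
    · simp only [lapQ, h2, sphLap_smul _ hg.1, hg.2, Pi.smul_apply, smul_eq_mul]; ring
  | zero =>
    refine ⟨Submodule.zero_mem _, ?_, ?_⟩
    · simpa using lapP_smul (0 : ℂ) (Submodule.zero_mem (sepSmooth p q))
    · simpa using lapQ_smul (0 : ℂ) (Submodule.zero_mem (sepSmooth p q))
  | add u v _ _ hu hv =>
    refine ⟨Submodule.add_mem _ hu.1 hv.1, ?_, ?_⟩
    · rw [lapP_add hu.1 hv.1, hu.2.1, hv.2.1, smul_add]
    · rw [lapQ_add hu.1 hv.1, hu.2.2, hv.2.2, smul_add]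
  | smul c u _ hu =>
    refine ⟨Submodule.smul_mem _ c hu.1, ?_, ?_⟩
    · rw [lapP_smul c hu.1, hu.2.1, smul_comm]
    · rw [lapQ_smul c hu.1, hu.2.2, smul_comm]

theorem kFinite_induction {p q : ℕ} {φ : (Prd p q → ℂ) → Prop}
    (hφ : ∀ j k, ∀ u ∈ kType p q j k, φ u) (hadd : ∀ u v, φ u → φ v → φ (u + v))
    {u : Prd p q → ℂ} (hu : u ∈ kFinite p q) : φ u := by
  have hu' : u ∈ ⨆ jk : ℕ × ℕ, kType p q jk.1 jk.2 := by
    rw [iSup_prod]; exact hu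
  exact Submodule.iSup_induction _ (motive := φ) hu' (fun jk u hu => hφ jk.1 jk.2 u hu)
    (hφ 0 0 0 (Submodule.zero_mem _)) hadd

theorem kFinite_spec {p q : ℕ} {u : Prd p q → ℂ} (hu : u ∈ kFinite p q) :
    u ∈ sepSmooth p q ∧ lapP u ∈ kFinite p q ∧ lapQ u ∈ kFinite p q := by
  refine kFinite_induction (φ := fun u => u ∈ sepSmooth p q ∧ lapP u ∈ kFinite p q ∧
    lapQ u ∈ kFinite p q) ?_ ?_ hu
  · intro j k u hu
    have hle : kType p q j k ≤ kFinite p q := le_iSup₂_of_le j k le_rfl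
    obtain ⟨h1, h2, h3⟩ := kType_spec hu
    refine ⟨h1, ?_, ?_⟩
    · rw [h2]; exact (kFinite p q).smul_mem _ (hle hu)
    · rw [h3]; exact (kFinite p q).smul_mem _ (hle hu)
  · rintro u v ⟨h1, h2, h3⟩ ⟨k1, k2, k3⟩
    refine ⟨(sepSmooth p q).add_mem h1 k1, ?_, ?_⟩
    · rw [lapP_add h1 k1]; exact (kFinite p q).add_mem h2 k2
    · rw [lapQ_add h1 k1]; exact (kFinite p q).add_mem h3 k3

/-- `Δ_{S^p}` as an endomorphism of the space of `K`-finite functions. -/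
def lapPEnd (p q : ℕ) : Module.End ℂ (kFinite p q) where
  toFun u := ⟨lapP u.1, (kFinite_spec u.2).2.1⟩
  map_add' u v := Subtype.ext (lapP_add (kFinite_spec u.2).1 (kFinite_spec v.2).1)
  map_smul' c u := Subtype.ext (lapP_smul c (kFinite_spec u.2).1)

/-- `Δ_{S^q}` as an endomorphism of the space of `K`-finite functions. -/
def lapQEnd (p q : ℕ) : Module.End ℂ (kFinite p q) where
  toFun u := ⟨lapQ u.1, (kFinite_spec u.2).2.2⟩
  map_add' u v := Subtype.ext (lapQ_add (kFinite_spec u.2).1 (kFinite_spec v.2).1)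
  map_smul' c u := Subtype.ext (lapQ_smul c (kFinite_spec u.2).1)

/-! ### Square roots and the operators `B`, `C`, `D` -/

theorem exists_sqrt {V : Type*} [AddCommGroup V] [Module ℂ V] (T : Module.End ℂ V) :
    ∃ S : Module.End ℂ V, ∀ (l : ℝ) (v : V), 0 ≤ l → T v = (l : ℂ) • v →
      S v = ((Real.sqrt l : ℝ) : ℂ) • v := by
  classical
  have hinj := (Module.End.eigenspaces_iSupIndep T).dfinsupp_lsum_injective
  set ι : (Π₀ μ : ℂ, T.eigenspace μ) →ₗ[ℂ] V :=
    DFinsupp.lsum ℂ fun μ => (T.eigenspace μ).subtype with hι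
  have hinj' : Function.Injective ι := hinj
  obtain ⟨g, hg⟩ := LinearMap.exists_leftInverse_of_injective ι (LinearMap.ker_eq_bot.mpr hinj')
  let σ : (Π₀ μ : ℂ, T.eigenspace μ) →ₗ[ℂ] V :=
    DFinsupp.lsum ℂ fun μ => ((Real.sqrt μ.re : ℝ) : ℂ) • (T.eigenspace μ).subtype
  refine ⟨σ ∘ₗ g, fun l v _ hv => ?_⟩
  have hmem : v ∈ T.eigenspace (l : ℂ) := Module.End.mem_eigenspace_iff.mpr hv
  have h1 : ι (DFinsupp.single (l : ℂ) ⟨v, hmem⟩) = v := by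
    simp [hι]
  have h2 : g v = DFinsupp.single (l : ℂ) ⟨v, hmem⟩ := by
    conv_lhs => rw [← h1]
    exact LinearMap.congr_fun hg _
  simp only [LinearMap.comp_apply, h2, σ, DFinsupp.lsum_single]
  simp

/-- The nonnegative square root of a diagonalizable operator `T` with nonnegative eigenvalues:
the operator that is multiplication by `√l` on the `l`-eigenspace of `T` for each `l ≥ 0`
(this determines it when these eigenspaces span the space). -/
def opSqrt {V : Type*} [AddCommGroup V] [Module ℂ V] (T : Module.End ℂ V) : Module.End ℂ V :=
  (exists_sqrt T).choose

/-- `B = √(Δ_{S^p} + ((p-1)/2)²)` on `K`-finite functions. -/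
def opB (p q : ℕ) : Module.End ℂ (kFinite p q) :=
  opSqrt (lapPEnd p q + ((((p : ℂ) - 1) / 2) ^ 2) • 1)

/-- `C = √(Δ_{S^q} + ((q-1)/2)²)` on `K`-finite functions. -/
def opC (p q : ℕ) : Module.End ℂ (kFinite p q) :=
  opSqrt (lapQEnd p q + ((((q : ℂ) - 1) / 2) ^ 2) • 1)

/-- `T - r + 1, T - r + 3, …, T + r - 1` multiplied together (`r` factors). -/
def stepProd {V : Type*} [AddCommGroup V] [Module ℂ V] (T : Module.End ℂ V) (r : ℕ) :
    Module.End ℂ V :=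
  ((List.range r).map fun i => T + ((2 * i + 1 - r : ℂ)) • (1 : Module.End ℂ V)).prod

/-- `D = (C+B-r+1)(C+B-r+3)⋯(C+B+r-1) · (C-B-r+1)(C-B-r+3)⋯(C-B+r-1)`. -/
def opD (p q r : ℕ) : Module.End ℂ (kFinite p q) :=
  stepProd (opC p q + opB p q) r * stepProd (opC p q - opB p q) r

/-- `J = j + (p-1)/2`; also used for `K = k + (q-1)/2`. -/
def shifted (p j : ℕ) : ℝ := j + ((p : ℝ) - 1) / 2

/-- `(K+J-r+1)(K+J-r+3)⋯(K+J+r-1) · (K-J-r+1)(K-J-r+3)⋯(K-J+r-1)`. -/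
def eigD (p q r j k : ℕ) : ℝ :=
  (∏ i ∈ Finset.range r, (shifted q k + shifted p j + (2 * i + 1 - r))) *
    ∏ i ∈ Finset.range r, (shifted q k - shifted p j + (2 * i + 1 - r))

/-- The quotient
`Γ(½(K+J+1+r)+t) Γ(½(K-J+1+r)+t) / (Γ(½(K+J+1-r)+t) Γ(½(K-J+1-r)+t))`. -/
def gammaQuot (p q r j k : ℕ) (t : ℝ) : ℝ :=
  (Real.Gamma ((shifted q k + shifted p j + 1 + r) / 2 + t) *
      Real.Gamma ((shifted q k - shifted p j + 1 + r) / 2 + t)) /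
    (Real.Gamma ((shifted q k + shifted p j + 1 - r) / 2 + t) *
      Real.Gamma ((shifted q k - shifted p j + 1 - r) / 2 + t))

/-- The differential operator `P(Δ_{S^p}, Δ_{S^q})` for a real polynomial `P` in two variables. -/
def polyOp {p q : ℕ} (P : MvPolynomial (Fin 2) ℝ) (f : Prd p q → ℂ) : Prd p q → ℂ :=
  fun z => ∑ m ∈ P.support, ((P.coeff m : ℝ) : ℂ) * (lapP^[m 0] (lapQ^[m 1] f)) z

/-! ### Conformal vector fields and intertwinors -/

/-- The Lie algebra `𝔤 = 𝔰𝔬(p+1,q+1)`, matrices skew for the form of signature `(p+1,q+1)`. -/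
abbrev lieG (p q : ℕ) : Submodule ℝ (Matrix (Fin (p + 1) ⊕ Fin (q + 1))
    (Fin (p + 1) ⊕ Fin (q + 1)) ℝ) :=
  skewAdjointMatricesSubmodule
    (LieAlgebra.Orthogonal.indefiniteDiagonal (Fin (p + 1)) (Fin (q + 1)) ℝ)

/-- The value `X z` of the linear vector field `X ∈ 𝔤` on `ℝ^{p+1,q+1}` at a point of
`S^p × S^q`. -/
def linField {p q : ℕ} (X : lieG p q) (z : Prd p q) : Amb p × Amb q :=
  let w := X.1.mulVec (Sum.elim (z.1 : Amb p) (z.2 : Amb q))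
  (WithLp.toLp 2 fun i => w (Sum.inl i), WithLp.toLp 2 fun i => w (Sum.inr i))

open Classical in
/-- The extension of `f` that is homogeneous of degree `0` in each of the two variables. -/
def homExt₂ {p q : ℕ} (f : Prd p q → ℂ) (v : Amb p × Amb q) : ℂ :=
  if h : v.1 ≠ 0 ∧ v.2 ≠ 0 then f (radial v.1 h.1, radial v.2 h.2) else 0

/-- The Lie derivative of a function along the conformal vector field on `S^p × S^q`
(the space of rays of the null cone) induced by `X ∈ 𝔤`. -/
def lieDer {p q : ℕ} (X : lieG p q) (f : Prd p q → ℂ) (z : Prd p q) : ℂ :=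
  fderiv ℝ (homExt₂ f) ((z.1 : Amb p), (z.2 : Amb q)) (linField X z)

/-- The conformal factor `ω` (`𝓛_X g = 2 ω g`) of the conformal vector field induced by `X ∈ 𝔤`
at `z = (x,y)`. The flow is `z ↦ h z / |(h z)_x|` with `h = exp (t X)`, and it pulls
`g = -g_{S^p} + g_{S^q}` back to `|(h z)_x|⁻² g`; hence `ω = -⟨x, (X z)_x⟩`. -/
def confFactor {p q : ℕ} (X : lieG p q) (z : Prd p q) : ℝ :=
  -(inner ℝ (z.1 : Amb p) (linField X z).1)

/-- The infinitesimal representation `U_a(X) = 𝓛_X + a ω`. -/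
def confRep {p q : ℕ} (a : ℝ) (X : lieG p q) (f : Prd p q → ℂ) (z : Prd p q) : ℂ :=
  lieDer X f z + (a : ℂ) * (confFactor X z : ℂ) * f z

/-- The rotations `SO(n+1)` of `ℝ^{n+1}`. -/
def IsRot {n : ℕ} (u : Amb n ≃ₗᵢ[ℝ] Amb n) : Prop :=
  LinearMap.det (u.toLinearEquiv : Amb n →ₗ[ℝ] Amb n) = 1

/-- The action of an orthogonal transformation on the sphere. -/
def rotSph {n : ℕ} (u : Amb n ≃ₗᵢ[ℝ] Amb n) (x : Sph n) : Sph n :=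
  ⟨u x, by rw [mem_sphere_zero_iff_norm, u.norm_map]; exact mem_sphere_zero_iff_norm.mp x.2⟩

/-- The action `f ↦ f ∘ (u,v)⁻¹` on functions. -/
def rotAct {p q : ℕ} (u : Amb p ≃ₗᵢ[ℝ] Amb p) (v : Amb q ≃ₗᵢ[ℝ] Amb q) (f : Prd p q → ℂ) :
    Prd p q → ℂ :=
  fun z => f (rotSph u.symm z.1, rotSph v.symm z.2)

/-- Intertwinors of order `2r` on `𝓔^ε`: linear maps that commute with
`K = SO(p+1) × SO(q+1)` and satisfy
`A (𝓛_X + (n/2 - r) ω) = (𝓛_X + (n/2 + r) ω) A` for all `X ∈ 𝔤`, with `n = p + q`. -/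
def IsIntertwinor (p q r : ℕ) (ε : Fin 2) (A : Module.End ℂ (kFinitePar p q ε)) : Prop :=
  (∀ (u : Amb p ≃ₗᵢ[ℝ] Amb p) (v : Amb q ≃ₗᵢ[ℝ] Amb q), IsRot u → IsRot v →
    ∀ f g : kFinitePar p q ε, (g : Prd p q → ℂ) = rotAct u v f →
      (A g : Prd p q → ℂ) = rotAct u v (A f)) ∧
  (∀ (X : lieG p q) (f g : kFinitePar p q ε),
    (g : Prd p q → ℂ) = confRep (((p : ℝ) + q) / 2 - r) X f →
      (A g : Prd p q → ℂ) = confRep (((p : ℝ) + q) / 2 + r) X (A f))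

/-- `Z` is a spectral function on `𝓔^ε`: the operator with eigenvalue `Z j k` on each `V(j,k)`
in `𝓔^ε` is an intertwinor of order `2r`. -/
def IsSpectralFunction (p q r : ℕ) (ε : Fin 2) (Z : ℕ → ℕ → ℂ) : Prop :=
  ∃ A : Module.End ℂ (kFinitePar p q ε), IsIntertwinor p q r ε A ∧
    ∀ j k, (j + k) % 2 = (ε : ℕ) → ∀ f : kFinitePar p q ε,
      (f : Prd p q → ℂ) ∈ kType p q j k → A f = Z j k • f

/-! ### The conformal Laplacian -/

section Coordinates

variable {ι : Type*} [Fintype ι] [DecidableEq ι]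

/-- The partial derivative `∂_i`. -/
def pd {E : Type*} [NormedAddCommGroup E] [NormedSpace ℝ E] (i : ι) (F : (ι → ℝ) → E)
    (w : ι → ℝ) : E :=
  fderiv ℝ F w (Pi.single i 1)

/-- The Christoffel symbol `Γ^k_{ij}` of a metric given by its coefficients in coordinates. -/
def christoffel (G : (ι → ℝ) → Matrix ι ι ℝ) (k i j : ι) (w : ι → ℝ) : ℝ :=
  (1 / 2) * ∑ l, (G w)⁻¹ k l *
    (pd i (fun w => G w j l) w + pd j (fun w => G w i l) w - pd l (fun w => G w i j) w)

/-- The Ricci curvature `R_{ij}` in coordinates. -/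
def ricci (G : (ι → ℝ) → Matrix ι ι ℝ) (i j : ι) (w : ι → ℝ) : ℝ :=
  ∑ k, (pd k (christoffel G k i j) w - pd j (christoffel G k i k) w +
    ∑ l, (christoffel G k k l w * christoffel G l i j w -
      christoffel G k j l w * christoffel G l i k w))

/-- The scalar curvature `R = g^{ij} R_{ij}` in coordinates. -/
def scalarCurv (G : (ι → ℝ) → Matrix ι ι ℝ) (w : ι → ℝ) : ℝ :=
  ∑ i, ∑ j, (G w)⁻¹ i j * ricci G i j w

/-- `-g^{ab} ∇_a ∇_b F` in coordinates. -/
def boxCoord (G : (ι → ℝ) → Matrix ι ι ℝ) (F : (ι → ℝ) → ℂ) (w : ι → ℝ) : ℂ :=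
  -∑ a, ∑ b, (((G w)⁻¹ a b : ℝ) : ℂ) *
    (pd a (pd b F) w - ∑ c, ((christoffel G c a b w : ℝ) : ℂ) * pd c F w)

end Coordinates

/-- The inverse of the manifold chart of `S^p × S^q` around `z`. -/
def param {p q : ℕ} (z : Prd p q) (w : Fin p ⊕ Fin q → ℝ) : Prd p q :=
  ((chartAt (EuclideanSpace ℝ (Fin p)) z.1).symm (WithLp.toLp 2 fun i => w (Sum.inl i)),
    (chartAt (EuclideanSpace ℝ (Fin q)) z.2).symm (WithLp.toLp 2 fun i => w (Sum.inr i)))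

/-- The coordinates of `z` in the chart around `z`. -/
def coord {p q : ℕ} (z : Prd p q) : Fin p ⊕ Fin q → ℝ :=
  Sum.elim (chartAt (EuclideanSpace ℝ (Fin p)) z.1 z.1)
    (chartAt (EuclideanSpace ℝ (Fin q)) z.2 z.2)

/-- The coefficients of the pseudo-Riemannian metric `-g_{S^p} + g_{S^q}` in the chart
around `z`. -/
def metricCoeff {p q : ℕ} (z : Prd p q) (w : Fin p ⊕ Fin q → ℝ) :
    Matrix (Fin p ⊕ Fin q) (Fin p ⊕ Fin q) ℝ :=
  Matrix.of fun i j =>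
    -(inner ℝ (pd i (fun w => ((param z w).1 : Amb p)) w)
        (pd j (fun w => ((param z w).1 : Amb p)) w)) +
      inner ℝ (pd i (fun w => ((param z w).2 : Amb q)) w)
        (pd j (fun w => ((param z w).2 : Amb q)) w)

/-- The conformal Laplacian `-g^{ab} ∇_a ∇_b + (n-2)/(4(n-1)) R` of `S^p × S^q` with the metric
`g = -g_{S^p} + g_{S^q}`, where `n = p + q` and `R` is the scalar curvature of `g`. -/
def confLaplacian {p q : ℕ} (f : Prd p q → ℂ) (z : Prd p q) : ℂ :=
  boxCoord (metricCoeff z) (fun w => f (param z w)) (coord z) +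
    (((((p : ℝ) + q) - 2) / (4 * (((p : ℝ) + q) - 1)) *
      scalarCurv (metricCoeff z) (coord z) : ℝ) : ℂ) * f z

end SphereProduct

end

/-!
The proof is an algebraic calculation with two families of operators on `C^∞(S^p × S^q)`: the
multiplications by the coordinates `x_i`, `y_l`, and the tangential derivatives `T_a`, the derivatives
of the homogeneous extensions along the basis vectors. On one sphere they satisfy a short list of
relations (`SphereRel`), from which follows `[Δ, [Δ, x]] = 2 (Δ x + x Δ) + n (n - 2) x`
(`SphereRel.double_comm`): multiplication by a coordinate raises or lowers
`J = √(Δ + ((n - 1)/2)²)` by one.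

*Covariance.* The Lie algebra consists of rotations of the factors, which commute with both Laplacians,
and of boosts. A boost has conformal factor `-w` with `w = x_i y_l`, and `U_{n/2 ∓ r}` of it is
`-1/2 [Δ_{S^p} + Δ_{S^q}, w] ± r w` (`boostOp_eq`). Pairing the factors of `D` with opposite shifts
gives a polynomial `P` in `J²` and `K²` (`covPoly`). Regard the products of `w` with the two Laplacians
from the left and from the right as a module over a commutative ring. On the part of `w` that raises `J`
and `K` by one the intertwining relation becomes
`P((J+1)², (K+1)²) (J + K + 1 - r) = (J + K + 1 + r) P(J², K²)`, which holds because the product defining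
`D` telescopes (`telescope`, `covPoly_smul`); the parts that lower `J` or `K` are covered by the same
identity, with the other sign of the square root.

*The case `r = 1`.* The charts of the spheres are stereographic projections. In them the metric is
conformally flat on each factor, the Christoffel symbols vanish at the centre, and the curvature and the
second derivatives are computed there (`polyOp_covPoly_one`).

*The components.* Harmonic functions on the sphere are constant, by integration by parts against a
radial cut-off (`const_of_sphLap_eq_zero`). With the double commutator relation, multiplication by a
coordinate therefore maps `E(j)` to `E(j+1) ⊕ E(j-1)` (`crdS_mul_mem`), which gives the stability of
`𝓔^ε` and the projections to the `V(j,k)`. The Gamma quotient is `4^{-r} d(j,k)` by the recursion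
`Γ(z + 1) = z Γ(z)`, used off the poles (`tendsto_gammaQuot`).

*Uniqueness.* An intertwinor `A` commutes with the rotations, hence with the two Laplacians, which are
their Casimir operators, and preserves the `V(j,k)`. The relation for the boosts links the neighbouring
components `V(j,k)` and `V(j±1,k±1)` by factors `c ∓ r` (`Intertwines.link`), and multiplication by the
`x_i y_l` is jointly injective between them (`eq_zero_of_pr_mulX`). Where `c + r ≠ 0`, vanishing on one
component thus implies vanishing on the neighbour. Under the hypothesis on `(q - p)/2 + ε + 1 - r`
these steps lead from `V(s,0)`, with `s ≥ r`, to all components (`Intertwines.eq_zero`). Finally `A` is a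
scalar on `V(s,0)`: multiplications by `x_i η` with the null coordinate `η = y₀ + i y₁` carry this space,
step by step and injectively, to the line spanned by `η^s`, on which there is nothing to prove
(`Intertwines.scalar_of_isNull`). Subtracting the right multiple of `D` from `A` leaves an intertwinor
that vanishes on `V(s,0)`, hence everywhere.
-/

noncomputable section

namespace SphereProduct

variable {p q : ℕ}

/-- The point `(x, y)` of `S^p × S^q` as a vector of `ℝ^{p+1} × ℝ^{q+1}`. -/
def emb (z : Prd p q) : Amb p × Amb q := ((z.1 : Amb p), (z.2 : Amb q))

/-- The standard basis of `ℝ^{p+1} × ℝ^{q+1}`. -/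
def dir : Fin (p + 1) ⊕ Fin (q + 1) → Amb p × Amb q :=
  Sum.elim (fun i => (EuclideanSpace.single i 1, 0)) (fun j => (0, EuclideanSpace.single j 1))

/-- The real coordinate functions of `ℝ^{p+1} × ℝ^{q+1}`. -/
def crdR (a : Fin (p + 1) ⊕ Fin (q + 1)) : Amb p × Amb q →L[ℝ] ℝ :=
  Sum.elim (fun i => (EuclideanSpace.proj i : Amb p →L[ℝ] ℝ).comp (ContinuousLinearMap.fst ℝ _ _))
    (fun j => (EuclideanSpace.proj j : Amb q →L[ℝ] ℝ).comp (ContinuousLinearMap.snd ℝ _ _)) a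

/-- The coordinate functions on `S^p × S^q`. -/
def crd (a : Fin (p + 1) ⊕ Fin (q + 1)) (z : Prd p q) : ℂ := (crdR a (emb z) : ℂ)

/-- The length of the component of a vector in the factor to which the index `a` belongs. -/
def len (a : Fin (p + 1) ⊕ Fin (q + 1)) (v : Amb p × Amb q) : ℝ :=
  Sum.elim (fun _ => ‖v.1‖) (fun _ => ‖v.2‖) a

/-- The tangential derivative `T_a f`: the derivative in the direction of the `a`-th basis vector
of the extension of `f` that is homogeneous of degree `0` in each variable. -/
def tanDer (a : Fin (p + 1) ⊕ Fin (q + 1)) (f : Prd p q → ℂ) (z : Prd p q) : ℂ :=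
  fderiv ℝ (homExt₂ f) (emb z) (dir a)

theorem emb_fst_ne (z : Prd p q) : (emb z).1 ≠ 0 := ne_zero_of_mem_unit_sphere z.1

theorem emb_snd_ne (z : Prd p q) : (emb z).2 ≠ 0 := ne_zero_of_mem_unit_sphere z.2

theorem norm_emb_fst (z : Prd p q) : ‖(emb z).1‖ = 1 := mem_sphere_zero_iff_norm.mp z.1.2

theorem norm_emb_snd (z : Prd p q) : ‖(emb z).2‖ = 1 := mem_sphere_zero_iff_norm.mp z.2.2

theorem radial_smul {n : ℕ} {v : Amb n} (hv : v ≠ 0) {c : ℝ} (hc : 0 < c) (h : c • v ≠ 0) :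
    radial (c • v) h = radial v hv := by
  apply Subtype.ext
  simp only [radial, norm_smul, Real.norm_of_nonneg hc.le, smul_smul]
  congr 1
  have := norm_ne_zero_iff.mpr hv
  field_simp

theorem radial_sphere {n : ℕ} (x : Sph n) (h : (x : Amb n) ≠ 0) : radial (x : Amb n) h = x := by
  apply Subtype.ext
  simp [radial, mem_sphere_zero_iff_norm.mp x.2]

theorem homExt₂_emb (f : Prd p q → ℂ) (z : Prd p q) : homExt₂ f (emb z) = f z := by
  have h : (emb z).1 ≠ 0 ∧ (emb z).2 ≠ 0 := ⟨emb_fst_ne z, emb_snd_ne z⟩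
  rw [homExt₂, dif_pos h]
  congr 1
  exact Prod.ext (radial_sphere z.1 (emb_fst_ne z)) (radial_sphere z.2 (emb_snd_ne z))

/-- The extension is homogeneous of degree `0` in each variable separately. -/
theorem homExt₂_smul (f : Prd p q → ℂ) {c d : ℝ} (hc : 0 < c) (hd : 0 < d) (v : Amb p × Amb q) :
    homExt₂ f (c • v.1, d • v.2) = homExt₂ f v := by
  by_cases h : v.1 ≠ 0 ∧ v.2 ≠ 0
  · have h' : c • v.1 ≠ 0 ∧ d • v.2 ≠ 0 := ⟨smul_ne_zero hc.ne' h.1, smul_ne_zero hd.ne' h.2⟩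
    rw [homExt₂, dif_pos h', homExt₂, dif_pos h]
    simp only [radial_smul h.1 hc, radial_smul h.2 hd]
  · have h' : ¬ (c • v.1 ≠ 0 ∧ d • v.2 ≠ 0) := by
      simpa [hc.ne', hd.ne'] using h
    rw [homExt₂, dif_neg h', homExt₂, dif_neg h]

theorem fact_finrank (n : ℕ) : Fact (Module.finrank ℝ (Amb n) = n + 1) :=
  ⟨finrank_euclideanSpace_fin⟩

theorem homExt₂_contDiffAt {f : Prd p q → ℂ} (hf : Smooth f) {v : Amb p × Amb q}
    (hv : v.1 ≠ 0) (hv' : v.2 ≠ 0) : ContDiffAt ℝ ∞ (homExt₂ f) v := by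
  have := fact_finrank p
  have := fact_finrank q
  let U : TopologicalSpace.Opens (Amb p × Amb q) := ⟨{v | v.1 ≠ 0 ∧ v.2 ≠ 0},
    (isOpen_ne.preimage continuous_fst).inter (isOpen_ne.preimage continuous_snd)⟩
  let ν : U → Amb p := fun u => ‖(u : Amb p × Amb q).1‖⁻¹ • (u : Amb p × Amb q).1
  let μ : U → Amb q := fun u => ‖(u : Amb p × Amb q).2‖⁻¹ • (u : Amb p × Amb q).2
  have hν : ContMDiff 𝓘(ℝ, Amb p × Amb q) 𝓘(ℝ, Amb p) ∞ ν := by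
    intro u
    refine (contMDiffAt_subtype_iff (f := fun u : Amb p × Amb q => ‖u.1‖⁻¹ • u.1)).mpr ?_
    refine ContDiffAt.contMDiffAt ?_
    exact ((contDiffAt_fst.norm ℝ u.2.1).inv (norm_ne_zero_iff.mpr u.2.1)).smul contDiffAt_fst
  have hμ : ContMDiff 𝓘(ℝ, Amb p × Amb q) 𝓘(ℝ, Amb q) ∞ μ := by
    intro u
    refine (contMDiffAt_subtype_iff (f := fun u : Amb p × Amb q => ‖u.2‖⁻¹ • u.2)).mpr ?_
    refine ContDiffAt.contMDiffAt ?_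
    exact ((contDiffAt_snd.norm ℝ u.2.2).inv (norm_ne_zero_iff.mpr u.2.2)).smul contDiffAt_snd
  have hmν : ∀ u : U, ν u ∈ Metric.sphere (0 : Amb p) 1 := fun u => (radial u.1.1 u.2.1).2
  have hmμ : ∀ u : U, μ u ∈ Metric.sphere (0 : Amb q) 1 := fun u => (radial u.1.2 u.2.2).2
  have h := hf.comp ((hν.codRestrict_sphere hmν).prodMk (hμ.codRestrict_sphere hmμ))
  have h2 : ContMDiffAt 𝓘(ℝ, Amb p × Amb q) 𝓘(ℝ, ℂ) ∞ (homExt₂ f) v := by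
    refine (contMDiffAt_subtype_iff (U := U) (x := ⟨v, hv, hv'⟩)).mp ?_
    convert h.contMDiffAt using 1
    funext u
    have hu : (u : Amb p × Amb q).1 ≠ 0 ∧ (u : Amb p × Amb q).2 ≠ 0 := u.2
    simp only [homExt₂, dif_pos hu, Function.comp]
    rfl
  exact contMDiffAt_iff_contDiffAt.mp h2

theorem homExt₂_contDiffAt_emb {f : Prd p q → ℂ} (hf : Smooth f) (z : Prd p q) :
    ContDiffAt ℝ ∞ (homExt₂ f) (emb z) :=
  homExt₂_contDiffAt hf (emb_fst_ne z) (emb_snd_ne z)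

theorem contMDiff_emb : ContMDiff ((𝓡 p).prod (𝓡 q)) 𝓘(ℝ, Amb p × Amb q) ∞
    (emb : Prd p q → Amb p × Amb q) := by
  have := fact_finrank p
  have := fact_finrank q
  have h1 : ContMDiff ((𝓡 p).prod (𝓡 q)) 𝓘(ℝ, Amb p) ∞ (fun z : Prd p q => (z.1 : Amb p)) :=
    (contMDiff_coe_sphere (E := Amb p) (n := p)).comp contMDiff_fst
  have h2 : ContMDiff ((𝓡 p).prod (𝓡 q)) 𝓘(ℝ, Amb q) ∞ (fun z : Prd p q => (z.2 : Amb q)) :=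
    (contMDiff_coe_sphere (E := Amb q) (n := q)).comp contMDiff_snd
  exact h1.prodMk_space h2

/-- Restrictions to `S^p × S^q` of functions that are smooth near it are smooth. -/
theorem smooth_comp_emb {G : Amb p × Amb q → ℂ} (hG : ∀ z : Prd p q, ContDiffAt ℝ ∞ G (emb z)) :
    Smooth (fun z : Prd p q => G (emb z)) := fun z =>
  ContMDiffAt.comp (I' := 𝓘(ℝ, Amb p × Amb q)) z (hG z).contMDiffAt contMDiff_emb.contMDiffAt

theorem Smooth.tanDer {f : Prd p q → ℂ} (hf : Smooth f) (a : Fin (p + 1) ⊕ Fin (q + 1)) :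
    Smooth (tanDer a f) :=
  smooth_comp_emb (G := fun v => fderiv ℝ (homExt₂ f) v (dir a)) fun z =>
    ((homExt₂_contDiffAt_emb hf z).fderiv_right (m := ∞) le_rfl).clm_apply contDiffAt_const

theorem Smooth.add {f g : Prd p q → ℂ} (hf : Smooth f) (hg : Smooth g) : Smooth (f + g) :=
  ContMDiff.add hf hg

theorem Smooth.smul {f : Prd p q → ℂ} (c : ℂ) (hf : Smooth f) : Smooth (c • f) :=
  (contDiff_const_smul (𝕜 := ℝ) (F := ℂ) c).comp_contMDiff hf

theorem Smooth.zero : Smooth (0 : Prd p q → ℂ) := contMDiff_const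

theorem smooth_const (c : ℂ) : Smooth (fun _ : Prd p q => c) := contMDiff_const

theorem Smooth.mul {f g : Prd p q → ℂ} (hf : Smooth f) (hg : Smooth g) : Smooth (f * g) := by
  have h : ContDiff ℝ ∞ (fun w : ℂ × ℂ => w.1 * w.2) := contDiff_fst.mul contDiff_snd
  exact h.comp_contMDiff (ContMDiff.prodMk_space hf hg)

theorem smooth_crd (a : Fin (p + 1) ⊕ Fin (q + 1)) : Smooth (crd (p := p) (q := q) a) :=
  smooth_comp_emb (G := fun v => (crdR a v : ℂ)) fun _ =>
    (Complex.ofRealCLM.contDiff.comp (crdR a).contDiff).contDiffAt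

/-- The derivative of the extension does not change if the point and the direction are scaled together,
separately in the two variables; so it is determined by its values on `S^p × S^q`. -/
theorem fderiv_homExt₂_smul {f : Prd p q → ℂ} (hf : Smooth f) {v : Amb p × Amb q}
    (hv : v.1 ≠ 0) (hv' : v.2 ≠ 0) {c d : ℝ} (hc : 0 < c) (hd : 0 < d) (u : Amb p × Amb q) :
    fderiv ℝ (homExt₂ f) (c • v.1, d • v.2) (c • u.1, d • u.2) = fderiv ℝ (homExt₂ f) v u := by
  let S : Amb p × Amb q →L[ℝ] Amb p × Amb q :=
    (c • ContinuousLinearMap.id ℝ (Amb p)).prodMap (d • ContinuousLinearMap.id ℝ (Amb q))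
  have hS : ∀ w, S w = (c • w.1, d • w.2) := fun w => rfl
  have h1 : homExt₂ f = homExt₂ f ∘ S := by
    funext w; simp only [Function.comp, hS, homExt₂_smul f hc hd]
  have h2 : DifferentiableAt ℝ (homExt₂ f) (S v) :=
    (homExt₂_contDiffAt hf (v := S v) (smul_ne_zero hc.ne' hv)
      (smul_ne_zero hd.ne' hv')).differentiableAt (by simp)
  have h3 := (h2.hasFDerivAt.comp v S.hasFDerivAt).fderiv
  rw [← h1] at h3
  rw [h3]
  simp [hS]

/-- The homogeneous extension of `T_a f`: the derivative of `homExt₂ f` in the direction `dir a` has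
degree `-1` in the variable to which `a` belongs, and the factor `len a` restores degree `0`. -/
theorem homExt₂_tanDer {f : Prd p q → ℂ} (hf : Smooth f) (a : Fin (p + 1) ⊕ Fin (q + 1))
    {v : Amb p × Amb q} (hv : v.1 ≠ 0) (hv' : v.2 ≠ 0) :
    homExt₂ (tanDer a f) v = (len a v : ℂ) * fderiv ℝ (homExt₂ f) v (dir a) := by
  have hc := inv_pos.mpr (norm_pos_iff.mpr hv)
  have hd := inv_pos.mpr (norm_pos_iff.mpr hv')
  have h : homExt₂ (tanDer a f) v =
      fderiv ℝ (homExt₂ f) (‖v.1‖⁻¹ • v.1, ‖v.2‖⁻¹ • v.2) (dir a) := by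
    rw [homExt₂, dif_pos ⟨hv, hv'⟩]; rfl
  rw [h, ← Complex.real_smul, ← ContinuousLinearMap.map_smul,
    ← fderiv_homExt₂_smul hf hv hv' hc hd]
  congr 1
  rcases a with i | j
  · simp [dir, len, smul_smul, inv_mul_cancel₀ (norm_ne_zero_iff.mpr hv)]
  · simp [dir, len, smul_smul, inv_mul_cancel₀ (norm_ne_zero_iff.mpr hv')]

/-- Two indices belong to the same factor. -/
def SameBlock (a b : Fin (p + 1) ⊕ Fin (q + 1)) : Prop := a.isLeft = b.isLeft

instance (a b : Fin (p + 1) ⊕ Fin (q + 1)) : Decidable (SameBlock a b) :=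
  inferInstanceAs (Decidable (_ = _))

theorem hasFDerivAt_norm_sphere {n : ℕ} (x : Amb n) (hx : ‖x‖ = 1) :
    HasFDerivAt (fun v : Amb n => ‖v‖) (innerSL ℝ x) x := by
  have hx0 : x ≠ 0 := by rintro rfl; simp at hx
  have h1 : DifferentiableAt ℝ (fun v : Amb n => ‖v‖) x := (contDiffAt_norm ℝ hx0).differentiableAt one_ne_zero
  have h2 := (hasStrictFDerivAt_norm_sq x).hasFDerivAt.unique (h1.hasFDerivAt.pow 2)
  have h3 : fderiv ℝ (fun v : Amb n => ‖v‖) x = innerSL ℝ x := by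
    ext u
    have := congrArg (fun L => L u) h2
    simp [hx] at this
    simp [this]
  exact h3 ▸ h1.hasFDerivAt

theorem fderiv_len (a b : Fin (p + 1) ⊕ Fin (q + 1)) (z : Prd p q) :
    HasFDerivAt (len b) (fderiv ℝ (len b) (emb z)) (emb z) ∧
      fderiv ℝ (len b) (emb z) (dir a) = if SameBlock a b then crdR a (emb z) else 0 := by
  rcases b with j | j
  · have h := (hasFDerivAt_norm_sphere (emb z).1 (norm_emb_fst z)).comp (emb z)
      (hasFDerivAt_fst (𝕜 := ℝ) (E := Amb p) (F := Amb q))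
    have h' : HasFDerivAt (len (p := p) (q := q) (.inl j)) _ (emb z) := h
    rw [h'.fderiv]
    refine ⟨h', ?_⟩
    rcases a with i | i <;> simp [SameBlock, dir, crdR, EuclideanSpace.inner_single_right]
  · have h := (hasFDerivAt_norm_sphere (emb z).2 (norm_emb_snd z)).comp (emb z)
      (hasFDerivAt_snd (𝕜 := ℝ) (E := Amb p) (F := Amb q))
    have h' : HasFDerivAt (len (p := p) (q := q) (.inr j)) _ (emb z) := h
    rw [h'.fderiv]
    refine ⟨h', ?_⟩
    rcases a with i | i <;> simp [SameBlock, dir, crdR, EuclideanSpace.inner_single_right]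

theorem len_emb (b : Fin (p + 1) ⊕ Fin (q + 1)) (z : Prd p q) : len b (emb z) = 1 := by
  rcases b with j | j
  · exact norm_emb_fst z
  · exact norm_emb_snd z

theorem eventually_emb_ne (z : Prd p q) :
    ∀ᶠ v in 𝓝 (emb z), v.1 ≠ 0 ∧ v.2 ≠ 0 :=
  (continuous_fst.continuousAt.eventually_ne (emb_fst_ne z)).and
    (continuous_snd.continuousAt.eventually_ne (emb_snd_ne z))

/-- Two tangential derivatives in terms of the second derivative of the homogeneous extension. The
extra term comes from the factor `len b` in the extension of `T_b f`. -/
theorem tanDer_tanDer {f : Prd p q → ℂ} (hf : Smooth f) (a b : Fin (p + 1) ⊕ Fin (q + 1))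
    (z : Prd p q) : tanDer a (tanDer b f) z =
      (if SameBlock a b then crd a z else 0) * tanDer b f z +
        fderiv ℝ (fderiv ℝ (homExt₂ f)) (emb z) (dir a) (dir b) := by
  have hev : homExt₂ (tanDer b f) =ᶠ[𝓝 (emb z)]
      fun v => (len b v : ℂ) * fderiv ℝ (homExt₂ f) v (dir b) :=
    (eventually_emb_ne z).mono fun v hv => homExt₂_tanDer hf b hv.1 hv.2
  have h1 : HasFDerivAt (fun v => (len b v : ℂ)) _ (emb z) :=
    Complex.ofRealCLM.hasFDerivAt.comp (emb z) (fderiv_len a b z).1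
  have h2 : DifferentiableAt ℝ (fderiv ℝ (homExt₂ f)) (emb z) :=
    ((homExt₂_contDiffAt_emb hf z).fderiv_right (m := ∞) le_rfl).differentiableAt (by simp)
  have h3 := h2.hasFDerivAt.clm_apply (hasFDerivAt_const (𝕜 := ℝ) (dir b) (emb z))
  have h4 := (h1.mul h3).fderiv
  rw [tanDer, hev.fderiv_eq]
  change fderiv ℝ ((fun v => (len b v : ℂ)) * fun v => fderiv ℝ (homExt₂ f) v (dir b)) _ _ = _
  rw [h4]
  have h5 := (fderiv_len a b z).2
  simp only [len_emb, add_apply, smul_apply,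
    ContinuousLinearMap.comp_apply, h5, Complex.ofReal_one, one_smul, ContinuousLinearMap.flip_apply]
  simp only [crd, tanDer]
  split_ifs <;> (simp; try ring)

/-- The commutation relation `[T_a, T_b] = x_a T_b - x_b T_a` within a block. -/
theorem tanDer_comm {f : Prd p q → ℂ} (hf : Smooth f) (a b : Fin (p + 1) ⊕ Fin (q + 1))
    (z : Prd p q) : tanDer a (tanDer b f) z - tanDer b (tanDer a f) z =
      if SameBlock a b then crd a z * tanDer b f z - crd b z * tanDer a f z else 0 := by
  have hs : IsSymmSndFDerivAt ℝ (homExt₂ f) (emb z) :=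
    (contDiffAt_infty.mp (homExt₂_contDiffAt_emb hf z) 2).isSymmSndFDerivAt (by simp)
  have hb : SameBlock b a ↔ SameBlock a b := eq_comm
  rw [tanDer_tanDer hf, tanDer_tanDer hf, hs.eq (dir a) (dir b)]
  simp only [hb]
  split_ifs <;> ring

theorem homExt₂_mul (f g : Prd p q → ℂ) : homExt₂ (f * g) = homExt₂ f * homExt₂ g := by
  funext v
  by_cases h : v.1 ≠ 0 ∧ v.2 ≠ 0
  · simp only [homExt₂, dif_pos h, Pi.mul_apply]
  · simp only [homExt₂, dif_neg h, Pi.mul_apply, mul_zero]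

theorem homExt₂_add (f g : Prd p q → ℂ) : homExt₂ (f + g) = homExt₂ f + homExt₂ g := by
  funext v
  by_cases h : v.1 ≠ 0 ∧ v.2 ≠ 0
  · simp only [homExt₂, dif_pos h, Pi.add_apply]
  · simp only [homExt₂, dif_neg h, Pi.add_apply, add_zero]

theorem homExt₂_const_smul (c : ℂ) (f : Prd p q → ℂ) : homExt₂ (c • f) = c • homExt₂ f := by
  funext v
  by_cases h : v.1 ≠ 0 ∧ v.2 ≠ 0
  · simp only [homExt₂, dif_pos h, Pi.smul_apply]
  · simp only [homExt₂, dif_neg h, Pi.smul_apply, smul_zero]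

theorem homExt₂_differentiableAt {f : Prd p q → ℂ} (hf : Smooth f) (z : Prd p q) :
    DifferentiableAt ℝ (homExt₂ f) (emb z) :=
  (homExt₂_contDiffAt_emb hf z).differentiableAt (by simp)

theorem tanDer_mul {f g : Prd p q → ℂ} (hf : Smooth f) (hg : Smooth g)
    (a : Fin (p + 1) ⊕ Fin (q + 1)) :
    tanDer a (f * g) = tanDer a f * g + f * tanDer a g := by
  funext z
  simp only [tanDer, homExt₂_mul, Pi.add_apply, Pi.mul_apply,
    fderiv_mul (homExt₂_differentiableAt hf z) (homExt₂_differentiableAt hg z),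
    add_apply, smul_apply, homExt₂_emb, smul_eq_mul]
  ring

theorem tanDer_add {f g : Prd p q → ℂ} (hf : Smooth f) (hg : Smooth g)
    (a : Fin (p + 1) ⊕ Fin (q + 1)) : tanDer a (f + g) = tanDer a f + tanDer a g := by
  funext z
  simp only [tanDer, homExt₂_add, Pi.add_apply,
    fderiv_add (homExt₂_differentiableAt hf z) (homExt₂_differentiableAt hg z),
    add_apply]

theorem tanDer_smul {f : Prd p q → ℂ} (c : ℂ) (hf : Smooth f)
    (a : Fin (p + 1) ⊕ Fin (q + 1)) : tanDer a (c • f) = c • tanDer a f := by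
  funext z
  simp only [tanDer, homExt₂_const_smul, Pi.smul_apply,
    fderiv_const_smul (homExt₂_differentiableAt hf z) c, smul_apply]

theorem crdR_dir (a b : Fin (p + 1) ⊕ Fin (q + 1)) :
    crdR b (dir a : Amb p × Amb q) = if a = b then 1 else 0 := by
  rcases a with i | i <;> rcases b with j | j <;> simp [crdR, dir, eq_comm]

theorem homExt₂_crd (b : Fin (p + 1) ⊕ Fin (q + 1)) {v : Amb p × Amb q}
    (hv : v.1 ≠ 0) (hv' : v.2 ≠ 0) : homExt₂ (crd b) v = (((len b v)⁻¹ * crdR b v : ℝ) : ℂ) := by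
  rw [homExt₂, dif_pos ⟨hv, hv'⟩]
  rcases b with j | j <;> simp [crd, crdR, emb, radial, len]

/-- The relation `T_a x_b = δ_{ab} - x_a x_b` within a block: `T_a` is the derivative along the
projection of the `a`-th basis vector to the tangent space. -/
theorem tanDer_crd (a b : Fin (p + 1) ⊕ Fin (q + 1)) (z : Prd p q) :
    tanDer a (crd b) z =
      if SameBlock a b then (if a = b then 1 else 0) - crd a z * crd b z else 0 := by
  have hev : (fun v => (len b v : ℂ) * homExt₂ (crd b) v) =ᶠ[𝓝 (emb z)]
      fun v => (crdR b v : ℂ) := (eventually_emb_ne z).mono fun v hv => by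
    have : len b v ≠ 0 := by
      rcases b with j | j
      · exact norm_ne_zero_iff.mpr hv.1
      · exact norm_ne_zero_iff.mpr hv.2
    simp only [homExt₂_crd b hv.1 hv.2, ← Complex.ofReal_mul]
    rw [mul_inv_cancel_left₀ this]
  have h1 : HasFDerivAt (fun v => (len b v : ℂ)) _ (emb z) :=
    Complex.ofRealCLM.hasFDerivAt.comp (emb z) (fderiv_len a b z).1
  have h2 := (h1.mul (homExt₂_differentiableAt (smooth_crd b) z).hasFDerivAt).fderiv
  have hlin : HasFDerivAt (fun v : Amb p × Amb q => (crdR b v : ℂ))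
      (Complex.ofRealCLM.comp (crdR b)) (emb z) :=
    Complex.ofRealCLM.hasFDerivAt.comp (emb z) (crdR b).hasFDerivAt
  have h4 := hev.fderiv_eq (𝕜 := ℝ)
  change fderiv ℝ ((fun v => (len b v : ℂ)) * homExt₂ (crd b)) _ = _ at h4
  rw [h2, hlin.fderiv] at h4
  have h5 := congrArg (fun L : Amb p × Amb q →L[ℝ] ℂ => L (dir a)) h4
  have h6 := (fderiv_len a b z).2
  simp only [len_emb, homExt₂_emb, add_apply, smul_apply,
    ContinuousLinearMap.comp_apply, h6, crdR_dir, Complex.ofReal_one, one_smul] at h5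
  rw [tanDer, eq_sub_of_add_eq h5]
  by_cases hab : SameBlock a b
  · simp only [hab, if_true, crd, smul_eq_mul, Complex.ofRealCLM_apply]
    split_ifs <;> simp [mul_comm]
  · have : a ≠ b := fun h => hab (by rw [h]; rfl)
    simp [hab, this]

theorem sum_crd_inl (z : Prd p q) : ∑ i, crd (.inl i) z * crd (.inl i) z = 1 := by
  have h := EuclideanSpace.norm_sq_eq (emb z).1
  rw [norm_emb_fst] at h
  simp only [crd, crdR, Sum.elim_inl, ← Complex.ofReal_mul, ← Complex.ofReal_sum]
  norm_cast
  simp [Real.norm_eq_abs, sq] at h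
  exact h.symm

theorem sum_crd_inr (z : Prd p q) : ∑ i, crd (.inr i) z * crd (.inr i) z = 1 := by
  have h := EuclideanSpace.norm_sq_eq (emb z).2
  rw [norm_emb_snd] at h
  simp only [crd, crdR, Sum.elim_inr, ← Complex.ofReal_mul, ← Complex.ofReal_sum]
  norm_cast
  simp [Real.norm_eq_abs, sq] at h
  exact h.symm

theorem eq_sum_single {n : ℕ} (v : Amb n) : v = ∑ i, v i • EuclideanSpace.single i (1 : ℝ) := by
  ext k; simp [Finset.sum_apply, Pi.single_apply]

/-- The derivative of the homogeneous extension at a point of `S^p × S^q` in terms of the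
tangential derivatives. -/
theorem fderiv_eq_sum_tanDer (f : Prd p q → ℂ) (z : Prd p q) (u : Amb p × Amb q) :
    fderiv ℝ (homExt₂ f) (emb z) u = ∑ a, (crdR a u : ℂ) * tanDer a f z := by
  have hu : u = ∑ a, crdR a u • dir a := by
    rw [Fintype.sum_sum_type]
    refine Prod.ext ?_ ?_
    · simpa [crdR, dir, Prod.fst_sum] using eq_sum_single u.1
    · simpa [crdR, dir, Prod.snd_sum] using eq_sum_single u.2
  conv_lhs => rw [hu]
  simp only [map_sum, ContinuousLinearMap.map_smul, Complex.real_smul, tanDer]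

/-- The derivative in the radial direction of the first factor vanishes. -/
theorem fderiv_radial_fst {f : Prd p q → ℂ} (hf : Smooth f) (z : Prd p q) :
    fderiv ℝ (homExt₂ f) (emb z) ((emb z).1, 0) = 0 := by
  have hline : HasDerivAt (fun t : ℝ => emb z + t • ((emb z).1, (0 : Amb q))) ((emb z).1, 0) 0 := by
    simpa using ((hasDerivAt_id (0 : ℝ)).smul_const ((emb z).1, (0 : Amb q))).const_add (emb z)
  have hF : HasFDerivAt (homExt₂ f) (fderiv ℝ (homExt₂ f) (emb z))
      (emb z + (0 : ℝ) • ((emb z).1, (0 : Amb q))) := by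
    simpa using (homExt₂_differentiableAt hf z).hasFDerivAt
  have h := hF.comp_hasDerivAt (0 : ℝ) hline
  have h' : (homExt₂ f ∘ fun t : ℝ => emb z + t • ((emb z).1, (0 : Amb q))) =ᶠ[𝓝 0]
      fun _ => f z := by
    filter_upwards [eventually_gt_nhds (show (-1 : ℝ) < 0 by norm_num)] with t ht
    have := homExt₂_smul f (show 0 < 1 + t by linarith) one_pos (emb z)
    rw [homExt₂_emb] at this
    rw [← this]
    simp only [Function.comp]
    congr 1
    refine Prod.ext ?_ ?_
    · simp [add_smul]
    · simp
  exact h.unique ((hasDerivAt_const (0 : ℝ) (f z)).congr_of_eventuallyEq h')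

/-- The derivative in the radial direction of the second factor vanishes. -/
theorem fderiv_radial_snd {f : Prd p q → ℂ} (hf : Smooth f) (z : Prd p q) :
    fderiv ℝ (homExt₂ f) (emb z) (0, (emb z).2) = 0 := by
  have hline : HasDerivAt (fun t : ℝ => emb z + t • ((0 : Amb p), (emb z).2)) (0, (emb z).2) 0 := by
    simpa using ((hasDerivAt_id (0 : ℝ)).smul_const ((0 : Amb p), (emb z).2)).const_add (emb z)
  have hF : HasFDerivAt (homExt₂ f) (fderiv ℝ (homExt₂ f) (emb z))
      (emb z + (0 : ℝ) • ((0 : Amb p), (emb z).2)) := by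
    simpa using (homExt₂_differentiableAt hf z).hasFDerivAt
  have h := hF.comp_hasDerivAt (0 : ℝ) hline
  have h' : (homExt₂ f ∘ fun t : ℝ => emb z + t • ((0 : Amb p), (emb z).2)) =ᶠ[𝓝 0]
      fun _ => f z := by
    filter_upwards [eventually_gt_nhds (show (-1 : ℝ) < 0 by norm_num)] with t ht
    have := homExt₂_smul f one_pos (show 0 < 1 + t by linarith) (emb z)
    rw [homExt₂_emb] at this
    rw [← this]
    simp only [Function.comp]
    congr 1
    refine Prod.ext ?_ ?_
    · simp
    · simp [add_smul]
  exact h.unique ((hasDerivAt_const (0 : ℝ) (f z)).congr_of_eventuallyEq h')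

theorem sum_crd_tanDer_inl {f : Prd p q → ℂ} (hf : Smooth f) (z : Prd p q) :
    ∑ i, crd (.inl i) z * tanDer (.inl i) f z = 0 := by
  have h := fderiv_radial_fst hf z
  rw [fderiv_eq_sum_tanDer, Fintype.sum_sum_type] at h
  simpa [crdR, crd] using h

theorem sum_crd_tanDer_inr {f : Prd p q → ℂ} (hf : Smooth f) (z : Prd p q) :
    ∑ i, crd (.inr i) z * tanDer (.inr i) f z = 0 := by
  have h := fderiv_radial_snd hf z
  rw [fderiv_eq_sum_tanDer, Fintype.sum_sum_type] at h
  simpa [crdR, crd] using h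

theorem homExt_slice_fst (f : Prd p q → ℂ) (y : Sph q) (v : Amb p) :
    homExt (fun x => f (x, y)) v = homExt₂ f (v, (y : Amb q)) := by
  have hy := ne_zero_of_mem_unit_sphere y
  by_cases hv : v = 0
  · rw [homExt, homExt₂, dif_neg (by simpa using hv), dif_neg (by simp [hv])]
  · rw [homExt, homExt₂, dif_pos hv, dif_pos ⟨hv, hy⟩, radial_sphere y hy]

theorem homExt_slice_snd (f : Prd p q → ℂ) (x : Sph p) (w : Amb q) :
    homExt (fun y => f (x, y)) w = homExt₂ f ((x : Amb p), w) := by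
  have hx := ne_zero_of_mem_unit_sphere x
  by_cases hw : w = 0
  · rw [homExt, homExt₂, dif_neg (by simpa using hw), dif_neg (by simp [hw])]
  · rw [homExt, homExt₂, dif_pos hw, dif_pos ⟨hx, hw⟩, radial_sphere x hx]

theorem iteratedFDeriv_two_comp_affine {E E' : Type*} [NormedAddCommGroup E] [NormedSpace ℝ E]
    [NormedAddCommGroup E'] [NormedSpace ℝ E'] {F : E' → ℂ} (L : E →L[ℝ] E') (c : E') {x : E}
    (hF : ContDiffAt ℝ ∞ F (L x + c)) (u w : E) :
    iteratedFDeriv ℝ 2 (fun v => F (L v + c)) x ![u, w] =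
      fderiv ℝ (fderiv ℝ F) (L x + c) (L u) (L w) := by
  have hι : ∀ v, HasFDerivAt (fun v => L v + c) L v := fun v => L.hasFDerivAt.add_const c
  have hcont : Tendsto (fun v => L v + c) (𝓝 x) (𝓝 (L x + c)) := (hι x).continuousAt
  have hev : fderiv ℝ (fun v => F (L v + c)) =ᶠ[𝓝 x] fun v => (fderiv ℝ F (L v + c)).comp L := by
    filter_upwards [hcont.eventually ((contDiffAt_infty.mp hF 1).eventually (by simp))] with v hv
    exact ((hv.differentiableAt (by simp)).hasFDerivAt.comp v (hι v)).fderiv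
  have h2 : DifferentiableAt ℝ (fderiv ℝ F) (L x + c) :=
    (hF.fderiv_right (m := ∞) le_rfl).differentiableAt (by simp)
  have h3 := (h2.hasFDerivAt.comp x (hι x)).clm_comp (hasFDerivAt_const (𝕜 := ℝ) L x)
  rw [iteratedFDeriv_two_apply, hev.fderiv_eq]
  change fderiv ℝ (fun v => ((fderiv ℝ F ∘ fun v => L v + c) v).comp L) x _ _ = _
  rw [h3.fderiv]
  simp

/-- `Δ_{S^p} = -∑ T_i²`: the first-order terms in `T_i²` sum to `∑ x_i T_i = 0`. -/
theorem lapP_eq_sum_tanDer {f : Prd p q → ℂ} (hf : Smooth f) (z : Prd p q) :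
    lapP f z = -∑ i, tanDer (.inl i) (tanDer (.inl i) f) z := by
  have h := sum_crd_tanDer_inl hf z
  simp only [tanDer_tanDer hf, SameBlock, if_true, Finset.sum_add_distrib, h, zero_add]
  have hx : ∀ v : Amb p, homExt (fun x => f (x, z.2)) v =
      homExt₂ f (ContinuousLinearMap.inl ℝ (Amb p) (Amb q) v + (0, (z.2 : Amb q))) := fun v => by
    rw [homExt_slice_fst]; simp
  have hz : ContinuousLinearMap.inl ℝ (Amb p) (Amb q) z.1 + (0, (z.2 : Amb q)) = emb z := by
    simp [emb]
  rw [lapP, sphLap, funext hx,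
    InnerProductSpace.laplacian_eq_iteratedFDeriv_orthonormalBasis _
      (EuclideanSpace.basisFun (Fin (p + 1)) ℝ)]
  simp only [EuclideanSpace.basisFun_apply]
  congr 1
  refine Finset.sum_congr rfl fun i _ => ?_
  rw [iteratedFDeriv_two_comp_affine _ _ (by rw [hz]; exact homExt₂_contDiffAt_emb hf z), hz]
  rfl

/-- `Δ_{S^q} = -∑ T_l²`, as for the first factor. -/
theorem lapQ_eq_sum_tanDer {f : Prd p q → ℂ} (hf : Smooth f) (z : Prd p q) :
    lapQ f z = -∑ i, tanDer (.inr i) (tanDer (.inr i) f) z := by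
  have h := sum_crd_tanDer_inr hf z
  simp only [tanDer_tanDer hf, SameBlock, if_true, Finset.sum_add_distrib, h, zero_add]
  have hx : ∀ v : Amb q, homExt (fun y => f (z.1, y)) v =
      homExt₂ f (ContinuousLinearMap.inr ℝ (Amb p) (Amb q) v + ((z.1 : Amb p), 0)) := fun v => by
    rw [homExt_slice_snd]; simp
  have hz : ContinuousLinearMap.inr ℝ (Amb p) (Amb q) z.2 + ((z.1 : Amb p), 0) = emb z := by
    simp [emb]
  rw [lapQ, sphLap, funext hx,
    InnerProductSpace.laplacian_eq_iteratedFDeriv_orthonormalBasis _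
      (EuclideanSpace.basisFun (Fin (q + 1)) ℝ)]
  simp only [EuclideanSpace.basisFun_apply]
  congr 1
  refine Finset.sum_congr rfl fun i _ => ?_
  rw [iteratedFDeriv_two_comp_affine _ _ (by rw [hz]; exact homExt₂_contDiffAt_emb hf z), hz]
  rfl

/-- The Lie derivative along the conformal vector field of `X ∈ 𝔤` in terms of the tangential
derivatives. -/
theorem lieDer_eq_sum (X : lieG p q) (f : Prd p q → ℂ) (z : Prd p q) :
    lieDer X f z = ∑ a, ∑ b, (X.1 a b : ℂ) * (crd b z * tanDer a f z) := by
  have h : ∀ a, (crdR a (linField X z) : ℂ) = ∑ b, (X.1 a b : ℂ) * crd b z := by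
    have hs : ∀ b, Sum.elim (z.1 : Amb p) (z.2 : Amb q) b = crdR b (emb z) := by
      rintro (j | j) <;> simp [crdR, emb]
    have h' : ∀ a, crdR a (linField X z) = ∑ b, X.1 a b * crdR b (emb z) := by
      rintro (i | i) <;>
        simp only [← hs] <;> rfl
    intro a
    rw [h']
    push_cast
    rfl
  change fderiv ℝ (homExt₂ f) (emb z) (linField X z) = _
  simp only [fderiv_eq_sum_tanDer, h, Finset.sum_mul, mul_assoc]

theorem confFactor_eq_sum (X : lieG p q) (z : Prd p q) :
    (confFactor X z : ℂ) = -∑ i, ∑ b, (X.1 (.inl i) b : ℂ) * (crd (.inl i) z * crd b z) := by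
  have hs : ∀ b, Sum.elim (z.1 : Amb p) (z.2 : Amb q) b = crdR b (emb z) := by
    rintro (j | j) <;> simp [crdR, emb]
  have hs' : ∀ i, (z.1 : Amb p) i = crdR (p := p) (q := q) (.inl i) (emb z) := fun i => hs (.inl i)
  simp only [confFactor, linField, PiLp.inner_apply, Matrix.mulVec, dotProduct, hs, hs', crd,
    RCLike.inner_apply, conj_trivial]
  push_cast
  simp only [Finset.sum_mul]
  congr 1
  refine Finset.sum_congr rfl fun i _ => Finset.sum_congr rfl fun b _ => by ring

/-! ### The algebra of tangential derivatives on a sphere -/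

/-- The relations between the multiplications `x i` by the coordinates and the tangential
derivatives `T i` on the sphere `S^n`. -/
structure SphereRel {R : Type*} [Ring R] {n : ℕ} (x T : Fin (n + 1) → R) : Prop where
  xx : ∀ i j, x i * x j = x j * x i
  Tx : ∀ i j, T i * x j - x j * T i = (if i = j then 1 else 0) - x i * x j
  TT : ∀ i j, T i * T j - T j * T i = x i * T j - x j * T i
  sum_xx : ∑ i, x i * x i = 1
  sum_xT : ∑ i, x i * T i = 0

namespace SphereRel

variable {R : Type*} [Ring R] {n : ℕ} {x T : Fin (n + 1) → R}

/-- `[Δ, x_k] = n x_k - 2 T_k`, where `Δ = -∑ T_i²`. -/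
theorem lap_x (h : SphereRel x T) (k : Fin (n + 1)) :
    (-∑ i, T i * T i) * x k - x k * (-∑ i, T i * T i) = (n : R) * x k - 2 * T k := by
  have h1 : ∀ i, T i * T i * x k - x k * (T i * T i) = 2 * ((if i = k then 1 else 0) * T i)
      - (if i = k then 1 else 0) * x i - 2 * (x k * (x i * T i)) - x k
      + 2 * (x i * x i * x k) := by
    intro i
    have hδ : T i * (if i = k then (1 : R) else 0) = (if i = k then 1 else 0) * T i := by
      split_ifs <;> simp
    have hδ' : x i * (if i = k then (1 : R) else 0) = (if i = k then 1 else 0) * x i := by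
      split_ifs <;> simp
    have h0 := h.Tx i i
    rw [if_pos rfl] at h0
    linear_combination (norm := noncomm_ring) T i * h.Tx i k + h.Tx i k * T i - h0 * x k
      - x i * h.Tx i k + hδ - hδ' - h.xx i k * (2 * T i)
  have h2 := Finset.sum_congr rfl fun i (_ : i ∈ Finset.univ) => h1 i
  simp only [Finset.sum_sub_distrib, Finset.sum_add_distrib, ← Finset.mul_sum, ← Finset.sum_mul,
    h.sum_xx, h.sum_xT, ite_mul, one_mul, zero_mul, Finset.sum_ite_eq', Finset.mem_univ, if_true,
    Finset.sum_const, Finset.card_univ, Fintype.card_fin, nsmul_eq_mul] at h2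
  push_cast at h2
  linear_combination (norm := noncomm_ring) -h2

/-- `[Δ, T_k] = (2 - n) T_k - 2 x_k Δ`, where `Δ = -∑ T_i²`. -/
theorem lap_T (h : SphereRel x T) (k : Fin (n + 1)) :
    (-∑ i, T i * T i) * T k - T k * (-∑ i, T i * T i) =
      (2 - n : R) * T k - 2 * (x k * (-∑ i, T i * T i)) := by
  have h1 : ∀ i, T i * T i * T k - T k * (T i * T i) = T k + 2 * (x i * T i * T k)
      - 2 * (x i * x i * T k) - 2 * (x k * (T i * T i)) - (if i = k then 1 else 0) * T i
      + 2 * (x k * (x i * T i)) := by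
    intro i
    have h0 := h.Tx i i
    rw [if_pos rfl] at h0
    linear_combination (norm := noncomm_ring) T i * h.TT i k + h.TT i k * T i + h0 * T k
      - h.Tx i k * T i - x i * h.TT i k + h.xx i k * (2 * T i)
  have h2 := Finset.sum_congr rfl fun i (_ : i ∈ Finset.univ) => h1 i
  simp only [Finset.sum_sub_distrib, Finset.sum_add_distrib, ← Finset.mul_sum, ← Finset.sum_mul,
    h.sum_xx, h.sum_xT, ite_mul, one_mul, zero_mul, Finset.sum_ite_eq', Finset.mem_univ, if_true,
    Finset.sum_const, Finset.card_univ, Fintype.card_fin, nsmul_eq_mul] at h2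
  push_cast at h2
  linear_combination (norm := noncomm_ring) -h2

/-- The coordinates raise or lower the square root of `Δ + ((n-1)/2)²` by one: the double
commutator relation `[Δ, [Δ, x]] = 2 (Δ x + x Δ) + n (n - 2) x`. -/
theorem double_comm (h : SphereRel x T) (k : Fin (n + 1)) {A : R} (hA : A = -∑ i, T i * T i) :
    A * (A * x k - x k * A) - (A * x k - x k * A) * A =
      2 * (A * x k + x k * A) + (n * (n - 2) : R) * x k := by
  have h1 := h.lap_x k
  have h2 := h.lap_T k
  rw [← hA] at h1 h2
  have hn : A * n = n * A := (Nat.cast_commute n A).symm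
  linear_combination (norm := noncomm_ring) A * h1 - h1 * A - 2 * h2 + n * h1 - 2 * h1
    + hn * x k

/-- The Laplacian commutes with the rotation fields `x_i T_j - x_j T_i`. -/
theorem rot_comm (h : SphereRel x T) (i j : Fin (n + 1)) {A : R} (hA : A = -∑ i, T i * T i) :
    A * (x i * T j - x j * T i) = (x i * T j - x j * T i) * A := by
  have h1 := h.lap_x
  have h2 := h.lap_T
  simp only [← hA] at h1 h2
  have hn : ∀ a : R, a * n = n * a := fun a => (Nat.cast_commute n a).symm
  linear_combination (norm := noncomm_ring) h1 i * T j + x i * h2 j - h1 j * T i - x j * h2 i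
    - 2 * h.TT i j - hn (x i) * T j + hn (x j) * T i - 2 * (h.xx i j) * A

/-- `∑ x_i [Δ, x_i] = n`; compared with the eigenvalues of `Δ`, this shows that no component of
multiplication by the coordinates can vanish. -/
theorem sum_x_comm (h : SphereRel x T) {A : R} (hA : A = -∑ i, T i * T i) :
    ∑ i, x i * (A * x i - x i * A) = (n : R) := by
  have h1 := h.lap_x
  simp only [← hA] at h1
  have h2 : ∀ i, x i * ((n : R) * x i - 2 * T i) = n * (x i * x i) - 2 * (x i * T i) := fun i => by
    have hn : x i * n = n * x i := (Nat.cast_commute n (x i)).symm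
    linear_combination (norm := noncomm_ring) hn * x i
  simp only [h1, h2, Finset.sum_sub_distrib, ← Finset.mul_sum, h.sum_xx, h.sum_xT]
  simp

/-- The Laplacian of the sphere is the Casimir operator of the rotations. -/
theorem casimir (h : SphereRel x T) {A : R} (hA : A = -∑ i, T i * T i) :
    ∑ i, ∑ j, (x i * T j - x j * T i) * (x i * T j - x j * T i) = -(2 * A) := by
  have h1 : ∀ i j, (x i * T j - x j * T i) * (x i * T j - x j * T i) =
      x i * x i * (T j * T j) + (if j = i then 1 else 0) * (x i * T j)
      - x i * x i * (x j * T j)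
      + (x j * x j * (T i * T i) + (if i = j then 1 else 0) * (x j * T i) - x j * x j * (x i * T i))
      - (x i * x j * (T j * T i) + x i * T i - x i * (x j * x j) * T i)
      - (x j * x i * (T i * T j) + x j * T j - x j * (x i * x i) * T j) := by
    intro i j
    have hj := h.Tx j j
    have hi := h.Tx i i
    rw [if_pos rfl] at hi hj
    have hδ : x i * (if j = i then (1 : R) else 0) = (if j = i then 1 else 0) * x i := by
      split_ifs <;> simp
    have hδ' : x j * (if i = j then (1 : R) else 0) = (if i = j then 1 else 0) * x j := by
      split_ifs <;> simp
    linear_combination (norm := noncomm_ring) x i * h.Tx j i * T j + x j * h.Tx i j * T i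
      - x i * hj * T i - x j * hi * T j + hδ * T j + hδ' * T i - x i * h.xx j i * T j
      - x j * h.xx i j * T i
  have h2 : ∀ i j, x i * x j * (T j * T i) = x i * (x j * T j * T i) := fun i j => by noncomm_ring
  have h3 : ∀ i j, x i * (x j * x j) * T i = x i * (x j * x j * T i) := fun i j => by noncomm_ring
  simp only [h1, h2, h3, Finset.sum_sub_distrib, Finset.sum_add_distrib, ← Finset.mul_sum, ← Finset.sum_mul,
    h.sum_xx, h.sum_xT, ite_mul, one_mul, zero_mul, Finset.sum_ite_eq', Finset.sum_ite_eq,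
    Finset.mem_univ, if_true, mul_zero, Finset.sum_const, Finset.card_univ, Fintype.card_fin, hA]
  have h4 : ∑ a, ∑ b, x b * (x a * T a * T b) = 0 := by
    rw [Finset.sum_comm]
    simp only [← Finset.mul_sum, ← Finset.sum_mul, h.sum_xT, zero_mul, mul_zero,
      Finset.sum_const_zero]
  have h5 : ∑ a, ∑ b, x b * (x a * x a * T b) = 0 := by
    rw [Finset.sum_comm]
    simp only [← Finset.mul_sum, ← Finset.sum_mul, h.sum_xx, one_mul, h.sum_xT]
  simp only [mul_smul_comm, ← Finset.smul_sum, h.sum_xT, h4, h5, smul_zero]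
  noncomm_ring

end SphereRel

/-! ### The operators on smooth functions on `S^p × S^q` -/


/-- The space `C^∞(S^p × S^q)`. -/
def smoothFun (p q : ℕ) : Submodule ℂ (Prd p q → ℂ) where
  carrier := {f | Smooth f}
  add_mem' := Smooth.add
  zero_mem' := Smooth.zero
  smul_mem' c _ hf := Smooth.smul c hf

/-- The space `C^∞(S^p × S^q)` as a type of its own, on which operators can be composed. -/
def SmoothFun (p q : ℕ) : Type := smoothFun p q

instance : AddCommGroup (SmoothFun p q) := inferInstanceAs (AddCommGroup (smoothFun p q))

instance : Module ℂ (SmoothFun p q) := inferInstanceAs (Module ℂ (smoothFun p q))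

/-- The inclusion of the smooth functions into all functions. -/
def SmoothFun.incl (p q : ℕ) : SmoothFun p q →ₗ[ℂ] (Prd p q → ℂ) := (smoothFun p q).subtype

namespace SmoothFun

@[simp] theorem add_val (f g : SmoothFun p q) : (f + g).1 = f.1 + g.1 := rfl
@[simp] theorem sub_val (f g : SmoothFun p q) : (f - g).1 = f.1 - g.1 := rfl
@[simp] theorem neg_val (f : SmoothFun p q) : (-f).1 = -f.1 := rfl
@[simp] theorem zero_val : (0 : SmoothFun p q).1 = 0 := rfl
@[simp] theorem smul_val (c : ℂ) (f : SmoothFun p q) : (c • f).1 = c • f.1 := rfl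

@[simp] theorem sum_val {ι : Type*} (s : Finset ι) (f : ι → SmoothFun p q) :
    (∑ i ∈ s, f i).1 = ∑ i ∈ s, (f i).1 := map_sum (SmoothFun.incl p q) f s

end SmoothFun

theorem Smooth.sum {ι : Type*} {s : Finset ι} {f : ι → Prd p q → ℂ} (hf : ∀ i, Smooth (f i)) :
    Smooth (fun z => ∑ i ∈ s, f i z) := by
  have := Submodule.sum_mem (smoothFun p q) (t := s) (f := f) fun i _ => hf i
  simp only [Finset.sum_fn] at this
  exact this

theorem Smooth.neg {f : Prd p q → ℂ} (hf : Smooth f) : Smooth (-f) :=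
  (smoothFun p q).neg_mem hf

theorem Smooth.lapP {f : Prd p q → ℂ} (hf : Smooth f) : Smooth (lapP f) := by
  rw [funext (lapP_eq_sum_tanDer hf)]
  exact (Smooth.sum fun i => (hf.tanDer _).tanDer _).neg

/-- Multiplication by the coordinate function `x_a`. -/
def mulX (a : Fin (p + 1) ⊕ Fin (q + 1)) : Module.End ℂ (SmoothFun p q) where
  toFun f := ⟨crd a * f.1, (smooth_crd a).mul f.2⟩
  map_add' _ _ := Subtype.ext (mul_add _ _ _)
  map_smul' c f := Subtype.ext (mul_smul_comm c (crd a) f.1)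

/-- The tangential derivative `T_a` as an operator on smooth functions. -/
def tanOp (a : Fin (p + 1) ⊕ Fin (q + 1)) : Module.End ℂ (SmoothFun p q) where
  toFun f := ⟨tanDer a f.1, Smooth.tanDer f.2 a⟩
  map_add' f g := Subtype.ext (tanDer_add f.2 g.2 a)
  map_smul' c f := Subtype.ext (tanDer_smul c f.2 a)

/-- `Δ_{S^p}` as an operator on smooth functions. -/
def lapPOp (p q : ℕ) : Module.End ℂ (SmoothFun p q) := -∑ i, tanOp (.inl i) * tanOp (.inl i)

/-- `Δ_{S^q}` as an operator on smooth functions. -/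
def lapQOp (p q : ℕ) : Module.End ℂ (SmoothFun p q) := -∑ i, tanOp (.inr i) * tanOp (.inr i)

theorem mulX_apply (a : Fin (p + 1) ⊕ Fin (q + 1)) (f : SmoothFun p q) (z : Prd p q) :
    (mulX a f).1 z = crd a z * f.1 z := rfl

theorem tanOp_apply (a : Fin (p + 1) ⊕ Fin (q + 1)) (f : SmoothFun p q) (z : Prd p q) :
    (tanOp a f).1 z = tanDer a f.1 z := rfl

theorem lapPOp_apply (f : SmoothFun p q) : (lapPOp p q f).1 = lapP f.1 := by
  funext z
  rw [lapP_eq_sum_tanDer f.2]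
  simp only [lapPOp, LinearMap.neg_apply, LinearMap.sum_apply, SmoothFun.neg_val,
    SmoothFun.sum_val, Pi.neg_apply, Finset.sum_apply]
  rfl

theorem lapQOp_apply (f : SmoothFun p q) : (lapQOp p q f).1 = lapQ f.1 := by
  funext z
  rw [lapQ_eq_sum_tanDer f.2]
  simp only [lapQOp, LinearMap.neg_apply, LinearMap.sum_apply, SmoothFun.neg_val,
    SmoothFun.sum_val, Pi.neg_apply, Finset.sum_apply]
  rfl

theorem smoothEnd_ext {S T : Module.End ℂ (SmoothFun p q)}
    (h : ∀ (f : SmoothFun p q) z, (S f).1 z = (T f).1 z) : S = T :=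
  LinearMap.ext fun f => Subtype.ext (funext (h f))

theorem mulX_comm (a b : Fin (p + 1) ⊕ Fin (q + 1)) : mulX a * mulX b = mulX b * mulX a :=
  smoothEnd_ext fun f z => by
    simp only [Module.End.mul_apply, mulX_apply]; ring

theorem tanOp_mulX (a b : Fin (p + 1) ⊕ Fin (q + 1)) : tanOp a * mulX b - mulX b * tanOp a =
    if SameBlock a b then (if a = b then 1 else 0) - mulX a * mulX b else 0 :=
  smoothEnd_ext fun f z => by
    have h : tanDer a (mulX b f).1 = _ := tanDer_mul (smooth_crd b) f.2 a
    simp only [Module.End.mul_apply, LinearMap.sub_apply, SmoothFun.sub_val, Pi.sub_apply,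
      mulX_apply, tanOp_apply, h, Pi.add_apply, Pi.mul_apply, tanDer_crd]
    split_ifs <;> simp [mulX_apply] <;> ring

theorem tanOp_tanOp (a b : Fin (p + 1) ⊕ Fin (q + 1)) : tanOp a * tanOp b - tanOp b * tanOp a =
    if SameBlock a b then mulX a * tanOp b - mulX b * tanOp a else 0 :=
  smoothEnd_ext fun f z => by
    have h := tanDer_comm f.2 a b z
    simp only [Module.End.mul_apply, LinearMap.sub_apply, SmoothFun.sub_val, Pi.sub_apply,
      tanOp_apply]
    have h' : ∀ c d, tanDer c (tanOp d f).1 = tanDer c (tanDer d f.1) := fun c d => rfl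
    rw [h', h', h]
    split_ifs <;> simp [mulX_apply, tanOp_apply]

theorem sphereRel_inl : SphereRel (fun i => mulX (p := p) (q := q) (.inl i))
    (fun i => tanOp (p := p) (q := q) (.inl i)) where
  xx i j := mulX_comm _ _
  Tx i j := by simpa [SameBlock] using tanOp_mulX (p := p) (q := q) (.inl i) (.inl j)
  TT i j := by simpa [SameBlock] using tanOp_tanOp (p := p) (q := q) (.inl i) (.inl j)
  sum_xx := smoothEnd_ext fun f z => by
    have h := sum_crd_inl z
    simp only [LinearMap.sum_apply, SmoothFun.sum_val, Finset.sum_apply, Module.End.mul_apply, mulX_apply,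
      ← mul_assoc, ← Finset.sum_mul, h]
    simp
  sum_xT := smoothEnd_ext fun f z => by
    have h := sum_crd_tanDer_inl f.2 z
    simp only [LinearMap.sum_apply, SmoothFun.sum_val, Finset.sum_apply, Module.End.mul_apply, mulX_apply,
      tanOp_apply, h]
    simp

theorem sphereRel_inr : SphereRel (fun i => mulX (p := p) (q := q) (.inr i))
    (fun i => tanOp (p := p) (q := q) (.inr i)) where
  xx i j := mulX_comm _ _
  Tx i j := by simpa [SameBlock] using tanOp_mulX (p := p) (q := q) (.inr i) (.inr j)
  TT i j := by simpa [SameBlock] using tanOp_tanOp (p := p) (q := q) (.inr i) (.inr j)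
  sum_xx := smoothEnd_ext fun f z => by
    have h := sum_crd_inr z
    simp only [LinearMap.sum_apply, SmoothFun.sum_val, Finset.sum_apply, Module.End.mul_apply, mulX_apply,
      ← mul_assoc, ← Finset.sum_mul, h]
    simp
  sum_xT := smoothEnd_ext fun f z => by
    have h := sum_crd_tanDer_inr f.2 z
    simp only [LinearMap.sum_apply, SmoothFun.sum_val, Finset.sum_apply, Module.End.mul_apply, mulX_apply,
      tanOp_apply, h]
    simp

theorem tanOp_commute_mulX {a b : Fin (p + 1) ⊕ Fin (q + 1)} (h : ¬ SameBlock a b) :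
    Commute (tanOp a) (mulX b) := by
  have := tanOp_mulX a b
  rw [if_neg h] at this
  exact sub_eq_zero.mp this

theorem tanOp_commute_tanOp {a b : Fin (p + 1) ⊕ Fin (q + 1)} (h : ¬ SameBlock a b) :
    Commute (tanOp a) (tanOp b) := by
  have := tanOp_tanOp a b
  rw [if_neg h] at this
  exact sub_eq_zero.mp this

theorem lapPOp_commute_mulX (l : Fin (q + 1)) : Commute (lapPOp p q) (mulX (.inr l)) := by
  have h : ∀ i, Commute (tanOp (p := p) (q := q) (.inl i)) (mulX (.inr l)) := fun i =>
    tanOp_commute_mulX (by simp [SameBlock])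
  exact (Commute.sum_left _ _ _ fun i _ => (h i).mul_left (h i)).neg_left

theorem lapPOp_commute_tanOp (l : Fin (q + 1)) : Commute (lapPOp p q) (tanOp (.inr l)) := by
  have h : ∀ i, Commute (tanOp (p := p) (q := q) (.inl i)) (tanOp (.inr l)) := fun i =>
    tanOp_commute_tanOp (by simp [SameBlock])
  exact (Commute.sum_left _ _ _ fun i _ => (h i).mul_left (h i)).neg_left

theorem lapQOp_commute_mulX (i : Fin (p + 1)) : Commute (lapQOp p q) (mulX (.inl i)) := by
  have h : ∀ l, Commute (tanOp (p := p) (q := q) (.inr l)) (mulX (.inl i)) := fun l =>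
    tanOp_commute_mulX (by simp [SameBlock])
  exact (Commute.sum_left _ _ _ fun i _ => (h i).mul_left (h i)).neg_left

theorem lapQOp_commute_tanOp (i : Fin (p + 1)) : Commute (lapQOp p q) (tanOp (.inl i)) := by
  have h : ∀ l, Commute (tanOp (p := p) (q := q) (.inr l)) (tanOp (.inl i)) := fun l =>
    tanOp_commute_tanOp (by simp [SameBlock])
  exact (Commute.sum_left _ _ _ fun i _ => (h i).mul_left (h i)).neg_left

theorem lapPOp_commute_lapQOp : Commute (lapPOp p q) (lapQOp p q) :=
  (Commute.sum_right _ _ _ fun l _ =>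
    (lapPOp_commute_tanOp l).mul_right (lapPOp_commute_tanOp l)).neg_right

/-- The rotation field `x_a T_b - x_b T_a`. -/
def rotOp (a b : Fin (p + 1) ⊕ Fin (q + 1)) : Module.End ℂ (SmoothFun p q) :=
  mulX a * tanOp b - mulX b * tanOp a

theorem lapPOp_commute_rotOp_inl (i j : Fin (p + 1)) :
    Commute (lapPOp p q) (rotOp (.inl i) (.inl j)) :=
  sphereRel_inl.rot_comm i j rfl

theorem lapQOp_commute_rotOp_inr (i j : Fin (q + 1)) :
    Commute (lapQOp p q) (rotOp (.inr i) (.inr j)) :=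
  sphereRel_inr.rot_comm i j rfl

theorem lapPOp_commute_rotOp_inr (i j : Fin (q + 1)) :
    Commute (lapPOp p q) (rotOp (.inr i) (.inr j)) := by
  unfold rotOp
  exact ((lapPOp_commute_mulX (p := p) (q := q) i).mul_right (lapPOp_commute_tanOp (p := p) (q := q) j)).sub_right
    ((lapPOp_commute_mulX (p := p) (q := q) j).mul_right (lapPOp_commute_tanOp (p := p) (q := q) i))

theorem lapQOp_commute_rotOp_inl (i j : Fin (p + 1)) :
    Commute (lapQOp p q) (rotOp (.inl i) (.inl j)) := by
  unfold rotOp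
  exact ((lapQOp_commute_mulX (p := p) (q := q) i).mul_right (lapQOp_commute_tanOp (p := p) (q := q) j)).sub_right
    ((lapQOp_commute_mulX (p := p) (q := q) j).mul_right (lapQOp_commute_tanOp (p := p) (q := q) i))

/-- The operator `U_a` of the boost in the plane of `x_i` and `y_l`. -/
def boostOp (a : ℂ) (i : Fin (p + 1)) (l : Fin (q + 1)) : Module.End ℂ (SmoothFun p q) :=
  mulX (.inr l) * tanOp (.inl i) + mulX (.inl i) * tanOp (.inr l) -
    a • (mulX (.inl i) * mulX (.inr l))

theorem boost_ring_identity {R : Type*} [Ring R] {A B x y T S : R} {m n : ℕ}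
    (h1 : A * x - x * A = m * x - 2 * T) (h2 : B * y - y * B = n * y - 2 * S)
    (h3 : A * y = y * A) (h4 : B * x = x * B) (h5 : T * y = y * T) :
    2 * (y * T + x * S) = -((A + B) * (x * y) - x * y * (A + B)) + (m + n) * (x * y) := by
  have hn : x * n = n * x := (Nat.cast_commute n x).symm
  have e : (A + B) * (x * y) - x * y * (A + B) =
      (A * x - x * A) * y + x * (A * y - y * A) + (B * x - x * B) * y + x * (B * y - y * B) := by
    simp only [add_mul, mul_add, sub_mul, mul_sub, ← mul_assoc]
    abel
  have e' : x * (n * y) = n * (x * y) := by rw [← mul_assoc, hn, mul_assoc]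
  rw [e, h1, h2, h3, h4, sub_self, sub_self, mul_sub x, e', sub_mul, mul_assoc 2 T, h5, two_mul S, mul_add x,
    mul_assoc (m : R) x y, two_mul, two_mul, add_mul]
  simp only [mul_zero, zero_mul]
  abel

/-- The conformal vector field of a boost is half the commutator of its conformal factor with
`Δ_{S^p} + Δ_{S^q}`, up to a multiple of the conformal factor. -/
theorem boostOp_eq (a : ℂ) (i : Fin (p + 1)) (l : Fin (q + 1)) :
    (2 : ℂ) • boostOp a i l =
      -((lapPOp p q + lapQOp p q) * (mulX (.inl i) * mulX (.inr l)) -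
        mulX (.inl i) * mulX (.inr l) * (lapPOp p q + lapQOp p q)) +
      ((p : ℂ) + q - 2 * a) • (mulX (.inl i) * mulX (.inr l)) := by
  have h := boost_ring_identity ((sphereRel_inl (p := p) (q := q)).lap_x i)
    ((sphereRel_inr (p := p) (q := q)).lap_x l) (lapPOp_commute_mulX l).eq
    (lapQOp_commute_mulX i).eq
    (tanOp_commute_mulX (p := p) (q := q) (a := .inl i) (b := .inr l) (by simp [SameBlock])).eq
  have hs : ((p : ℂ) + q) • (mulX (p := p) (q := q) (.inl i) * mulX (.inr l)) =
      ((p : Module.End ℂ (SmoothFun p q)) + (q : Module.End ℂ (SmoothFun p q))) * (mulX (.inl i) * mulX (.inr l)) := by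
    rw [add_smul, Nat.cast_smul_eq_nsmul, Nat.cast_smul_eq_nsmul, nsmul_eq_mul, nsmul_eq_mul,
      add_mul]
  unfold boostOp
  rw [smul_sub, two_smul, ← two_mul, sub_smul, hs, mul_smul, ← add_sub_assoc]
  exact congrArg (· - (2 : ℂ) • a • (mulX (p := p) (q := q) (.inl i) * mulX (.inr l))) h

/-- `U_a(X) = 𝓛_X + a ω` as an operator on smooth functions. -/
def confOp (a : ℂ) (X : lieG p q) : Module.End ℂ (SmoothFun p q) :=
  ∑ b, ∑ c, (X.1 b c : ℂ) • (mulX c * tanOp b) -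
    a • ∑ i, ∑ b, (X.1 (.inl i) b : ℂ) • (mulX (.inl i) * mulX b)

theorem confOp_apply (a : ℝ) (X : lieG p q) (f : SmoothFun p q) :
    (confOp a X f).1 = confRep a X f.1 := by
  funext z
  simp only [confRep, lieDer_eq_sum, confFactor_eq_sum, confOp, LinearMap.sub_apply,
    LinearMap.smul_apply, LinearMap.sum_apply, SmoothFun.sub_val, Pi.sub_apply,
    SmoothFun.sum_val, Finset.sum_apply, SmoothFun.smul_val, Pi.smul_apply, Module.End.mul_apply, mulX_apply,
    tanOp_apply, smul_eq_mul]
  simp only [mul_neg, neg_mul, sub_eq_add_neg, mul_assoc, Finset.sum_mul]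

/-- The entries of `X ∈ 𝔤`: skew within the two diagonal blocks, symmetric between them. -/
theorem lieG_entry (X : lieG p q) (a b : Fin (p + 1) ⊕ Fin (q + 1)) :
    X.1 b a * Sum.elim (fun _ => (1 : ℝ)) (fun _ => -1) b =
      -(Sum.elim (fun _ => (1 : ℝ)) (fun _ => -1) a * X.1 a b) := by
  have h := (mem_skewAdjointMatricesSubmodule _ _).mp X.2
  have h' := congrFun (congrFun h a) b
  simpa [LieAlgebra.Orthogonal.indefiniteDiagonal, Matrix.mul_diagonal,
    Matrix.diagonal_mul] using h'

/-- Every `U_a(X)` is a combination of rotations of the two factors and of boosts. -/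
theorem confOp_eq (a : ℂ) (X : lieG p q) :
    (2 : ℂ) • confOp a X =
      ∑ i, ∑ k, (X.1 (.inl i) (.inl k) : ℂ) • rotOp (.inl k) (.inl i) +
      ∑ j, ∑ l, (X.1 (.inr j) (.inr l) : ℂ) • rotOp (.inr l) (.inr j) +
      (2 : ℂ) • ∑ i, ∑ l, (X.1 (.inl i) (.inr l) : ℂ) • boostOp a i l := by
  have hp : ∀ i k, X.1 (.inl k) (.inl i) = -X.1 (.inl i) (.inl k) := fun i k => by
    have := lieG_entry X (.inl i) (.inl k)
    simp at this; linarith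
  have hq : ∀ j l, X.1 (.inr l) (.inr j) = -X.1 (.inr j) (.inr l) := fun j l => by
    have := lieG_entry X (.inr j) (.inr l)
    simp at this; linarith
  have hpq : ∀ i l, X.1 (.inr l) (.inl i) = X.1 (.inl i) (.inr l) := fun i l => by
    simpa using lieG_entry X (.inl i) (.inr l)
  have h1 : ∑ i, ∑ k, (X.1 (.inl i) (.inl k) : ℂ) • rotOp (p := p) (q := q) (.inl k) (.inl i) =
      (2 : ℂ) • ∑ i, ∑ k, (X.1 (.inl i) (.inl k) : ℂ) • (mulX (.inl k) * tanOp (.inl i)) := by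
    simp only [rotOp, smul_sub, Finset.sum_sub_distrib]
    rw [sub_eq_iff_eq_add, two_smul, add_assoc, left_eq_add, Finset.sum_comm,
      ← Finset.sum_add_distrib]
    refine Finset.sum_eq_zero fun i _ => ?_
    rw [← Finset.sum_add_distrib]
    refine Finset.sum_eq_zero fun k _ => ?_
    rw [hp i k]
    simp
  have h2 : ∑ i, ∑ k, (X.1 (.inr i) (.inr k) : ℂ) • rotOp (p := p) (q := q) (.inr k) (.inr i) =
      (2 : ℂ) • ∑ i, ∑ k, (X.1 (.inr i) (.inr k) : ℂ) • (mulX (.inr k) * tanOp (.inr i)) := by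
    simp only [rotOp, smul_sub, Finset.sum_sub_distrib]
    rw [sub_eq_iff_eq_add, two_smul, add_assoc, left_eq_add, Finset.sum_comm,
      ← Finset.sum_add_distrib]
    refine Finset.sum_eq_zero fun i _ => ?_
    rw [← Finset.sum_add_distrib]
    refine Finset.sum_eq_zero fun k _ => ?_
    rw [hq i k]
    simp
  have h3 : ∑ i, ∑ k, (X.1 (.inl i) (.inl k) : ℂ) •
      (mulX (p := p) (q := q) (.inl i) * mulX (.inl k)) = 0 := by
    have h : ∑ i, ∑ k, (X.1 (.inl i) (.inl k) : ℂ) •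
        (mulX (p := p) (q := q) (.inl i) * mulX (.inl k)) = -∑ i, ∑ k, (X.1 (.inl i) (.inl k) : ℂ) •
        (mulX (p := p) (q := q) (.inl i) * mulX (.inl k)) := by
      conv_lhs => rw [Finset.sum_comm]
      rw [← Finset.sum_neg_distrib]
      refine Finset.sum_congr rfl fun i _ => ?_
      rw [← Finset.sum_neg_distrib]
      refine Finset.sum_congr rfl fun k _ => ?_
      rw [hp i k, mulX_comm]
      simp
    have h' := eq_neg_iff_add_eq_zero.mp h
    rw [← two_smul ℂ] at h'
    exact (smul_eq_zero_iff_right two_ne_zero).mp h'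
  have h4 : confOp a X = ∑ i, ∑ k, (X.1 (.inl i) (.inl k) : ℂ) • (mulX (.inl k) * tanOp (.inl i)) +
      ∑ i, ∑ k, (X.1 (.inr i) (.inr k) : ℂ) • (mulX (.inr k) * tanOp (.inr i)) +
      ∑ i, ∑ l, (X.1 (.inl i) (.inr l) : ℂ) • boostOp a i l := by
    simp only [confOp, Fintype.sum_sum_type, Finset.sum_add_distrib, h3, hpq, boostOp, smul_sub,
      smul_add, Finset.sum_sub_distrib, zero_add, smul_comm _ a, ← Finset.smul_sum]
    rw [Finset.sum_comm (f := fun l i => (X.1 (.inl i) (.inr l) : ℂ) •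
      (mulX (p := p) (q := q) (.inl i) * tanOp (.inr l)))]
    abel
  rw [h1, h2, h4, ← smul_add, ← smul_add]

/-! ### The polynomial of the operator `D` -/

/-- The polynomial `P` with `D = P(Δ_{S^p}, Δ_{S^q})`: in terms of `α = J²` and `β = K²` it is the
product of the factors `(K + J + s) (K - J + s)`, and the factors for `s` and `-s` combine to a
polynomial in `α` and `β`. -/
def covPoly (p q : ℕ) : ℕ → MvPolynomial (Fin 2) ℝ
  | 0 => 1
  | 1 => (MvPolynomial.X 1 + MvPolynomial.C ((((q : ℝ) - 1) / 2) ^ 2)) -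
      (MvPolynomial.X 0 + MvPolynomial.C ((((p : ℝ) - 1) / 2) ^ 2))
  | r + 2 => covPoly p q r *
      (((MvPolynomial.X 1 + MvPolynomial.C ((((q : ℝ) - 1) / 2) ^ 2)) -
        (MvPolynomial.X 0 + MvPolynomial.C ((((p : ℝ) - 1) / 2) ^ 2)) +
          MvPolynomial.C (((r : ℝ) + 1) ^ 2)) ^ 2 -
        4 * MvPolynomial.C (((r : ℝ) + 1) ^ 2) *
          (MvPolynomial.X 1 + MvPolynomial.C ((((q : ℝ) - 1) / 2) ^ 2)))

/-- Passing from `r` to `r + 2` adds the two outer factors, with shifts `±(r + 1)`. -/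
theorem prod_step {S : Type*} [CommRing S] (f : S → S) (r : ℕ) :
    ∏ i ∈ Finset.range (r + 2), f (2 * i + 1 - (r + 2 : ℕ)) =
      f (-(r + 1)) * f (r + 1) * ∏ i ∈ Finset.range r, f (2 * i + 1 - r) := by
  rw [Finset.prod_range_succ, Finset.prod_range_succ']
  have h1 : ∀ i : ℕ, f (2 * ((i + 1 : ℕ) : S) + 1 - (r + 2 : ℕ)) = f (2 * i + 1 - r) := fun i => by
    congr 1; push_cast; ring
  have h2 : f (2 * ((0 : ℕ) : S) + 1 - (r + 2 : ℕ)) = f (-(r + 1)) := by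
    congr 1; push_cast; ring
  have h3 : f (2 * ((r + 1 : ℕ) : S) + 1 - (r + 2 : ℕ)) = f (r + 1) := by
    congr 1; push_cast; ring
  rw [h2, h3, Finset.prod_congr rfl fun i _ => h1 i]
  ring

/-- With `J²` and `K²` for the shifted arguments, `covPoly` is the product of linear factors that
defines `D`. -/
theorem eval_covPoly {S : Type*} [CommRing S] (φ : ℝ →+* S) (p q : ℕ) {a b J K : S}
    (ha : a + φ ((((p : ℝ) - 1) / 2) ^ 2) = J ^ 2) (hb : b + φ ((((q : ℝ) - 1) / 2) ^ 2) = K ^ 2)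
    (r : ℕ) : MvPolynomial.eval₂ φ ![a, b] (covPoly p q r) =
      (∏ i ∈ Finset.range r, (K + J + (2 * i + 1 - r))) *
        ∏ i ∈ Finset.range r, (K - J + (2 * i + 1 - r)) := by
  induction r using Nat.twoStepInduction with
  | zero => simp [covPoly]
  | one =>
    simp only [covPoly, MvPolynomial.eval₂_sub, MvPolynomial.eval₂_add, MvPolynomial.eval₂_X,
      MvPolynomial.eval₂_C, Matrix.cons_val_zero, Matrix.cons_val_one, ha, hb]
    simp
    ring
  | more r ih _ =>
    have h4 : (4 : MvPolynomial (Fin 2) ℝ) = MvPolynomial.C 4 := (map_ofNat MvPolynomial.C 4).symm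
    rw [covPoly, MvPolynomial.eval₂_mul, ih, h4]
    simp only [MvPolynomial.eval₂_sub, MvPolynomial.eval₂_add, MvPolynomial.eval₂_X,
      MvPolynomial.eval₂_C, MvPolynomial.eval₂_mul, MvPolynomial.eval₂_pow,
      Matrix.cons_val_zero, Matrix.cons_val_one, ha, hb]
    rw [prod_step (fun s => K + J + s), prod_step (fun s => K - J + s)]
    simp only [map_pow, map_add, map_natCast, map_one, map_ofNat]
    ring

theorem totalDegree_covPoly_le (p q r : ℕ) : (covPoly p q r).totalDegree ≤ r := by
  have hX : ∀ (i : Fin 2) (c : ℝ),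
      (MvPolynomial.X i + MvPolynomial.C c : MvPolynomial (Fin 2) ℝ).totalDegree ≤ 1 := fun i c =>
    (MvPolynomial.totalDegree_add _ _).trans (max_le (MvPolynomial.totalDegree_X i).le (by simp))
  have hsub : ∀ {f g : MvPolynomial (Fin 2) ℝ} {n : ℕ}, f.totalDegree ≤ n → g.totalDegree ≤ n →
      (f - g).totalDegree ≤ n := fun hf hg => (MvPolynomial.totalDegree_sub _ _).trans (max_le hf hg)
  induction r using Nat.twoStepInduction with
  | zero => simp [covPoly]
  | one => exact hsub (hX _ _) (hX _ _)
  | more r ih _ =>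
    refine (MvPolynomial.totalDegree_mul _ _).trans (add_le_add ih (hsub ?_ ?_))
    · refine (MvPolynomial.totalDegree_pow _ _).trans ?_
      refine (Nat.mul_le_mul_left 2 (m := 1) ?_)
      exact (MvPolynomial.totalDegree_add _ _).trans
        (max_le (hsub (hX _ _) (hX _ _)) (by rw [MvPolynomial.totalDegree_C]; exact zero_le_one))
    · have h4 : (4 : MvPolynomial (Fin 2) ℝ) = MvPolynomial.C 4 :=
        (map_ofNat MvPolynomial.C 4).symm
      rw [h4, ← MvPolynomial.C_mul]
      refine (MvPolynomial.totalDegree_mul _ _).trans ?_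
      rw [MvPolynomial.totalDegree_C, zero_add]
      exact (hX _ _).trans one_le_two

/-- The top degree is attained: for `J = 0` the polynomial becomes `∏ (K + s)²`, of degree `2 r`
in `K`. -/
theorem totalDegree_covPoly (p q r : ℕ) : (covPoly p q r).totalDegree = r := by
  refine le_antisymm (totalDegree_covPoly_le p q r) ?_
  have h := eval_covPoly (Polynomial.C : ℝ →+* Polynomial ℝ) p q
    (a := -Polynomial.C ((((p : ℝ) - 1) / 2) ^ 2)) (J := 0)
    (b := Polynomial.X ^ 2 - Polynomial.C ((((q : ℝ) - 1) / 2) ^ 2)) (K := Polynomial.X)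
    (by simp) (by simp) r
  have hmonic : (∏ i ∈ Finset.range r,
      (Polynomial.X + 0 + (2 * (i : Polynomial ℝ) + 1 - (r : Polynomial ℝ)))).Monic ∧
      (∏ i ∈ Finset.range r,
      (Polynomial.X + 0 + (2 * (i : Polynomial ℝ) + 1 - (r : Polynomial ℝ)))).natDegree = r := by
    have hc : ∀ i : ℕ, (Polynomial.X + 0 + (2 * (i : Polynomial ℝ) + 1 - (r : Polynomial ℝ))) =
        Polynomial.X + Polynomial.C (2 * (i : ℝ) + 1 - r) := fun i => by
      rw [← map_ofNat Polynomial.C 2]; simp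
    simp only [hc]
    refine ⟨Polynomial.monic_prod_of_monic _ _ fun i _ => Polynomial.monic_X_add_C _, ?_⟩
    rw [Polynomial.natDegree_prod_of_monic _ _ fun i _ => Polynomial.monic_X_add_C _]
    simp only [Polynomial.natDegree_X_add_C, Finset.sum_const, Finset.card_range, smul_eq_mul,
      mul_one]
  simp only [sub_zero] at h
  have hdeg : (MvPolynomial.eval₂ (Polynomial.C : ℝ →+* Polynomial ℝ)
      ![-Polynomial.C ((((p : ℝ) - 1) / 2) ^ 2),
        Polynomial.X ^ 2 - Polynomial.C ((((q : ℝ) - 1) / 2) ^ 2)]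
      (covPoly p q r)).natDegree = r + r := by
    rw [h]
    simp only [add_zero] at hmonic ⊢
    rw [hmonic.1.natDegree_mul hmonic.1, hmonic.2]
  have hle := MvPolynomial.aeval_natDegree_le (covPoly p q r) le_rfl
    (![-Polynomial.C ((((p : ℝ) - 1) / 2) ^ 2),
        Polynomial.X ^ 2 - Polynomial.C ((((q : ℝ) - 1) / 2) ^ 2)] : Fin 2 → Polynomial ℝ)
    (n := 2) (fun i => by
      fin_cases i
      · simp
      · simp only [Fin.mk_one, Matrix.cons_val_one, Matrix.cons_val_fin_one]
        compute_degree)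
  rw [MvPolynomial.aeval_def] at hle
  change (MvPolynomial.eval₂ (Polynomial.C : ℝ →+* Polynomial ℝ) _ _).natDegree ≤ _ at hle
  rw [hdeg] at hle
  omega

/-! ### Polynomials in two commuting operators and the intertwining relation -/

/-- `P(a, b)` for a real polynomial `P` and commuting elements `a`, `b` of a complex algebra. -/
def evalComm {R : Type*} [Ring R] [Algebra ℂ R] (a b : R) (P : MvPolynomial (Fin 2) ℝ) : R :=
  ∑ m ∈ P.support, ((P.coeff m : ℝ) : ℂ) • (a ^ m 0 * b ^ m 1)

theorem map_evalComm {R R' : Type*} [Ring R] [Algebra ℂ R] [Ring R'] [Algebra ℂ R']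
    (φ : R →ₐ[ℂ] R') (a b : R) (P : MvPolynomial (Fin 2) ℝ) :
    φ (evalComm a b P) = evalComm (φ a) (φ b) P := by
  simp only [evalComm, map_sum, map_smul, map_mul, map_pow]

theorem evalComm_commute {R : Type*} [Ring R] [Algebra ℂ R] {a b c : R} (ha : Commute a c)
    (hb : Commute b c) (P : MvPolynomial (Fin 2) ℝ) : Commute (evalComm a b P) c :=
  Commute.sum_left _ _ _ fun _ _ => ((ha.pow_left _).mul_left (hb.pow_left _)).smul_left _

theorem evalComm_eq_eval₂ {R : Type*} [CommRing R] [Algebra ℂ R] (a b : R)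
    (P : MvPolynomial (Fin 2) ℝ) : evalComm a b P =
      MvPolynomial.eval₂ ((algebraMap ℂ R).comp Complex.ofRealHom) ![a, b] P := by
  rw [MvPolynomial.eval₂_eq']
  refine Finset.sum_congr rfl fun m _ => ?_
  simp [Fin.prod_univ_two, Algebra.smul_def]

section EvalComm

variable {R : Type*} [Ring R] [Algebra ℂ R] (A B : R)

theorem evalComm_eq_sum {P : MvPolynomial (Fin 2) ℝ} {S : Finset (Fin 2 →₀ ℕ)} (h : P.support ⊆ S) :
    evalComm A B P = ∑ m ∈ S, ((P.coeff m : ℝ) : ℂ) • (A ^ m 0 * B ^ m 1) :=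
  Finset.sum_subset h fun m _ hm => by
    rw [MvPolynomial.notMem_support_iff.mp hm, Complex.ofReal_zero, zero_smul]

theorem evalComm_add (P Q : MvPolynomial (Fin 2) ℝ) :
    evalComm A B (P + Q) = evalComm A B P + evalComm A B Q := by
  classical
  rw [evalComm_eq_sum A B (S := P.support ∪ Q.support) MvPolynomial.support_add,
    evalComm_eq_sum A B (S := P.support ∪ Q.support) Finset.subset_union_left,
    evalComm_eq_sum A B (S := P.support ∪ Q.support) Finset.subset_union_right,
    ← Finset.sum_add_distrib]
  simp only [MvPolynomial.coeff_add, Complex.ofReal_add, add_smul]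

theorem evalComm_monomial (m : Fin 2 →₀ ℕ) (c : ℝ) :
    evalComm A B (MvPolynomial.monomial m c) = (c : ℂ) • (A ^ m 0 * B ^ m 1) := by
  classical
  rw [evalComm_eq_sum A B MvPolynomial.support_monomial_subset, Finset.sum_singleton,
    MvPolynomial.coeff_monomial, if_pos rfl]

theorem evalComm_covPoly_one (p q : ℕ) :
    evalComm A B (covPoly p q 1) =
      B - A + ((((q : ℂ) - 1) / 2) ^ 2 - (((p : ℂ) - 1) / 2) ^ 2) • (1 : R) := by
  have h : covPoly p q 1 = MvPolynomial.monomial (Finsupp.single 1 1) 1 +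
      MvPolynomial.monomial (Finsupp.single 0 1) (-1) +
      MvPolynomial.monomial 0 ((((q : ℝ) - 1) / 2) ^ 2 - (((p : ℝ) - 1) / 2) ^ 2) := by
    rw [covPoly, map_neg]
    simp only [MvPolynomial.monomial_zero', map_sub]
    change _ = MvPolynomial.X 1 + -MvPolynomial.X 0 + _
    ring
  rw [h, evalComm_add, evalComm_add, evalComm_monomial, evalComm_monomial, evalComm_monomial]
  simp
  abel

end EvalComm

/-- Right multiplication by `P(a, b)` is `P` of the right multiplications, since `a` and `b` commute. -/
theorem mulRight_evalComm {R : Type*} [Ring R] [Algebra ℂ R] {a b : R} (h : Commute a b)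
    (P : MvPolynomial (Fin 2) ℝ) : LinearMap.mulRight ℂ (evalComm a b P) =
      evalComm (R := Module.End ℂ R) (LinearMap.mulRight ℂ a) (LinearMap.mulRight ℂ b) P := by
  ext x
  simp only [evalComm, LinearMap.mulRight_apply, Finset.mul_sum, mul_smul_comm,
    LinearMap.sum_apply, LinearMap.smul_apply, Module.End.mul_apply, LinearMap.pow_mulRight]
  refine Finset.sum_congr rfl fun m _ => ?_
  rw [(h.pow_pow _ _).eq, mul_assoc]

/-- Commuting operators that agree on `w` may be exchanged inside polynomials applied to `w`. -/
theorem eval₂_smul_congr {S M : Type*} [CommRing S] [AddCommGroup M] [Module S M] (φ : ℝ →+* S)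
    {w : M} {a b a' b' : S} (ha : a • w = a' • w) (hb : b • w = b' • w)
    (P : MvPolynomial (Fin 2) ℝ) :
    MvPolynomial.eval₂ φ ![a, b] P • w = MvPolynomial.eval₂ φ ![a', b'] P • w := by
  induction P using MvPolynomial.induction_on with
  | C c => simp
  | add P Q hP hQ => simp only [MvPolynomial.eval₂_add, add_smul, hP, hQ]
  | mul_X P i hP =>
    have hi : (![a, b] i) • w = (![a', b'] i) • w := by
      fin_cases i
      · exact ha
      · exact hb
    rw [MvPolynomial.eval₂_mul, MvPolynomial.eval₂_mul, MvPolynomial.eval₂_X,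
      MvPolynomial.eval₂_X, mul_smul, hi, smul_comm, hP, ← mul_smul, mul_comm]

/-- Shifting the argument of `∏ (y + s)` by `2` exchanges its outermost factors. -/
theorem telescope {S : Type*} [CommRing S] (y : S) (r : ℕ) :
    (∏ i ∈ Finset.range r, (y + 2 + (2 * i + 1 - r))) * (y + 1 - r) =
      (y + 1 + r) * ∏ i ∈ Finset.range r, (y + (2 * i + 1 - r)) := by
  have h1 := Finset.prod_range_succ (fun i : ℕ => y + (2 * (i : S) + 1 - r)) r
  have h2 := Finset.prod_range_succ' (fun i : ℕ => y + (2 * (i : S) + 1 - r)) r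
  have h3 : ∀ i : ℕ, y + (2 * ((i + 1 : ℕ) : S) + 1 - r) = y + 2 + (2 * i + 1 - r) := fun i => by
    push_cast; ring
  simp only [h3] at h2
  rw [h1] at h2
  push_cast at h2
  linear_combination -h2

/-- The intertwining relation as an identity of polynomials in `J` and `K`. Here `la`, `ra`, `lb`,
`rb` stand for left and right multiplication by the two Laplacians, and `w` for the conformal
factor; on `w` the operator `j = (la - ra - 1) / 2` satisfies `j² = ra + c²`,
`(j + 1)² = la + c²`. -/
theorem covPoly_smul {S M : Type*} [CommRing S] [AddCommGroup M] [Module S M] (φ : ℝ →+* S)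
    (p q r : ℕ) {w : M} {la lb ra rb : S}
    (ha : (la - ra) ^ 2 • w = (2 * (la + ra) + p * (p - 2) : S) • w)
    (hb : (lb - rb) ^ 2 • w = (2 * (lb + rb) + q * (q - 2) : S) • w) :
    (MvPolynomial.eval₂ φ ![la, lb] (covPoly p q r) * (la + lb - ra - rb - 2 * r)) • w =
      ((la + lb - ra - rb + 2 * r) * MvPolynomial.eval₂ φ ![ra, rb] (covPoly p q r)) • w := by
  have h2 : φ (1 / 2) * 2 = 1 := by
    rw [← map_ofNat φ 2, ← map_mul]; norm_num
  have h4 : φ (1 / 2) ^ 2 * 4 = 1 := by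
    linear_combination (φ (1 / 2) * 2 + 1) * h2
  have hc : ∀ n : ℕ, φ ((((n : ℝ) - 1) / 2) ^ 2) = φ (1 / 2) ^ 2 * ((n : S) - 1) ^ 2 := fun n => by
    rw [← map_natCast φ n, ← map_one φ, ← map_sub, ← map_pow, ← map_pow, ← map_mul]
    congr 1; ring
  -- `h = 1 / 2`; the division is not available in `S` itself
  set h := φ (1 / 2) with hh
  set j := h * (la - ra - 1) with hj
  set k := h * (lb - rb - 1) with hk
  have key : ∀ {l r' c : S} (n : ℕ), (l - r') ^ 2 • w = (2 * (l + r') + n * (n - 2) : S) • w →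
      c = h ^ 2 * ((n : S) - 1) ^ 2 →
      r' • w = ((h * (l - r' - 1)) ^ 2 - c) • w ∧ l • w = ((h * (l - r' - 1) + 1) ^ 2 - c) • w := by
    intro l r' c n hrel hcn
    have e1 : ((h * (l - r' - 1)) ^ 2 - c) - r' =
        h ^ 2 * ((l - r') ^ 2 - (2 * (l + r') + n * (n - 2))) := by
      rw [hcn]; linear_combination r' * h4
    have e2 : ((h * (l - r' - 1) + 1) ^ 2 - c) - l =
        h ^ 2 * ((l - r') ^ 2 - (2 * (l + r') + n * (n - 2))) := by
      rw [hcn]; linear_combination r' * h4 + (l - r' - 1) * h2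
    have e3 : (h ^ 2 * ((l - r') ^ 2 - (2 * (l + r') + n * (n - 2)))) • w = 0 := by
      rw [mul_smul, sub_smul, hrel, sub_self, smul_zero]
    constructor
    · rw [eq_comm, ← sub_eq_zero, ← sub_smul, e1, e3]
    · rw [eq_comm, ← sub_eq_zero, ← sub_smul, e2, e3]
  obtain ⟨hra, hla⟩ := key p ha (hc p)
  obtain ⟨hrb, hlb⟩ := key q hb (hc q)
  rw [mul_comm, mul_smul, mul_smul, eval₂_smul_congr φ hla hlb, eval₂_smul_congr φ hra hrb,
    ← mul_smul, ← mul_smul,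
    eval_covPoly φ p q (J := j + 1) (K := k + 1) (sub_add_cancel _ _) (sub_add_cancel _ _),
    eval_covPoly φ p q (J := j) (K := k) (sub_add_cancel _ _) (sub_add_cancel _ _)]
  congr 1
  have e : la + lb - ra - rb = 2 * (k + j + 1) := by
    rw [hj, hk]; linear_combination (-(la - ra - 1) - (lb - rb - 1)) * h2
  have h5 := telescope (k + j) r
  have h6 : ∀ i : ℕ, k + 1 + (j + 1) + (2 * (i : S) + 1 - r) = k + j + 2 + (2 * i + 1 - r) :=
    fun i => by ring
  have h7 : ∀ i : ℕ, k + 1 - (j + 1) + (2 * (i : S) + 1 - r) = k - j + (2 * i + 1 - r) :=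
    fun i => by ring
  simp only [h6, h7, e]
  linear_combination 2 * (∏ i ∈ Finset.range r, (k - j + (2 * (i : S) + 1 - r))) * h5

/-- If `w` satisfies the double commutator relations with the commuting elements `a` and `b`, then
`P(a, b)` intertwines `[a + b, w] / 2 - r w` and `[a + b, w] / 2 + r w`. -/
theorem covPoly_intertwine {R : Type*} [Ring R] [Algebra ℂ R] (p q r : ℕ) {a b w : R}
    (hab : Commute a b)
    (ha : a * (a * w - w * a) - (a * w - w * a) * a =
      2 * (a * w + w * a) + (p * (p - 2) : R) * w)
    (hb : b * (b * w - w * b) - (b * w - w * b) * b =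
      2 * (b * w + w * b) + (q * (q - 2) : R) * w) :
    evalComm a b (covPoly p q r) * ((a + b) * w - w * (a + b) - 2 * r * w) =
      ((a + b) * w - w * (a + b) + 2 * r * w) * evalComm a b (covPoly p q r) := by
  -- `R` is a module over the commutative algebra that is generated by the multiplications by `a` and
  -- `b` from the left and from the right
  let la : Module.End ℂ R := LinearMap.mulLeft ℂ a
  let lb : Module.End ℂ R := LinearMap.mulLeft ℂ b
  let ra : Module.End ℂ R := LinearMap.mulRight ℂ a
  let rb : Module.End ℂ R := LinearMap.mulRight ℂ b
  let s : Set (Module.End ℂ R) := {la, lb, ra, rb}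
  have hcomm : ∀ x ∈ s, ∀ y ∈ s, x * y = y * x := by
    have hll : la * lb = lb * la := LinearMap.ext fun x => by
      simp [la, lb, ← mul_assoc, hab.eq]
    have hrr : ra * rb = rb * ra := LinearMap.ext fun x => by
      simp [ra, rb, mul_assoc, hab.eq]
    have hlr : ∀ c d : R, LinearMap.mulLeft ℂ c * LinearMap.mulRight ℂ d =
        LinearMap.mulRight ℂ d * LinearMap.mulLeft ℂ c := fun c d => LinearMap.ext fun x => by
      simp [mul_assoc]
    rintro x (rfl | rfl | rfl | rfl) y (rfl | rfl | rfl | rfl) <;>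
      first | rfl | exact hll | exact hll.symm | exact hrr | exact hrr.symm | exact hlr _ _ |
        exact (hlr _ _).symm
  have hmc := Algebra.isMulCommutative_adjoin ℂ hcomm
  let : CommRing (Algebra.adjoin ℂ s) :=
    { (Algebra.adjoin ℂ s).toRing with mul_comm := fun x y => hmc.is_comm.comm x y }
  have mem : ∀ x ∈ s, x ∈ Algebra.adjoin ℂ s := fun x hx => Algebra.subset_adjoin hx
  let la' : Algebra.adjoin ℂ s := ⟨la, mem _ (by simp [s])⟩
  let lb' : Algebra.adjoin ℂ s := ⟨lb, mem _ (by simp [s])⟩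
  let ra' : Algebra.adjoin ℂ s := ⟨ra, mem _ (by simp [s])⟩
  let rb' : Algebra.adjoin ℂ s := ⟨rb, mem _ (by simp [s])⟩
  have act : ∀ (c : Algebra.adjoin ℂ s) (v : R), c • v = c.1 v := fun _ _ => rfl
  have actla : ∀ v : R, la' • v = a * v := fun _ => rfl
  have actlb : ∀ v : R, lb' • v = b * v := fun _ => rfl
  have actra : ∀ v : R, ra' • v = v * a := fun _ => rfl
  have actrb : ∀ v : R, rb' • v = v * b := fun _ => rfl
  have h := covPoly_smul ((algebraMap ℂ (Algebra.adjoin ℂ s)).comp Complex.ofRealHom) p q r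
    (w := w) (la := la') (lb := lb') (ra := ra') (rb := rb')
    (by
      simp only [pow_two, mul_smul, sub_smul, add_smul, actla, actra, two_smul, two_mul,
        Nat.cast_smul_eq_nsmul, nsmul_eq_mul] at ha ⊢
      rw [← sub_eq_zero] at ha ⊢
      rw [← ha]
      noncomm_ring)
    (by
      simp only [pow_two, mul_smul, sub_smul, add_smul, actlb, actrb, two_smul, two_mul,
        Nat.cast_smul_eq_nsmul, nsmul_eq_mul] at hb ⊢
      rw [← sub_eq_zero] at hb ⊢
      rw [← hb]
      noncomm_ring)
  have hl : ∀ v : R, evalComm la' lb' (covPoly p q r) • v = evalComm a b (covPoly p q r) * v :=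
    fun v => by
      rw [act]
      have h1 := map_evalComm (Algebra.adjoin ℂ s).val la' lb' (covPoly p q r)
      have h2 := map_evalComm (Algebra.lmul ℂ R) a b (covPoly p q r)
      exact (congrArg (fun f : Module.End ℂ R => f v) (h1.trans h2.symm))
  have hr : ∀ v : R, evalComm ra' rb' (covPoly p q r) • v = v * evalComm a b (covPoly p q r) :=
    fun v => by
      rw [act]
      have h1 := map_evalComm (Algebra.adjoin ℂ s).val ra' rb' (covPoly p q r)
      exact (congrArg (fun f : Module.End ℂ R => f v)
        (h1.trans (mulRight_evalComm hab (covPoly p q r)).symm))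
  rw [← evalComm_eq_eval₂, ← evalComm_eq_eval₂] at h
  simp only [mul_smul, add_smul, sub_smul, actla, actlb, actra, actrb, hl, hr, two_smul,
    Nat.cast_smul_eq_nsmul, nsmul_eq_mul] at h
  have hDa : evalComm a b (covPoly p q r) * a = a * evalComm a b (covPoly p q r) :=
    (evalComm_commute (Commute.refl a) hab.symm _).eq
  have hDb : evalComm a b (covPoly p q r) * b = b * evalComm a b (covPoly p q r) :=
    (evalComm_commute hab (Commute.refl b) _).eq
  convert h using 2 <;> simp only [two_mul, add_mul, mul_add, sub_mul, mul_assoc, hDa, hDb] <;> abel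

/-! ### The covariant differential operator -/


theorem lapPOp_pow_apply (n : ℕ) (f : SmoothFun p q) : ((lapPOp p q ^ n) f).1 = lapP^[n] f.1 := by
  induction n with
  | zero => rfl
  | succ n ih =>
    rw [pow_succ', Module.End.mul_apply, lapPOp_apply, ih, Function.iterate_succ_apply']

theorem lapQOp_pow_apply (n : ℕ) (f : SmoothFun p q) : ((lapQOp p q ^ n) f).1 = lapQ^[n] f.1 := by
  induction n with
  | zero => rfl
  | succ n ih =>
    rw [pow_succ', Module.End.mul_apply, lapQOp_apply, ih, Function.iterate_succ_apply']

theorem polyOp_eq_evalComm (P : MvPolynomial (Fin 2) ℝ) (f : SmoothFun p q) :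
    polyOp P f.1 = (evalComm (lapPOp p q) (lapQOp p q) P f).1 := by
  funext z
  simp only [polyOp, evalComm, LinearMap.sum_apply, LinearMap.smul_apply, SmoothFun.sum_val,
    Finset.sum_apply, SmoothFun.smul_val, Pi.smul_apply, Module.End.mul_apply, smul_eq_mul,
    lapPOp_pow_apply, lapQOp_pow_apply]

/-- The covariance of `P(Δ_{S^p}, Δ_{S^q})` under boosts: the conformal factor `x_i y_l` satisfies the
double commutator relation with each of the two Laplacians. -/
theorem boostOp_intertwine (r : ℕ) (i : Fin (p + 1)) (l : Fin (q + 1)) :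
    evalComm (lapPOp p q) (lapQOp p q) (covPoly p q r) *
        boostOp (((p : ℂ) + q) / 2 - r) i l =
      boostOp (((p : ℂ) + q) / 2 + r) i l *
        evalComm (lapPOp p q) (lapQOp p q) (covPoly p q r) := by
  set D := evalComm (lapPOp p q) (lapQOp p q) (covPoly p q r) with hD
  set w : Module.End ℂ (SmoothFun p q) := mulX (.inl i) * mulX (.inr l) with hw
  have ha := sphereRel_inl.double_comm (A := lapPOp p q) i rfl
  have hb := sphereRel_inr.double_comm (A := lapQOp p q) l rfl
  have hxl : mulX (p := p) (q := q) (.inr l) * lapPOp p q = lapPOp p q * mulX (.inr l) :=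
    (lapPOp_commute_mulX l).symm.eq
  have hxi : mulX (p := p) (q := q) (.inl i) * lapQOp p q = lapQOp p q * mulX (.inl i) :=
    (lapQOp_commute_mulX i).symm.eq
  have h := covPoly_intertwine p q r (w := w) lapPOp_commute_lapQOp (by
      have h1 : lapPOp p q * w - w * lapPOp p q =
          (lapPOp p q * mulX (.inl i) - mulX (.inl i) * lapPOp p q) * mulX (.inr l) := by
        rw [hw, sub_mul, mul_assoc (mulX (.inl i)) (mulX (.inr l)), hxl]; simp only [mul_assoc]
      have h2 : lapPOp p q * w + w * lapPOp p q =
          (lapPOp p q * mulX (.inl i) + mulX (.inl i) * lapPOp p q) * mulX (.inr l) := by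
        rw [hw, add_mul, mul_assoc (mulX (.inl i)) (mulX (.inr l)), hxl]; simp only [mul_assoc]
      rw [h1, h2, mul_assoc _ (mulX (.inr l)), hxl, hw, ← mul_assoc, ← mul_assoc, ← sub_mul, ha,
        add_mul]
      simp only [mul_assoc]) (by
      have h1 : lapQOp p q * w - w * lapQOp p q =
          mulX (.inl i) * (lapQOp p q * mulX (.inr l) - mulX (.inr l) * lapQOp p q) := by
        rw [hw, mul_sub, ← mul_assoc (lapQOp p q), ← hxi]; simp only [mul_assoc]
      have h2 : lapQOp p q * w + w * lapQOp p q =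
          mulX (.inl i) * (lapQOp p q * mulX (.inr l) + mulX (.inr l) * lapQOp p q) := by
        rw [hw, mul_add, ← mul_assoc (lapQOp p q), ← hxi]; simp only [mul_assoc]
      have hn : mulX (p := p) (q := q) (.inl i) * ((q : Module.End ℂ (SmoothFun p q)) *
          ((q : Module.End ℂ (SmoothFun p q)) - 2)) =
          ((q : Module.End ℂ (SmoothFun p q)) * ((q : Module.End ℂ (SmoothFun p q)) - 2)) *
            mulX (.inl i) :=
        ((Nat.cast_commute q _).mul_left
          ((Nat.cast_commute q _).sub_left (Nat.cast_commute 2 _))).symm.eq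
      rw [h1, h2, ← mul_assoc (lapQOp p q), ← hxi, mul_assoc, mul_assoc, ← mul_sub, hb, mul_add,
        ← mul_assoc (mulX (.inl i)) _ (mulX (.inr l)), hn, hw]
      simp only [two_mul, mul_add, mul_assoc])
  -- with weights `n/2 ∓ r` the boost is half the commutator, up to `± r w`
  have e1 := boostOp_eq (p := p) (q := q) (((p : ℂ) + q) / 2 - r) i l
  have e2 := boostOp_eq (p := p) (q := q) (((p : ℂ) + q) / 2 + r) i l
  have c1 : (p : ℂ) + q - 2 * (((p : ℂ) + q) / 2 - r) = 2 * r := by ring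
  have c2 : (p : ℂ) + q - 2 * (((p : ℂ) + q) / 2 + r) = -(2 * r) := by ring
  have hs : (2 * r : ℂ) • w = 2 * r * w := by
    rw [mul_smul, two_smul, Nat.cast_smul_eq_nsmul, nsmul_eq_mul, ← two_mul, mul_assoc]
  rw [c1, ← hw, hs] at e1
  rw [c2, ← hw, neg_smul, hs] at e2
  have e3 : (2 : ℂ) • (D * boostOp (((p : ℂ) + q) / 2 - r) i l) =
      (2 : ℂ) • (boostOp (((p : ℂ) + q) / 2 + r) i l * D) := by
    rw [← mul_smul_comm, ← smul_mul_assoc, e1, e2, ← neg_add, neg_add_eq_sub, ← neg_sub,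
      mul_neg, neg_mul, h]
  exact smul_right_injective _ (two_ne_zero (α := ℂ)) e3

/-- `P(Δ_{S^p}, Δ_{S^q})` intertwines `U_{n/2-r}` and `U_{n/2+r}` on `C^∞(S^p × S^q)`. -/
theorem confOp_intertwine (r : ℕ) (X : lieG p q) :
    evalComm (lapPOp p q) (lapQOp p q) (covPoly p q r) * confOp (((p : ℂ) + q) / 2 - r) X =
      confOp (((p : ℂ) + q) / 2 + r) X * evalComm (lapPOp p q) (lapQOp p q) (covPoly p q r) := by
  have hp : ∀ i k, Commute (evalComm (lapPOp p q) (lapQOp p q) (covPoly p q r))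
      (rotOp (.inl i) (.inl k)) := fun i k =>
    evalComm_commute (lapPOp_commute_rotOp_inl i k) (lapQOp_commute_rotOp_inl i k) _
  have hq : ∀ i k, Commute (evalComm (lapPOp p q) (lapQOp p q) (covPoly p q r))
      (rotOp (.inr i) (.inr k)) := fun i k =>
    evalComm_commute (lapPOp_commute_rotOp_inr i k) (lapQOp_commute_rotOp_inr i k) _
  refine smul_right_injective _ (two_ne_zero (α := ℂ)) ?_
  change (2 : ℂ) • (_ * _) = (2 : ℂ) • (_ * _)
  rw [← mul_smul_comm, ← smul_mul_assoc, confOp_eq, confOp_eq]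
  simp only [mul_add, add_mul, Finset.mul_sum, Finset.sum_mul, mul_smul_comm, smul_mul_assoc,
    (hp _ _).eq, (hq _ _).eq, boostOp_intertwine]

theorem polyOp_covariant (r : ℕ) {f : Prd p q → ℂ} (hf : Smooth f) (X : lieG p q) :
    polyOp (covPoly p q r) (confRep (((p : ℝ) + q) / 2 - r) X f) =
      confRep (((p : ℝ) + q) / 2 + r) X (polyOp (covPoly p q r) f) := by
  let F : SmoothFun p q := ⟨f, hf⟩
  have h := congrArg (fun S : Module.End ℂ (SmoothFun p q) => (S F).1) (confOp_intertwine r X)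
  have c1 : ((p : ℂ) + q) / 2 - r = (((((p : ℝ) + q) / 2 - r : ℝ)) : ℂ) := by push_cast; ring
  have c2 : ((p : ℂ) + q) / 2 + r = (((((p : ℝ) + q) / 2 + r : ℝ)) : ℂ) := by push_cast; ring
  simp only [Module.End.mul_apply, c1, c2] at h
  rw [← polyOp_eq_evalComm, confOp_apply, confOp_apply, ← polyOp_eq_evalComm] at h
  exact h

/-! ### Harmonic functions on the sphere are constant -/

theorem integral_fderiv_eq_zero {n : ℕ} {g : Amb n → ℂ} (hg : ContDiff ℝ 1 g)
    (hc : HasCompactSupport g) (v : Amb n) : ∫ x, fderiv ℝ g x v = 0 := by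
  have hcont : Continuous fun x => fderiv ℝ g x v :=
    (hg.continuous_fderiv one_ne_zero).clm_apply continuous_const
  have h := integral_mul_fderiv_eq_neg_fderiv_mul_of_integrable
    (μ := MeasureTheory.volume) (f := fun _ : Amb n => (1 : ℂ)) (g := g) (v := v)
    (by simp) (by simpa using hcont.integrable_of_hasCompactSupport (hc.fderiv_apply ℝ v))
    (by simpa using hg.continuous.integrable_of_hasCompactSupport hc)
    (fun x _ => differentiableAt_const _) (fun x _ => hg.differentiable one_ne_zero x)
  simpa using h

theorem homExt_smul {n : ℕ} (f : Sph n → ℂ) {c : ℝ} (hc : 0 < c) (v : Amb n) :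
    homExt f (c • v) = homExt f v := by
  by_cases h : v = 0
  · simp [h]
  · rw [homExt, homExt, dif_pos h, dif_pos (smul_ne_zero hc.ne' h), radial_smul h hc]

theorem fderiv_homExt_smul {n : ℕ} {f : Sph n → ℂ} (hf : SmoothSph f) {c : ℝ} (hc : 0 < c)
    {v : Amb n} (hv : v ≠ 0) (u : Amb n) :
    fderiv ℝ (homExt f) v u = fderiv ℝ (homExt f) (c • v) (c • u) := by
  have h1 : (fun w : Amb n => homExt f (c • w)) = homExt f := funext fun w => homExt_smul f hc w
  have h2 : DifferentiableAt ℝ (homExt f) (c • v) :=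
    (homExt_contDiffAt hf (smul_ne_zero hc.ne' hv)).differentiableAt (by simp)
  have h3 := (h2.hasFDerivAt.comp v ((hasFDerivAt_id (𝕜 := ℝ) v).const_smul c)).fderiv
  change fderiv ℝ (fun w : Amb n => homExt f (c • w)) v = _ at h3
  rw [h1] at h3
  rw [h3]
  rfl

/-- Euler's relation for the extension of degree `0`. -/
theorem fderiv_homExt_self {n : ℕ} {f : Sph n → ℂ} (hf : SmoothSph f) {v : Amb n} (hv : v ≠ 0) :
    fderiv ℝ (homExt f) v v = 0 := by
  have hline : HasDerivAt (fun t : ℝ => v + t • v) v 0 := by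
    simpa using ((hasDerivAt_id (0 : ℝ)).smul_const v).const_add v
  have hF : HasFDerivAt (homExt f) (fderiv ℝ (homExt f) v) (v + (0 : ℝ) • v) := by
    simpa using ((homExt_contDiffAt hf hv).differentiableAt (by simp)).hasFDerivAt
  have h := hF.comp_hasDerivAt (0 : ℝ) hline
  have h' : (homExt f ∘ fun t : ℝ => v + t • v) =ᶠ[𝓝 0] fun _ => homExt f v := by
    filter_upwards [eventually_gt_nhds (show (-1 : ℝ) < 0 by norm_num)] with t ht
    have := homExt_smul f (show 0 < 1 + t by linarith) v
    simpa [add_smul] using this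
  exact h.unique ((hasDerivAt_const (0 : ℝ) _).congr_of_eventuallyEq h')

theorem laplacian_homExt_eq_sum {n : ℕ} (F : Amb n → ℂ) (v : Amb n) :
    Laplacian.laplacian F v = ∑ i, fderiv ℝ (fderiv ℝ F) v (EuclideanSpace.single i 1)
      (EuclideanSpace.single i 1) := by
  rw [InnerProductSpace.laplacian_eq_iteratedFDeriv_orthonormalBasis _
    (EuclideanSpace.basisFun (Fin (n + 1)) ℝ)]
  simp [iteratedFDeriv_two_apply]

/-- If `Δ f = 0` on the sphere, then the extension is harmonic away from the origin, because its second
derivative is homogeneous. -/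
theorem laplacian_homExt_eq_zero {n : ℕ} {f : Sph n → ℂ} (hf : SmoothSph f)
    (h0 : sphLap f = 0) {v : Amb n} (hv : v ≠ 0) : Laplacian.laplacian (homExt f) v = 0 := by
  have hc : 0 < ‖v‖⁻¹ := inv_pos.mpr (norm_pos_iff.mpr hv)
  have h1 : homExt f = fun w : Amb n =>
      homExt f ((‖v‖⁻¹ • ContinuousLinearMap.id ℝ (Amb n)) w + 0) := by
    funext w
    simpa using (homExt_smul f hc w).symm
  have hx : (‖v‖⁻¹ • ContinuousLinearMap.id ℝ (Amb n)) v + 0 = (radial v hv : Amb n) := by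
    simp [radial]
  have h2 : ∀ i : Fin (n + 1), fderiv ℝ (fderiv ℝ (homExt f)) v (EuclideanSpace.single i 1)
      (EuclideanSpace.single i 1) = (‖v‖⁻¹ : ℂ) ^ 2 * fderiv ℝ (fderiv ℝ (homExt f)) (radial v hv)
      (EuclideanSpace.single i 1) (EuclideanSpace.single i 1) := fun i => by
    have := iteratedFDeriv_two_comp_affine (F := homExt f)
      (‖v‖⁻¹ • ContinuousLinearMap.id ℝ (Amb n)) 0 (x := v)
      (by rw [hx]; exact homExt_contDiffAt hf (ne_zero_of_mem_unit_sphere _))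
      (EuclideanSpace.single i 1) (EuclideanSpace.single i 1)
    rw [← h1, iteratedFDeriv_two_apply, hx] at this
    simp only [Matrix.cons_val_zero, Matrix.cons_val_one] at this
    rw [this]
    simp only [smul_apply, ContinuousLinearMap.id_apply, map_smul, Complex.real_smul]
    push_cast
    ring
  have h3 := congrFun h0 (radial v hv)
  simp only [sphLap, Pi.zero_apply, neg_eq_zero] at h3
  rw [laplacian_homExt_eq_sum] at h3 ⊢
  simp only [h2, ← Finset.mul_sum, h3, mul_zero]

/-- A harmonic function `f` on `S^n` has derivative zero: for a radial cut-off `ψ` supported away from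
the origin and the extension `F` of `f`, the integral of `∑ ∂ᵢ (ψ F̄ ∂ᵢ F) = ψ |∇F|²` vanishes. -/
theorem fderiv_homExt_eq_zero {n : ℕ} {f : Sph n → ℂ} (hf : SmoothSph f) (h0 : sphLap f = 0)
    (x : Sph n) : fderiv ℝ (homExt f) (x : Amb n) = 0 := by
  set F := homExt f with hF
  let b : ContDiffBump (1 : ℝ) := ⟨1 / 4, 1 / 2, by norm_num, by norm_num⟩
  let ψ : Amb n → ℝ := fun v => b (‖v‖ ^ 2)
  have hψ : ContDiff ℝ ∞ ψ := b.contDiff.comp (contDiff_norm_sq ℝ)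
  have hψ0 : ∀ v : Amb n, ‖v‖ < 1 / 2 → ψ v = 0 := fun v hv => by
    refine b.zero_of_le_dist ?_
    change (1 / 2 : ℝ) ≤ _
    rw [Real.dist_eq, abs_sub_comm, abs_of_nonneg] <;> nlinarith [norm_nonneg v]
  have hψ2 : ∀ v : Amb n, 2 < ‖v‖ → ψ v = 0 := fun v hv => by
    refine b.zero_of_le_dist ?_
    change (1 / 2 : ℝ) ≤ _
    rw [Real.dist_eq, abs_of_nonneg] <;> nlinarith [norm_nonneg v]
  let e : Fin (n + 1) → Amb n := fun i => EuclideanSpace.single i 1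
  let g : Fin (n + 1) → Amb n → ℂ := fun i v =>
    (ψ v : ℂ) * ((starRingEnd ℂ) (F v) * fderiv ℝ F v (e i))
  have hg0 : ∀ i, ∀ v : Amb n, ‖v‖ < 1 / 2 → g i =ᶠ[𝓝 v] 0 := fun i v hv => by
    filter_upwards [(continuous_norm.tendsto v).eventually (gt_mem_nhds hv)] with w hw
    simp [g, hψ0 w hw]
  have hFs : ∀ v : Amb n, v ≠ 0 → ContDiffAt ℝ ∞ F v := fun v hv => homExt_contDiffAt hf hv
  have hg : ∀ i, ContDiff ℝ 1 (g i) := fun i => by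
    rw [contDiff_iff_contDiffAt]
    intro v
    by_cases hv : v = 0
    · exact contDiffAt_const.congr_of_eventuallyEq (hg0 i v (by rw [hv]; norm_num))
    · have h1 : ContDiffAt ℝ ∞ (g i) v :=
        (Complex.ofRealCLM.contDiff.contDiffAt.comp v hψ.contDiffAt).mul
          ((Complex.conjCLE.contDiff.contDiffAt.comp v (hFs v hv)).mul
            (((hFs v hv).fderiv_right (m := ∞) le_rfl).clm_apply contDiffAt_const))
      exact contDiffAt_infty.mp h1 1
  have hgc : ∀ i, HasCompactSupport (g i) := fun i => by
    refine HasCompactSupport.intro (isCompact_closedBall (0 : Amb n) 2) fun v hv => ?_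
    have : 2 < ‖v‖ := by simpa using hv
    simp [g, hψ2 v this]
  let h : Amb n → ℝ := fun v => ψ v * ∑ i, ‖fderiv ℝ F v (e i)‖ ^ 2
  have hsum : ∀ v, ∑ i, fderiv ℝ (g i) v (e i) = (h v : ℂ) := fun v => by
    by_cases hv : v = 0
    · have h1 : ∀ i, fderiv ℝ (g i) v = 0 := fun i => by
        rw [(hg0 i v (by rw [hv]; norm_num)).fderiv_eq]
        simp
      simp [h1, h, hψ0 v (by rw [hv]; norm_num)]
    · have hFd : DifferentiableAt ℝ F v := (hFs v hv).differentiableAt (by simp)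
      have hFd2 : DifferentiableAt ℝ (fderiv ℝ F) v :=
        ((hFs v hv).fderiv_right (m := ∞) le_rfl).differentiableAt (by simp)
      have hb : HasDerivAt b (deriv b (‖v‖ ^ 2)) (‖v‖ ^ 2) :=
        (b.contDiff.differentiable (n := ∞) (by simp) _).hasDerivAt
      have hψd : HasFDerivAt ψ _ v :=
        HasFDerivAt.comp (g := b) v hb.hasFDerivAt (hasStrictFDerivAt_norm_sq v).hasFDerivAt
      have hψd' : HasFDerivAt (fun v => (ψ v : ℂ)) _ v := Complex.ofRealCLM.hasFDerivAt.comp v hψd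
      have hFc : HasFDerivAt (fun v => (starRingEnd ℂ) (F v)) _ v :=
        Complex.conjCLE.hasFDerivAt.comp v hFd.hasFDerivAt
      have h1 : ∀ i, fderiv ℝ (g i) v (e i) =
          (2 * deriv b (‖v‖ ^ 2) * (starRingEnd ℂ) (F v)) * ((v i : ℂ) * fderiv ℝ F v (e i)) +
          (ψ v : ℂ) * (‖fderiv ℝ F v (e i)‖ ^ 2 : ℝ) +
          ((ψ v : ℂ) * (starRingEnd ℂ) (F v)) * fderiv ℝ (fderiv ℝ F) v (e i) (e i) := fun i => by
        have h2 := hFd2.hasFDerivAt.clm_apply (hasFDerivAt_const (𝕜 := ℝ) (e i) v)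
        have h3 : HasFDerivAt (g i) _ v := hψd'.mul (hFc.mul h2)
        rw [h3.fderiv]
        have hn : ((‖fderiv ℝ F v (e i)‖ ^ 2 : ℝ) : ℂ) =
            fderiv ℝ F v (e i) * (starRingEnd ℂ) (fderiv ℝ F v (e i)) := by
          rw [Complex.mul_conj, Complex.normSq_eq_norm_sq]
        have hi : inner ℝ v (e i) = v i := by
          simp [e, EuclideanSpace.inner_single_right]
        rw [hn]
        simp [hi, -map_mul]
        ring
      -- the gradient of the radial function `ψ` is orthogonal to that of `F`
      have hE : ∑ i, (v i : ℂ) * fderiv ℝ F v (e i) = 0 := by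
        have h2 := fderiv_homExt_self hf hv
        have h3 : fderiv ℝ F v (∑ i, v i • e i) = 0 := by
          rw [← eq_sum_single v]; exact h2
        simpa [map_sum] using h3
      have hL := laplacian_homExt_eq_zero hf h0 hv
      rw [laplacian_homExt_eq_sum] at hL
      simp only [h1, Finset.sum_add_distrib, ← Finset.mul_sum, hE]
      rw [show ∑ i, fderiv ℝ (fderiv ℝ F) v (e i) (e i) = 0 from hL]
      simp [h]
  have hcont : Continuous h := by
    have h1 : Continuous fun v => ∑ i, fderiv ℝ (g i) v (e i) :=
      continuous_finsetSum _ fun i _ =>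
        ((hg i).continuous_fderiv one_ne_zero).clm_apply continuous_const
    simp only [hsum] at h1
    exact Complex.continuous_re.comp h1
  have hint : ∫ v, h v = 0 := by
    have h1 : ∫ v, ∑ i, fderiv ℝ (g i) v (e i) = 0 := by
      rw [MeasureTheory.integral_finsetSum]
      · exact Finset.sum_eq_zero fun i _ => integral_fderiv_eq_zero (hg i) (hgc i) _
      · intro i _
        exact (((hg i).continuous_fderiv one_ne_zero).clm_apply
          continuous_const).integrable_of_hasCompactSupport ((hgc i).fderiv_apply ℝ _)
    simp only [hsum] at h1
    exact Complex.ofReal_eq_zero.mp ((integral_ofReal (𝕜 := ℂ) (f := h)).symm.trans h1)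
  have hzero : h (x : Amb n) = 0 := by
    by_contra hne
    refine (Continuous.integral_pos_of_hasCompactSupport_nonneg_nonzero
      (μ := MeasureTheory.volume) hcont ?_ ?_ hne).ne' hint
    · refine HasCompactSupport.intro (isCompact_closedBall (0 : Amb n) 2) fun v hv => ?_
      have : 2 < ‖v‖ := by simpa using hv
      simp [h, hψ2 v this]
    · exact fun v => mul_nonneg b.nonneg (Finset.sum_nonneg fun i _ => by positivity)
  have hψ1 : ψ (x : Amb n) = 1 := by
    refine b.one_of_mem_closedBall ?_
    rw [mem_sphere_zero_iff_norm.mp x.2]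
    simp
    norm_num
  simp only [h, hψ1, one_mul] at hzero
  rw [Finset.sum_eq_zero_iff_of_nonneg fun i _ => by positivity] at hzero
  ext u
  rw [eq_sum_single u, map_sum]
  refine Finset.sum_eq_zero fun i hi => ?_
  have h1 := hzero i hi
  rw [map_smul, show fderiv ℝ F x (EuclideanSpace.single i 1) = 0 by simpa [e] using h1, smul_zero]

/-- Harmonic functions on `S^n`, `n ≥ 1`, are constant: `ℝ^{n+1} ∖ {0}` is connected. -/
theorem const_of_sphLap_eq_zero {n : ℕ} (hn : 1 ≤ n) {f : Sph n → ℂ} (hf : SmoothSph f)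
    (h0 : sphLap f = 0) (x y : Sph n) : f x = f y := by
  have hE : ∀ x : Sph n, homExt f (x : Amb n) = f x := fun x => by
    rw [homExt, dif_pos (ne_zero_of_mem_unit_sphere x), radial_sphere]
  rw [← hE x, ← hE y]
  have hrank : 1 < Module.rank ℝ (Amb n) := by
    rw [← Module.finrank_eq_rank, finrank_euclideanSpace_fin]
    exact_mod_cast by omega
  refine IsOpen.is_const_of_fderiv_eq_zero (𝕜 := ℝ) (s := {(0 : Amb n)}ᶜ) isOpen_compl_singleton
    (isConnected_compl_singleton_of_one_lt_rank hrank 0).isPreconnected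
    (fun v hv => ((homExt_contDiffAt hf hv).differentiableAt
      (by simp)).differentiableWithinAt) (fun v hv => ?_)
    (ne_zero_of_mem_unit_sphere x) (ne_zero_of_mem_unit_sphere y)
  ext u
  have hc : 0 < ‖v‖⁻¹ := inv_pos.mpr (norm_pos_iff.mpr hv)
  rw [fderiv_homExt_smul hf hc hv]
  have := fderiv_homExt_eq_zero hf h0 (radial v hv)
  rw [show ‖v‖⁻¹ • v = (radial v hv : Amb n) from rfl, this]
  rfl

/-! ### Spherical harmonics -/

/-- The coordinate functions on the sphere. -/
def crdS {n : ℕ} (k : Fin (n + 1)) (x : Sph n) : ℂ := ((x : Amb n) k : ℂ)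

theorem SmoothSph.fst {n m : ℕ} {f : Sph n → ℂ} (hf : SmoothSph f) :
    Smooth (fun z : Prd n m => f z.1) := hf.comp contMDiff_fst

theorem SmoothSph.snd {n m : ℕ} {f : Sph m → ℂ} (hf : SmoothSph f) :
    Smooth (fun z : Prd n m => f z.2) := hf.comp contMDiff_snd

theorem Smooth.slice_fst {p q : ℕ} {f : Prd p q → ℂ} (hf : Smooth f) (y : Sph q) :
    SmoothSph (fun x => f (x, y)) :=
  ContMDiff.comp hf (contMDiff_id.prodMk contMDiff_const)

theorem Smooth.slice_snd {p q : ℕ} {f : Prd p q → ℂ} (hf : Smooth f) (x : Sph p) :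
    SmoothSph (fun y => f (x, y)) :=
  ContMDiff.comp hf (contMDiff_const.prodMk contMDiff_id)

/-- A function on `S^n` as a function on `S^n × S^0`; this transfers the operator relations on
products to a single sphere. -/
def liftS {n : ℕ} (f : Sph n → ℂ) (hf : SmoothSph f) : SmoothFun n 0 := ⟨fun z => f z.1, hf.fst⟩

/-- A point of `S^0`. -/
def pt : Sph 0 := ⟨EuclideanSpace.single 0 1, by simp⟩

theorem SmoothSph.sphLap {n : ℕ} {f : Sph n → ℂ} (hf : SmoothSph f) : SmoothSph (sphLap f) :=
  (Smooth.lapP (hf.fst (m := 0))).slice_fst pt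

theorem smoothSph_crdS {n : ℕ} (k : Fin (n + 1)) : SmoothSph (crdS k) :=
  (smooth_crd (p := n) (q := 0) (.inl k)).slice_fst pt

theorem SmoothSph.mul {n : ℕ} {f g : Sph n → ℂ} (hf : SmoothSph f) (hg : SmoothSph g) :
    SmoothSph (f * g) :=
  (Smooth.mul (hf.fst (m := 0)) hg.fst).slice_fst pt

theorem SmoothSph.sub {n : ℕ} {f g : Sph n → ℂ} (hf : SmoothSph f) (hg : SmoothSph g) :
    SmoothSph (f - g) := by
  rw [sub_eq_add_neg, ← neg_one_smul ℂ g]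
  exact hf.add (hg.smul _)

theorem sphLap_sub {n : ℕ} {f g : Sph n → ℂ} (hf : SmoothSph f) (hg : SmoothSph g) :
    sphLap (f - g) = sphLap f - sphLap g := by
  rw [sub_eq_add_neg, ← neg_one_smul ℂ g, sphLap_add hf (hg.smul _), sphLap_smul _ hg,
    neg_one_smul, sub_eq_add_neg]

theorem tanDer_const {p q : ℕ} (a : Fin (p + 1) ⊕ Fin (q + 1)) (c : ℂ) :
    tanDer a (fun _ : Prd p q => c) = 0 := by
  funext z
  have h : homExt₂ (fun _ : Prd p q => c) =ᶠ[𝓝 (emb z)] fun _ => c :=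
    (eventually_emb_ne z).mono fun v hv => by rw [homExt₂, dif_pos hv]
  rw [tanDer, h.fderiv_eq]
  simp

theorem sphLap_const {n : ℕ} (c : ℂ) : sphLap (fun _ : Sph n => c) = 0 := by
  have h := lapP_eq_sum_tanDer (p := n) (q := 0) (smooth_const c)
  have h0 : ∀ a, tanDer (p := n) (q := 0) a 0 = 0 := fun a => tanDer_const a 0
  simp only [tanDer_const, h0] at h
  funext x
  have := h (x, pt)
  simpa [lapP] using this

/-- The relation `[Δ, x_k] = n x_k - 2 T_k` on a single sphere. -/
theorem sphLap_crdS_mul {n : ℕ} (k : Fin (n + 1)) {f : Sph n → ℂ} (hf : SmoothSph f) (x : Sph n) :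
    sphLap (crdS k * f) x - crdS k x * sphLap f x =
      n * (crdS k x * f x) - 2 * tanDer (q := 0) (.inl k) (fun z => f z.1) (x, pt) := by
  have h := congrArg (fun S : Module.End ℂ (SmoothFun n 0) => (S (liftS f hf)).1 (x, pt))
    ((sphereRel_inl (p := n) (q := 0)).lap_x k)
  have h1 := lapPOp_apply (mulX (.inl k) (liftS f hf))
  have h2 := lapPOp_apply (liftS f hf)
  have hn : ∀ (m : ℕ) (S : Module.End ℂ (SmoothFun n 0)) (g : SmoothFun n 0),
      (((m : Module.End ℂ (SmoothFun n 0)) * S) g).1 = (m : ℂ) • (S g).1 := fun m S g => by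
    rw [← nsmul_eq_mul, ← Nat.cast_smul_eq_nsmul ℂ]; rfl
  have h3 : ∀ S : Module.End ℂ (SmoothFun n 0), ((2 * S) (liftS f hf)).1 = (2 : ℂ) • (S (liftS f hf)).1 :=
    fun S => by exact_mod_cast hn 2 S (liftS f hf)
  change (((lapPOp n 0 * mulX (.inl k) - mulX (.inl k) * lapPOp n 0 :
      Module.End ℂ (SmoothFun n 0)) (liftS f hf)).1) (x, pt) =
    ((((n : Module.End ℂ (SmoothFun n 0)) * mulX (.inl k) : Module.End ℂ (SmoothFun n 0))
        (liftS f hf)).1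
      - ((2 * tanOp (.inl k) : Module.End ℂ (SmoothFun n 0)) (liftS f hf)).1) (x, pt) at h
  rw [hn, h3] at h
  change (lapPOp n 0 (mulX (.inl k) (liftS f hf))).1 (x, pt) -
    crd (.inl k) (x, pt) * (lapPOp n 0 (liftS f hf)).1 (x, pt) = _ at h
  rw [h1, h2] at h
  exact h

/-- The double commutator relation on a single sphere. -/
theorem sphLap_sphLap_crdS_mul {n : ℕ} (k : Fin (n + 1)) {f : Sph n → ℂ} (hf : SmoothSph f) {c : ℂ}
    (hc : sphLap f = c • f) :
    sphLap (sphLap (crdS k * f)) =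
      (2 * c + 2) • sphLap (crdS k * f) + (2 * c - c ^ 2 + n * (n - 2)) • (crdS k * f) := by
  funext x
  have h := congrArg (fun S : Module.End ℂ (SmoothFun n 0) => S (liftS f hf))
    ((sphereRel_inl (p := n) (q := 0)).double_comm (A := lapPOp n 0) k rfl)
  have hA : lapPOp n 0 (liftS f hf) = c • liftS f hf := Subtype.ext (by
    rw [lapPOp_apply]
    funext z
    exact congrFun hc z.1)
  have hn : ((n : Module.End ℂ (SmoothFun n 0)) * ((n : Module.End ℂ (SmoothFun n 0)) - 2)) *
      mulX (.inl k) = ((n : ℂ) * (n - 2)) • mulX (.inl k) := by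
    have e1 : (n : Module.End ℂ (SmoothFun n 0)) = (n : ℂ) • 1 := by
      rw [Nat.cast_smul_eq_nsmul, nsmul_eq_mul, mul_one]
    have e2 : (2 : Module.End ℂ (SmoothFun n 0)) = (2 : ℂ) • 1 := by
      rw [two_smul, one_add_one_eq_two]
    rw [e1, e2, ← sub_smul, smul_mul_smul_comm, one_mul, smul_mul_assoc, one_mul]
  have h2 : ∀ S : Module.End ℂ (SmoothFun n 0), 2 * S = (2 : ℂ) • S := fun S => by
    rw [two_smul, two_mul]
  rw [hn, h2] at h
  simp only [LinearMap.sub_apply, LinearMap.add_apply, LinearMap.smul_apply, Module.End.mul_apply,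
    hA, map_smul, map_sub, smul_add, smul_smul] at h
  set g := mulX (.inl k) (liftS f hf) with hg
  have hg1 : ∀ z, g.1 z = (crdS k * f) z.1 := fun z => rfl
  have hg2 : ∀ z, (lapPOp n 0 g).1 z = sphLap (crdS k * f) z.1 := fun z => by
    rw [lapPOp_apply]; rfl
  have hg3 : ∀ z, (lapPOp n 0 (lapPOp n 0 g)).1 z = sphLap (sphLap (crdS k * f)) z.1 := fun z => by
    rw [lapPOp_apply]
    simp only [lapP, hg2]
  have h' := congrArg (fun u : SmoothFun n 0 => u.1 (x, pt)) h
  simp only [SmoothFun.sub_val, SmoothFun.add_val, SmoothFun.smul_val, Pi.sub_apply, Pi.add_apply,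
    Pi.smul_apply, hg1, hg2, hg3, smul_eq_mul] at h' ⊢
  linear_combination h'

theorem sphHarm_zero_const {n : ℕ} (hn : 1 ≤ n) {f : Sph n → ℂ} (hf : f ∈ sphHarm n 0) (x y : Sph n) :
    f x = f y :=
  const_of_sphLap_eq_zero hn hf.1 (by simpa using hf.2) x y

/-- Multiplication by a coordinate maps `E(j)` to `E(j+1) ⊕ E(j-1)`. -/
theorem crdS_mul_mem {n j : ℕ} (hn : 1 ≤ n) (k : Fin (n + 1)) {f : Sph n → ℂ} (hf : f ∈ sphHarm n j) :
    ∃ g₁ ∈ sphHarm n (j + 1), ∃ g₂ ∈ sphHarm n (j - 1), crdS k * f = g₁ + g₂ ∧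
      (j = 0 → g₂ = 0) := by
  have hs := (smoothSph_crdS k).mul hf.1
  rcases Nat.eq_zero_or_pos j with rfl | hj
  · refine ⟨crdS k * f, ⟨hs, ?_⟩, 0, Submodule.zero_mem _, (add_zero _).symm, fun _ => rfl⟩
    obtain ⟨c, rfl⟩ : ∃ c, f = fun _ => c := ⟨f (radial (EuclideanSpace.single 0 1) (by simp)),
      funext fun x => sphHarm_zero_const hn hf _ _⟩
    funext x
    have h := sphLap_crdS_mul k hf.1 x
    rw [tanDer_const, sphLap_const] at h
    simp only [Pi.zero_apply, mul_zero, sub_zero] at h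
    rw [h]
    simp
  · set g := crdS k * f with hg
    have h := sphLap_sphLap_crdS_mul k hf.1 hf.2
    rw [← hg] at h
    -- by the double commutator relation `(Δ - c₁) (Δ - c₂)` kills `x_k f`, where `c₁`, `c₂` are the
    -- eigenvalues on `E(j+1)` and `E(j-1)`; as `c₁ ≠ c₂`, the function splits into eigenfunctions
    set c : ℂ := (j : ℂ) * ((j : ℂ) + n - 1) with hc
    set c₁ : ℂ := ((j : ℂ) + 1) * ((j : ℂ) + n) with hc₁
    set c₂ : ℂ := ((j : ℂ) - 1) * ((j : ℂ) + n - 2) with hc₂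
    have hd : (2 * (2 * j + n - 1) : ℂ) ≠ 0 := by
      have : ((2 * (2 * j + n - 1) : ℕ) : ℂ) ≠ 0 := by
        have : 2 * (2 * j + n - 1) ≠ 0 := by omega
        exact_mod_cast this
      have e : ((2 * (2 * j + n - 1) : ℕ) : ℂ) = 2 * (2 * j + n - 1) := by
        push_cast [show 1 ≤ 2 * j + n by omega]; ring
      rwa [e] at this
    set d := (2 * (2 * j + n - 1) : ℂ) with hdd
    have hsL := hs.sphLap
    have hlap : ∀ e : ℂ, sphLap (sphLap g - e • g) = sphLap (sphLap g) - e • sphLap g := fun e => by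
      rw [sphLap_sub hsL (hs.smul e), sphLap_smul e hs]
    refine ⟨d⁻¹ • (sphLap g - c₂ • g), ⟨(hsL.sub (hs.smul _)).smul _, ?_⟩,
      (-d⁻¹) • (sphLap g - c₁ • g), ⟨(hsL.sub (hs.smul _)).smul _, ?_⟩, ?_, by omega⟩
    · rw [sphLap_smul _ (hsL.sub (hs.smul _)), hlap, h, smul_comm]
      congr 1
      funext x
      simp only [Pi.sub_apply, Pi.add_apply, Pi.smul_apply, smul_eq_mul]
      push_cast
      rw [hc, hc₂]
      ring
    · rw [sphLap_smul _ (hsL.sub (hs.smul _)), hlap, h, smul_comm]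
      congr 1
      funext x
      simp only [Pi.sub_apply, Pi.add_apply, Pi.smul_apply, smul_eq_mul]
      push_cast [show 1 ≤ j from hj]
      rw [hc, hc₁]
      ring
    · funext x
      simp only [Pi.sub_apply, Pi.add_apply, Pi.smul_apply, smul_eq_mul]
      have h1 : d⁻¹ * d = 1 := inv_mul_cancel₀ hd
      have h2 : c₁ - c₂ = d := by rw [hc₁, hc₂, hdd]; ring
      linear_combination (-g x) * h1 - (d⁻¹ * g x) * h2

/-- The null coordinate `ζ = x₀ + i x₁`. -/
def nullCrd (n : ℕ) (x : Sph n) : ℂ := crdS 0 x + Complex.I * crdS 1 x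

theorem smoothSph_nullCrd {n : ℕ} : SmoothSph (nullCrd n) :=
  (smoothSph_crdS 0).add ((smoothSph_crdS 1).smul Complex.I)

theorem smoothSph_nullCrd_pow {n : ℕ} (j : ℕ) : SmoothSph (nullCrd n ^ j) := by
  induction j with
  | zero => exact contMDiff_const
  | succ j ih => rw [pow_succ']; exact smoothSph_nullCrd.mul ih

/-- The tangential derivative of `ζ^j` in the null direction `e₀ + i e₁`: the derivative of the linear
function `x₀ + i x₁` in this direction vanishes, and the radial correction contributes `-j ζ^{j+1}`. -/
theorem tanDer_nullCrd_pow {n : ℕ} (hn : 1 ≤ n) (j : ℕ) (z : Prd n 0) :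
    tanDer (.inl 0) (fun z : Prd n 0 => (nullCrd n ^ j) z.1) z +
      Complex.I * tanDer (.inl 1) (fun z : Prd n 0 => (nullCrd n ^ j) z.1) z =
        -(j * nullCrd n z.1 ^ (j + 1)) := by
  have h01 : (1 : Fin (n + 1)) ≠ 0 := by
    simp [Fin.ext_iff]; omega
  have hI := Complex.I_sq
  have h1 : ∀ a, tanDer (.inl a) (fun z : Prd n 0 => nullCrd n z.1) z =
      (if a = 0 then 1 else 0) + Complex.I * (if a = 1 then 1 else 0)
        - crdS a z.1 * nullCrd n z.1 := fun a => by
    have h := tanDer_add (smooth_crd (p := n) (q := 0) (.inl 0))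
      ((smooth_crd (.inl 1)).smul Complex.I) (.inl a)
    rw [tanDer_smul _ (smooth_crd _)] at h
    have h' := congrFun h z
    simp only [Pi.add_apply, Pi.smul_apply, tanDer_crd, SameBlock] at h'
    refine Eq.trans h' ?_
    simp only [Sum.inl.injEq, smul_eq_mul, nullCrd, if_true, Sum.isLeft_inl]
    simp only [show ∀ k, crd (.inl k) z = crdS k z.1 from fun _ => rfl]
    ring
  induction j with
  | zero =>
    have : (fun z : Prd n 0 => (nullCrd n ^ 0) z.1) = fun _ => 1 := by simp
    rw [this, tanDer_const, tanDer_const]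
    simp
  | succ j ih =>
    have h2 : ∀ a, tanDer a (fun z : Prd n 0 => (nullCrd n ^ (j + 1)) z.1) z =
        tanDer a (fun z : Prd n 0 => nullCrd n z.1) z * (nullCrd n ^ j) z.1 +
        nullCrd n z.1 * tanDer a (fun z : Prd n 0 => (nullCrd n ^ j) z.1) z := fun a => by
      have h := tanDer_mul (smoothSph_nullCrd.fst (m := 0)) ((smoothSph_nullCrd_pow j).fst (m := 0)) a
      refine Eq.trans ?_ (congrFun h z)
      congr 1
      funext w
      simp [pow_succ']
    rw [h2, h2, h1, h1, if_pos rfl, if_neg h01, if_neg h01.symm, if_pos rfl]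
    have hζ : crdS 0 z.1 + Complex.I * crdS 1 z.1 = nullCrd n z.1 := rfl
    push_cast
    simp only [Pi.pow_apply] at ih ⊢
    linear_combination nullCrd n z.1 * ih + nullCrd n z.1 ^ j * hI
      - nullCrd n z.1 * nullCrd n z.1 ^ j * hζ

/-- The powers of the null coordinate are highest weight vectors: `ζ ^ j ∈ E(j)`. -/
theorem nullCrd_pow_mem {n : ℕ} (hn : 1 ≤ n) (j : ℕ) : nullCrd n ^ j ∈ sphHarm n j := by
  refine ⟨smoothSph_nullCrd_pow j, ?_⟩
  induction j with
  | zero =>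
    have h : sphLap (nullCrd n ^ 0) = 0 := sphLap_const (n := n) 1
    rw [h]
    simp
  | succ j ih =>
    have hs := smoothSph_nullCrd_pow (n := n) j
    have e : nullCrd n ^ (j + 1) = crdS 0 * nullCrd n ^ j + Complex.I • (crdS 1 * nullCrd n ^ j) := by
      funext x
      simp only [Pi.pow_apply, Pi.add_apply, Pi.mul_apply, Pi.smul_apply, smul_eq_mul, pow_succ,
        nullCrd]
      ring
    funext x
    have h0 := sphLap_crdS_mul 0 hs x
    have h1 := sphLap_crdS_mul 1 hs x
    have h2 := tanDer_nullCrd_pow hn j (x, pt)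
    have h3 := congrFun ih x
    have e' : nullCrd n x ^ (j + 1) = nullCrd n x * nullCrd n x ^ j := pow_succ' _ _
    have hζ : crdS 0 x + Complex.I * crdS 1 x = nullCrd n x := rfl
    have h4 : sphLap (nullCrd n ^ (j + 1)) x = sphLap (crdS 0 * nullCrd n ^ j) x +
        Complex.I * sphLap (crdS 1 * nullCrd n ^ j) x := by
      rw [e, sphLap_add ((smoothSph_crdS 0).mul hs) (((smoothSph_crdS 1).mul hs).smul _),
        sphLap_smul _ ((smoothSph_crdS 1).mul hs)]
      rfl
    rw [h4]
    simp only [Pi.smul_apply, Pi.pow_apply, smul_eq_mul, e'] at h0 h1 h2 h3 ⊢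
    push_cast
    linear_combination h0 + Complex.I * h1 - 2 * h2 + nullCrd n x * h3
      + (sphLap (nullCrd n ^ j) x + n * nullCrd n x ^ j) * hζ

/-- The point `e₀` of the sphere. -/
def basePt (n : ℕ) : Sph n := ⟨EuclideanSpace.single 0 1, by simp⟩

theorem nullCrd_basePt {n : ℕ} (hn : 1 ≤ n) : nullCrd n (basePt n) = 1 := by
  have h : (1 : Fin (n + 1)) ≠ 0 := by
    simp [Fin.ext_iff]; omega
  simp [nullCrd, crdS, basePt, h]

/-! ### Rotations -/

theorem smoothSph_of_contDiffAt {n : ℕ} {G : Amb n → ℂ} (hG : ∀ x : Sph n, ContDiffAt ℝ ∞ G x) :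
    SmoothSph (fun x : Sph n => G x) := fun x => by
  have := fact_finrank n
  exact ContMDiffAt.comp (I' := 𝓘(ℝ, Amb n)) x (hG x).contMDiffAt
    (contMDiff_coe_sphere (E := Amb n) (n := n)).contMDiffAt

theorem homExt_coe {n : ℕ} (f : Sph n → ℂ) (x : Sph n) : homExt f (x : Amb n) = f x := by
  rw [homExt, dif_pos (ne_zero_of_mem_unit_sphere x), radial_sphere]

theorem homExt_rotSph {n : ℕ} (f : Sph n → ℂ) (u : Amb n ≃ₗᵢ[ℝ] Amb n) :
    homExt (fun x => f (rotSph u x)) = fun v => homExt f (u v) := by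
  funext v
  by_cases hv : v = 0
  · simp [homExt, hv]
  · have huv : u v ≠ 0 := by simpa using hv
    rw [homExt, homExt, dif_pos hv, dif_pos huv]
    congr 1
    apply Subtype.ext
    simp [rotSph, radial]

theorem sphHarm_rot {n j : ℕ} {f : Sph n → ℂ} (hf : f ∈ sphHarm n j) (u : Amb n ≃ₗᵢ[ℝ] Amb n) :
    (fun x => f (rotSph u x)) ∈ sphHarm n j := by
  have hG : ∀ x : Sph n, ContDiffAt ℝ ∞ (fun v => homExt f (u v)) (x : Amb n) := fun x =>
    ContDiffAt.comp (x : Amb n) (homExt_contDiffAt hf.1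
      (show u (x : Amb n) ≠ 0 by simpa using ne_zero_of_mem_unit_sphere x))
      u.toContinuousLinearEquiv.contDiff.contDiffAt
  refine ⟨?_, ?_⟩
  · convert smoothSph_of_contDiffAt hG using 1
    funext x
    exact (homExt_coe f (rotSph u x)).symm
  · funext x
    have h := congrFun hf.2 (rotSph u x)
    simp only [sphLap, homExt_rotSph, Pi.smul_apply] at h ⊢
    rw [← h]
    congr 1
    rw [InnerProductSpace.laplacian_eq_iteratedFDeriv_orthonormalBasis _
      (EuclideanSpace.basisFun (Fin (n + 1)) ℝ),
      InnerProductSpace.laplacian_eq_iteratedFDeriv_orthonormalBasis (homExt f)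
      ((EuclideanSpace.basisFun (Fin (n + 1)) ℝ).map u)]
    refine Finset.sum_congr rfl fun i _ => ?_
    have h2 := iteratedFDeriv_two_comp_affine (F := homExt f)
      (u.toContinuousLinearEquiv : Amb n →L[ℝ] Amb n) 0 (x := x)
      (by
        simp only [add_zero]
        exact homExt_contDiffAt hf.1
          (show u (x : Amb n) ≠ 0 by simpa using ne_zero_of_mem_unit_sphere x))
      (EuclideanSpace.basisFun (Fin (n + 1)) ℝ i) (EuclideanSpace.basisFun (Fin (n + 1)) ℝ i)
    simp only [add_zero] at h2
    refine Eq.trans h2 ?_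
    rw [iteratedFDeriv_two_apply]
    rfl

/-! ### The `K`-types as joint eigenspaces -/

/-- The eigenvalue `j (j + n - 1)` of the Laplacian on the spherical harmonics of order `j`. -/
def eigLap (n j : ℕ) : ℂ := (j : ℂ) * ((j : ℂ) + n - 1)

theorem eigLap_re (n j : ℕ) : (eigLap n j).re = (j : ℝ) * ((j : ℝ) + n - 1) := by
  have : eigLap n j = (((j : ℝ) * ((j : ℝ) + n - 1) : ℝ) : ℂ) := by
    rw [eigLap]; push_cast; ring
  rw [this, Complex.ofReal_re]

theorem eigLap_im (n j : ℕ) : (eigLap n j).im = 0 := by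
  have : eigLap n j = (((j : ℝ) * ((j : ℝ) + n - 1) : ℝ) : ℂ) := by
    rw [eigLap]; push_cast; ring
  rw [this, Complex.ofReal_im]

theorem eigLap_injective {n : ℕ} (hn : 1 ≤ n) : Function.Injective (eigLap n) := by
  intro j k h
  have h' := congrArg Complex.re h
  rw [eigLap_re, eigLap_re] at h'
  have hn' : (1 : ℝ) ≤ n := by exact_mod_cast hn
  have h2 : ((j : ℝ) - k) * (j + k + n - 1) = 0 := by linear_combination h'
  rcases mul_eq_zero.mp h2 with h3 | h3
  · exact_mod_cast sub_eq_zero.mp h3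
  · have hj : (0 : ℝ) ≤ j := Nat.cast_nonneg j
    have hk : (0 : ℝ) ≤ k := Nat.cast_nonneg k
    have e1 : (j : ℝ) = 0 := by linarith
    have e2 : (k : ℝ) = 0 := by linarith
    exact_mod_cast e1.trans e2.symm

theorem Smooth.of_mem_kType {j k : ℕ} {u : Prd p q → ℂ} (hu : u ∈ kType p q j k) : Smooth u := by
  have h : kType p q j k ≤ smoothFun p q := by
    refine Submodule.span_le.mpr ?_
    rintro _ ⟨f, hf, g, hg, rfl⟩
    exact (hf.1.fst).mul hg.1.snd
  exact h hu

theorem Smooth.of_mem_kFinite {u : Prd p q → ℂ} (hu : u ∈ kFinite p q) : Smooth u :=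
  kFinite_induction (φ := Smooth) (fun _ _ _ h => .of_mem_kType h) (fun _ _ h h' => h.add h') hu

/-- `V(j,k)` as a space of smooth functions. -/
def kT (p q j k : ℕ) : Submodule ℂ (SmoothFun p q) := (kType p q j k).comap (SmoothFun.incl p q)

/-- The sum of the `V(j,k)` with `j + k ≡ n` modulo `2`, as a space of smooth functions. -/
def kPar (p q n : ℕ) : Submodule ℂ (SmoothFun p q) :=
  (⨆ (j : ℕ) (k : ℕ) (_ : (j + k) % 2 = n % 2), kType p q j k).comap (SmoothFun.incl p q)

theorem mem_kPar {ε : Fin 2} {u : SmoothFun p q} :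
    u ∈ kPar p q ε ↔ u.1 ∈ kFinitePar p q ε := by
  have h : (ε : ℕ) % 2 = ε := Nat.mod_eq_of_lt ε.2
  rw [kPar, kFinitePar, h]
  rfl

theorem kPar_congr {n m : ℕ} (h : n % 2 = m % 2) : kPar p q n = kPar p q m := by
  rw [kPar, kPar, h]

theorem kT_le_kPar {j k n : ℕ} (h : (j + k) % 2 = n % 2) : kT p q j k ≤ kPar p q n :=
  Submodule.comap_mono (le_iSup₂_of_le j k (le_iSup_of_le h le_rfl))

theorem kPar_induction {n : ℕ} {φ : SmoothFun p q → Prop}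
    (hφ : ∀ j k, (j + k) % 2 = n % 2 → ∀ u ∈ kT p q j k, φ u)
    (h0 : φ 0) (hadd : ∀ u v, φ u → φ v → φ (u + v))
    {u : SmoothFun p q} (hu : u ∈ kPar p q n) : φ u := by
  have hu' : u.1 ∈ ⨆ (j : ℕ) (k : ℕ) (_ : (j + k) % 2 = n % 2), kType p q j k := hu
  have hu'' : u.1 ∈ ⨆ jk : {jk : ℕ × ℕ // (jk.1 + jk.2) % 2 = n % 2}, kType p q jk.1.1 jk.1.2 := by
    rw [iSup_subtype, iSup_prod]; exact hu'
  have h := Submodule.iSup_induction _ (motive := fun f => ∃ hf : Smooth f, φ ⟨f, hf⟩) hu''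
    (fun jk f hf => ⟨.of_mem_kType hf, hφ _ _ jk.2 ⟨f, .of_mem_kType hf⟩ hf⟩) ⟨Smooth.zero, h0⟩
    (fun f g hf hg => ⟨hf.1.add hg.1, hadd _ _ hf.2 hg.2⟩)
  exact h.2

theorem lapPOp_of_mem_kT {j k : ℕ} {u : SmoothFun p q} (hu : u ∈ kT p q j k) :
    lapPOp p q u = eigLap p j • u :=
  Subtype.ext ((lapPOp_apply u).trans (kType_spec hu).2.1)

theorem lapQOp_of_mem_kT {j k : ℕ} {u : SmoothFun p q} (hu : u ∈ kT p q j k) :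
    lapQOp p q u = eigLap q k • u :=
  Subtype.ext ((lapQOp_apply u).trans (kType_spec hu).2.2)

/-- Eigenspaces are independent, so there is a linear map that is the identity on one of them and
vanishes on the others, whether or not they span. -/
theorem exists_spectral_projection {V : Type*} [AddCommGroup V] [Module ℂ V] (T : Module.End ℂ V)
    (μ : ℂ) : ∃ S : Module.End ℂ V, (∀ v, T v = μ • v → S v = v) ∧
      ∀ ν, ν ≠ μ → ∀ v, T v = ν • v → S v = 0 := by
  classical
  have hinj := (Module.End.eigenspaces_iSupIndep T).dfinsupp_lsum_injective
  set ι : (Π₀ μ : ℂ, T.eigenspace μ) →ₗ[ℂ] V :=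
    DFinsupp.lsum ℂ fun μ => (T.eigenspace μ).subtype with hι
  have hinj' : Function.Injective ι := hinj
  obtain ⟨g, hg⟩ := LinearMap.exists_leftInverse_of_injective ι (LinearMap.ker_eq_bot.mpr hinj')
  have key : ∀ (ν : ℂ) (v : V) (hv : T v = ν • v), g v = DFinsupp.single ν
      ⟨v, Module.End.mem_eigenspace_iff.mpr hv⟩ := fun ν v hv => by
    have h1 : ι (DFinsupp.single ν ⟨v, Module.End.mem_eigenspace_iff.mpr hv⟩) = v := by
      simp [hι]
    conv_lhs => rw [← h1]
    exact LinearMap.congr_fun hg _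
  refine ⟨(T.eigenspace μ).subtype ∘ₗ DFinsupp.lapply μ ∘ₗ g, fun v hv => ?_, fun ν hν v hv => ?_⟩
  · simp only [LinearMap.comp_apply, key μ v hv, DFinsupp.lapply_apply, DFinsupp.single_eq_same]
    rfl
  · simp only [LinearMap.comp_apply, key ν v hv, DFinsupp.lapply_apply]
    rw [DFinsupp.single_eq_of_ne hν.symm, map_zero]

/-- A projection of `C^∞(S^p × S^q)` onto an eigenspace of `Δ_{S^p} + i Δ_{S^q}`, for the eigenvalue that
this operator has on `V(j,k)`. As the eigenvalues of the two Laplacians are real, this eigenvalue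
determines both of them, and the projection vanishes on the other `V(j',k')`. -/
def pr (p q j k : ℕ) : Module.End ℂ (SmoothFun p q) :=
  (exists_spectral_projection (lapPOp p q + Complex.I • lapQOp p q)
    (eigLap p j + Complex.I * eigLap q k)).choose

theorem pr_of_eigen {j k : ℕ} {u : SmoothFun p q} (hp : lapPOp p q u = eigLap p j • u)
    (hq : lapQOp p q u = eigLap q k • u) : pr p q j k u = u := by
  refine (exists_spectral_projection (lapPOp p q + Complex.I • lapQOp p q)
    (eigLap p j + Complex.I * eigLap q k)).choose_spec.1 u ?_
  rw [LinearMap.add_apply, LinearMap.smul_apply, hp, hq, add_smul, mul_smul]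

theorem pr_self {j k : ℕ} {u : SmoothFun p q} (hu : u ∈ kT p q j k) : pr p q j k u = u :=
  pr_of_eigen (lapPOp_of_mem_kT hu) (lapQOp_of_mem_kT hu)

theorem pr_of_ne (hp : 1 ≤ p) (hq : 1 ≤ q) {j k j' k' : ℕ} (h : (j, k) ≠ (j', k'))
    {u : SmoothFun p q} (hu : u ∈ kT p q j k) : pr p q j' k' u = 0 := by
  refine (exists_spectral_projection (lapPOp p q + Complex.I • lapQOp p q)
    (eigLap p j' + Complex.I * eigLap q k')).choose_spec.2
      (eigLap p j + Complex.I * eigLap q k) (fun he => h ?_) u ?_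
  · have h1 := congrArg Complex.re he
    have h2 := congrArg Complex.im he
    simp only [Complex.add_re, Complex.add_im, Complex.mul_re, Complex.mul_im, Complex.I_re,
      Complex.I_im, eigLap_im] at h1 h2
    refine Prod.ext (eigLap_injective hp (Complex.ext ?_ ?_))
      (eigLap_injective hq (Complex.ext ?_ ?_))
    · linarith
    · simp only [eigLap_im]
    · linarith
    · simp only [eigLap_im]
  · rw [LinearMap.add_apply, LinearMap.smul_apply, lapPOp_of_mem_kT hu, lapQOp_of_mem_kT hu,
      add_smul, mul_smul]

theorem pr_mem (hp : 1 ≤ p) (hq : 1 ≤ q) {n : ℕ} (j k : ℕ) {u : SmoothFun p q}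
    (hu : u ∈ kPar p q n) : pr p q j k u ∈ kT p q j k := by
  refine kPar_induction (φ := fun u => pr p q j k u ∈ kT p q j k) (fun j' k' _ u hu => ?_) ?_ ?_ hu
  · by_cases h : (j', k') = (j, k)
    · obtain ⟨rfl, rfl⟩ := Prod.mk.inj h
      rwa [pr_self hu]
    · rw [pr_of_ne hp hq h hu]; exact Submodule.zero_mem _
  · rw [map_zero]; exact Submodule.zero_mem _
  · intro u v hu hv; rw [map_add]; exact Submodule.add_mem _ hu hv

/-- Within `𝓔^ε` the component `V(j,k)` is the whole joint eigenspace. -/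
theorem mem_kT_of_eigen (hp : 1 ≤ p) (hq : 1 ≤ q) {n j k : ℕ} {u : SmoothFun p q}
    (hu : u ∈ kPar p q n) (h1 : lapPOp p q u = eigLap p j • u)
    (h2 : lapQOp p q u = eigLap q k • u) : u ∈ kT p q j k := by
  rw [← pr_of_eigen h1 h2]
  exact pr_mem hp hq j k hu

theorem pr_lapPOp (hp : 1 ≤ p) (hq : 1 ≤ q) {n : ℕ} (j k : ℕ) {u : SmoothFun p q}
    (hu : u ∈ kPar p q n) : pr p q j k (lapPOp p q u) = eigLap p j • pr p q j k u := by
  refine kPar_induction (φ := fun u => pr p q j k (lapPOp p q u) = eigLap p j • pr p q j k u)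
    (fun j' k' _ u hu => ?_) ?_ ?_ hu
  · rw [lapPOp_of_mem_kT hu, map_smul]
    by_cases h : (j', k') = (j, k)
    · rw [(Prod.mk.inj h).1]
    · rw [pr_of_ne hp hq h hu, smul_zero, smul_zero]
  · simp only [map_zero, smul_zero]
  · intro u v hu hv; rw [map_add, map_add, map_add, smul_add, hu, hv]

theorem pr_lapQOp (hp : 1 ≤ p) (hq : 1 ≤ q) {n : ℕ} (j k : ℕ) {u : SmoothFun p q}
    (hu : u ∈ kPar p q n) : pr p q j k (lapQOp p q u) = eigLap q k • pr p q j k u := by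
  refine kPar_induction (φ := fun u => pr p q j k (lapQOp p q u) = eigLap q k • pr p q j k u)
    (fun j' k' _ u hu => ?_) ?_ ?_ hu
  · rw [lapQOp_of_mem_kT hu, map_smul]
    by_cases h : (j', k') = (j, k)
    · rw [(Prod.mk.inj h).2]
    · rw [pr_of_ne hp hq h hu, smul_zero, smul_zero]
  · simp only [map_zero, smul_zero]
  · intro u v hu hv; rw [map_add, map_add, map_add, smul_add, hu, hv]

/-! ### Stability under multiplication by coordinates and under the Lie algebra -/

/-- Multiplication by `x_i` maps `V(j,k)` to `V(j+1,k) ⊕ V(j-1,k)`. -/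
theorem mulX_inl_mem (hp : 1 ≤ p) (i : Fin (p + 1)) {j k : ℕ} {u : SmoothFun p q}
    (hu : u ∈ kT p q j k) : ∃ u₁ ∈ kT p q (j + 1) k, ∃ u₂ ∈ kT p q (j - 1) k,
      mulX (.inl i) u = u₁ + u₂ ∧ (j = 0 → u₂ = 0) := by
  obtain ⟨f, hf⟩ := u
  have hf' : f ∈ kType p q j k := hu
  have h : ∃ u₁ ∈ kType p q (j + 1) k, ∃ u₂ ∈ kType p q (j - 1) k,
      crd (.inl i) * f = u₁ + u₂ ∧ (j = 0 → u₂ = 0) := by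
    clear hu hf
    induction hf' using Submodule.span_induction with
    | mem u hu =>
      obtain ⟨f, hf, g, hg, rfl⟩ := hu
      obtain ⟨f₁, h₁, f₂, h₂, he, h0⟩ := crdS_mul_mem hp i hf
      refine ⟨_, Submodule.subset_span ⟨f₁, h₁, g, hg, rfl⟩, _,
        Submodule.subset_span ⟨f₂, h₂, g, hg, rfl⟩, ?_, fun hj => ?_⟩
      · funext z
        have := congrFun he z.1
        simp only [Pi.mul_apply, Pi.add_apply] at this ⊢
        rw [← add_mul, ← this, mul_assoc]
        rfl
      · funext z
        simp [h0 hj]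
    | zero => exact ⟨0, Submodule.zero_mem _, 0, Submodule.zero_mem _, by simp, fun _ => rfl⟩
    | add u v _ _ hu hv =>
      obtain ⟨u₁, h₁, u₂, h₂, he, h0⟩ := hu
      obtain ⟨v₁, k₁, v₂, k₂, ke, k0⟩ := hv
      exact ⟨_, Submodule.add_mem _ h₁ k₁, _, Submodule.add_mem _ h₂ k₂, by rw [mul_add, he, ke]; abel,
        fun hj => by rw [h0 hj, k0 hj, add_zero]⟩
    | smul c u _ hu =>
      obtain ⟨u₁, h₁, u₂, h₂, he, h0⟩ := hu
      exact ⟨_, Submodule.smul_mem _ c h₁, _, Submodule.smul_mem _ c h₂,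
        by rw [mul_smul_comm, he, smul_add], fun hj => by rw [h0 hj, smul_zero]⟩
  obtain ⟨u₁, h₁, u₂, h₂, he, h0⟩ := h
  exact ⟨⟨u₁, .of_mem_kType h₁⟩, h₁, ⟨u₂, .of_mem_kType h₂⟩, h₂, Subtype.ext he,
    fun hj => Subtype.ext (h0 hj)⟩

/-- Multiplication by `y_l` maps `V(j,k)` to `V(j,k+1) ⊕ V(j,k-1)`. -/
theorem mulX_inr_mem (hq : 1 ≤ q) (l : Fin (q + 1)) {j k : ℕ} {u : SmoothFun p q}
    (hu : u ∈ kT p q j k) : ∃ u₁ ∈ kT p q j (k + 1), ∃ u₂ ∈ kT p q j (k - 1),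
      mulX (.inr l) u = u₁ + u₂ ∧ (k = 0 → u₂ = 0) := by
  obtain ⟨f, hf⟩ := u
  have hf' : f ∈ kType p q j k := hu
  have h : ∃ u₁ ∈ kType p q j (k + 1), ∃ u₂ ∈ kType p q j (k - 1),
      crd (.inr l) * f = u₁ + u₂ ∧ (k = 0 → u₂ = 0) := by
    clear hu hf
    induction hf' using Submodule.span_induction with
    | mem u hu =>
      obtain ⟨f, hf, g, hg, rfl⟩ := hu
      obtain ⟨f₁, h₁, f₂, h₂, he, h0⟩ := crdS_mul_mem hq l hg
      refine ⟨_, Submodule.subset_span ⟨f, hf, f₁, h₁, rfl⟩, _,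
        Submodule.subset_span ⟨f, hf, f₂, h₂, rfl⟩, ?_, fun hj => ?_⟩
      · funext z
        have := congrFun he z.2
        simp only [Pi.mul_apply, Pi.add_apply] at this ⊢
        rw [← mul_add, ← this, mul_left_comm]
        rfl
      · funext z
        simp [h0 hj]
    | zero => exact ⟨0, Submodule.zero_mem _, 0, Submodule.zero_mem _, by simp, fun _ => rfl⟩
    | add u v _ _ hu hv =>
      obtain ⟨u₁, h₁, u₂, h₂, he, h0⟩ := hu
      obtain ⟨v₁, k₁, v₂, k₂, ke, k0⟩ := hv
      exact ⟨_, Submodule.add_mem _ h₁ k₁, _, Submodule.add_mem _ h₂ k₂, by rw [mul_add, he, ke]; abel,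
        fun hj => by rw [h0 hj, k0 hj, add_zero]⟩
    | smul c u _ hu =>
      obtain ⟨u₁, h₁, u₂, h₂, he, h0⟩ := hu
      exact ⟨_, Submodule.smul_mem _ c h₁, _, Submodule.smul_mem _ c h₂,
        by rw [mul_smul_comm, he, smul_add], fun hj => by rw [h0 hj, smul_zero]⟩
  obtain ⟨u₁, h₁, u₂, h₂, he, h0⟩ := h
  exact ⟨⟨u₁, .of_mem_kType h₁⟩, h₁, ⟨u₂, .of_mem_kType h₂⟩, h₂, Subtype.ext he,
    fun hj => Subtype.ext (h0 hj)⟩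

theorem mulX_mem_kPar (hp : 1 ≤ p) (hq : 1 ≤ q) (a : Fin (p + 1) ⊕ Fin (q + 1)) {n : ℕ}
    {u : SmoothFun p q} (hu : u ∈ kPar p q n) : mulX a u ∈ kPar p q (n + 1) := by
  refine kPar_induction (φ := fun u => mulX a u ∈ kPar p q (n + 1)) (fun j k hjk u hu => ?_) ?_ ?_ hu
  · rcases a with i | l
    · obtain ⟨u₁, h₁, u₂, h₂, he, h0⟩ := mulX_inl_mem hp i hu
      rw [he]
      refine Submodule.add_mem _ (kT_le_kPar (by omega) h₁) ?_
      by_cases hj : j = 0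
      · rw [h0 hj]; exact Submodule.zero_mem _
      · exact kT_le_kPar (by omega) h₂
    · obtain ⟨u₁, h₁, u₂, h₂, he, h0⟩ := mulX_inr_mem hq l hu
      rw [he]
      refine Submodule.add_mem _ (kT_le_kPar (by omega) h₁) ?_
      by_cases hk : k = 0
      · rw [h0 hk]; exact Submodule.zero_mem _
      · exact kT_le_kPar (by omega) h₂
  · rw [map_zero]; exact Submodule.zero_mem _
  · intro u v hu hv; rw [map_add]; exact Submodule.add_mem _ hu hv

theorem lapPOp_mem_kPar {n : ℕ} {u : SmoothFun p q} (hu : u ∈ kPar p q n) :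
    lapPOp p q u ∈ kPar p q n := by
  refine kPar_induction (φ := fun u => lapPOp p q u ∈ kPar p q n) (fun j k hjk u hu => ?_) ?_ ?_ hu
  · rw [lapPOp_of_mem_kT hu]; exact Submodule.smul_mem _ _ (kT_le_kPar hjk hu)
  · rw [map_zero]; exact Submodule.zero_mem _
  · intro u v hu hv; rw [map_add]; exact Submodule.add_mem _ hu hv

theorem lapQOp_mem_kPar {n : ℕ} {u : SmoothFun p q} (hu : u ∈ kPar p q n) :
    lapQOp p q u ∈ kPar p q n := by
  refine kPar_induction (φ := fun u => lapQOp p q u ∈ kPar p q n) (fun j k hjk u hu => ?_) ?_ ?_ hu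
  · rw [lapQOp_of_mem_kT hu]; exact Submodule.smul_mem _ _ (kT_le_kPar hjk hu)
  · rw [map_zero]; exact Submodule.zero_mem _
  · intro u v hu hv; rw [map_add]; exact Submodule.add_mem _ hu hv

theorem natCast_mul_end_apply (m : ℕ) (S : Module.End ℂ (SmoothFun p q)) (u : SmoothFun p q) :
    ((m : Module.End ℂ (SmoothFun p q)) * S) u = (m : ℂ) • S u := by
  rw [← nsmul_eq_mul, ← Nat.cast_smul_eq_nsmul ℂ]; rfl

theorem two_smul_tanOp_inl (i : Fin (p + 1)) (u : SmoothFun p q) :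
    (2 : ℂ) • tanOp (.inl i) u = (p : ℂ) • mulX (.inl i) u -
      (lapPOp p q (mulX (.inl i) u) - mulX (.inl i) (lapPOp p q u)) := by
  have h := LinearMap.congr_fun ((sphereRel_inl (p := p) (q := q)).lap_x i) u
  change lapPOp p q (mulX (.inl i) u) - mulX (.inl i) (lapPOp p q u) =
    (((p : Module.End ℂ (SmoothFun p q)) * mulX (.inl i) : Module.End ℂ (SmoothFun p q)) u) -
      ((2 * tanOp (.inl i) : Module.End ℂ (SmoothFun p q)) u) at h
  have h2 := natCast_mul_end_apply 2 (tanOp (.inl i)) u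
  rw [Nat.cast_ofNat, Nat.cast_ofNat] at h2
  rw [natCast_mul_end_apply, h2] at h
  rw [h]; abel

theorem two_smul_tanOp_inr (l : Fin (q + 1)) (u : SmoothFun p q) :
    (2 : ℂ) • tanOp (.inr l) u = (q : ℂ) • mulX (.inr l) u -
      (lapQOp p q (mulX (.inr l) u) - mulX (.inr l) (lapQOp p q u)) := by
  have h := LinearMap.congr_fun ((sphereRel_inr (p := p) (q := q)).lap_x l) u
  change lapQOp p q (mulX (.inr l) u) - mulX (.inr l) (lapQOp p q u) =
    (((q : Module.End ℂ (SmoothFun p q)) * mulX (.inr l) : Module.End ℂ (SmoothFun p q)) u) -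
      ((2 * tanOp (.inr l) : Module.End ℂ (SmoothFun p q)) u) at h
  have h2 := natCast_mul_end_apply 2 (tanOp (.inr l)) u
  rw [Nat.cast_ofNat, Nat.cast_ofNat] at h2
  rw [natCast_mul_end_apply, h2] at h
  rw [h]; abel

/-- The tangential derivatives change the parity, because they are combinations of a coordinate and
of its commutator with the Laplacian. -/
theorem tanOp_mem_kPar (hp : 1 ≤ p) (hq : 1 ≤ q) (a : Fin (p + 1) ⊕ Fin (q + 1)) {n : ℕ}
    {u : SmoothFun p q} (hu : u ∈ kPar p q n) : tanOp a u ∈ kPar p q (n + 1) := by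
  refine (Submodule.smul_mem_iff _ (two_ne_zero (α := ℂ))).mp ?_
  have hx := mulX_mem_kPar hp hq a hu
  rcases a with i | l
  · rw [two_smul_tanOp_inl]
    exact Submodule.sub_mem _ (Submodule.smul_mem _ _ hx)
      (Submodule.sub_mem _ (lapPOp_mem_kPar hx) (mulX_mem_kPar hp hq _ (lapPOp_mem_kPar hu)))
  · rw [two_smul_tanOp_inr]
    exact Submodule.sub_mem _ (Submodule.smul_mem _ _ hx)
      (Submodule.sub_mem _ (lapQOp_mem_kPar hx) (mulX_mem_kPar hp hq _ (lapQOp_mem_kPar hu)))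

theorem confOp_mem_kPar (hp : 1 ≤ p) (hq : 1 ≤ q) (a : ℂ) (X : lieG p q) {n : ℕ}
    {u : SmoothFun p q} (hu : u ∈ kPar p q n) : confOp a X u ∈ kPar p q n := by
  have h2 : kPar p q (n + 1 + 1) = kPar p q n := kPar_congr (by omega)
  simp only [confOp, LinearMap.sub_apply, LinearMap.smul_apply, LinearMap.sum_apply,
    Module.End.mul_apply]
  refine Submodule.sub_mem _ (Submodule.sum_mem _ fun b _ => Submodule.sum_mem _ fun c _ =>
    Submodule.smul_mem _ _ ?_) (Submodule.smul_mem _ _ (Submodule.sum_mem _ fun i _ =>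
      Submodule.sum_mem _ fun b _ => Submodule.smul_mem _ _ ?_))
  · rw [← h2]; exact mulX_mem_kPar hp hq _ (tanOp_mem_kPar hp hq _ hu)
  · rw [← h2]; exact mulX_mem_kPar hp hq _ (mulX_mem_kPar hp hq _ hu)

theorem confRep_mem_kFinitePar (hp : 1 ≤ p) (hq : 1 ≤ q) (a : ℝ) (X : lieG p q) {ε : Fin 2}
    {f : Prd p q → ℂ} (hf : f ∈ kFinitePar p q ε) : confRep a X f ∈ kFinitePar p q ε := by
  have hs : Smooth f := .of_mem_kFinite (kFinitePar_le p q ε hf)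
  have h := confOp_mem_kPar hp hq (a : ℂ) X (u := ⟨f, hs⟩) (mem_kPar.mpr hf)
  have e : (confOp (a : ℂ) X ⟨f, hs⟩).1 = confRep a X f := confOp_apply a X ⟨f, hs⟩
  exact e ▸ mem_kPar.mp h

theorem rotAct_mem_kType {j k : ℕ} {f : Prd p q → ℂ} (hf : f ∈ kType p q j k)
    (u : Amb p ≃ₗᵢ[ℝ] Amb p) (v : Amb q ≃ₗᵢ[ℝ] Amb q) : rotAct u v f ∈ kType p q j k := by
  induction hf using Submodule.span_induction with
  | mem f hf =>
    obtain ⟨f, hf, g, hg, rfl⟩ := hf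
    exact Submodule.subset_span ⟨_, sphHarm_rot hf u.symm, _, sphHarm_rot hg v.symm, rfl⟩
  | zero => exact Submodule.zero_mem _
  | add f g _ _ hf hg => exact Submodule.add_mem _ hf hg
  | smul c f _ hf => exact Submodule.smul_mem _ c hf

/-- The action of a pair of isometries on functions, as a linear map. -/
def rotActL (u : Amb p ≃ₗᵢ[ℝ] Amb p) (v : Amb q ≃ₗᵢ[ℝ] Amb q) :
    (Prd p q → ℂ) →ₗ[ℂ] (Prd p q → ℂ) where
  toFun := rotAct u v
  map_add' _ _ := rfl
  map_smul' _ _ := rfl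

theorem rotAct_mem_kFinitePar {ε : Fin 2} {f : Prd p q → ℂ} (hf : f ∈ kFinitePar p q ε)
    (u : Amb p ≃ₗᵢ[ℝ] Amb p) (v : Amb q ≃ₗᵢ[ℝ] Amb q) : rotAct u v f ∈ kFinitePar p q ε := by
  have h : kFinitePar p q ε ≤ (kFinitePar p q ε).comap (rotActL u v) :=
    iSup_le fun j => iSup_le fun k => iSup_le fun hjk => fun f hf =>
      Submodule.mem_iSup_of_mem j (Submodule.mem_iSup_of_mem k
        (Submodule.mem_iSup_of_mem hjk (rotAct_mem_kType hf u v)))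
  exact h hf

/-- A smooth function as an element of the type of smooth functions. -/
def SmoothFun.of {f : Prd p q → ℂ} (hf : Smooth f) : SmoothFun p q := ⟨f, hf⟩

/-! ### The operator `D` on the `K`-types -/

theorem opSqrt_apply {V : Type*} [AddCommGroup V] [Module ℂ V] (T : Module.End ℂ V) {s : ℝ}
    (hs : 0 ≤ s) {v : V} (hv : T v = ((s ^ 2 : ℝ) : ℂ) • v) : opSqrt T v = (s : ℂ) • v := by
  have h := (exists_sqrt T).choose_spec (s ^ 2) v (sq_nonneg s) hv
  rwa [Real.sqrt_sq hs] at h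

theorem shifted_nonneg (hp : 1 ≤ p) (j : ℕ) : 0 ≤ shifted p j := by
  have h1 : (1 : ℝ) ≤ p := by exact_mod_cast hp
  have h2 : (0 : ℝ) ≤ j := Nat.cast_nonneg j
  rw [shifted]; linarith

theorem eigLap_add_sq (n j : ℕ) :
    eigLap n j + (((n : ℂ) - 1) / 2) ^ 2 = ((shifted n j ^ 2 : ℝ) : ℂ) := by
  rw [eigLap, shifted]; push_cast; ring

theorem opB_apply (hp : 1 ≤ p) {j k : ℕ} {f : kFinite p q} (hf : f.1 ∈ kType p q j k) :
    opB p q f = (shifted p j : ℂ) • f := by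
  refine opSqrt_apply _ (shifted_nonneg hp j) ?_
  rw [← eigLap_add_sq, add_smul, LinearMap.add_apply, LinearMap.smul_apply, Module.End.one_apply]
  congr 1
  exact Subtype.ext (kType_spec hf).2.1

theorem opC_apply (hq : 1 ≤ q) {j k : ℕ} {f : kFinite p q} (hf : f.1 ∈ kType p q j k) :
    opC p q f = (shifted q k : ℂ) • f := by
  refine opSqrt_apply _ (shifted_nonneg hq k) ?_
  rw [← eigLap_add_sq, add_smul, LinearMap.add_apply, LinearMap.smul_apply, Module.End.one_apply]
  congr 1
  exact Subtype.ext (kType_spec hf).2.2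

theorem stepProd_apply {V : Type*} [AddCommGroup V] [Module ℂ V] (T : Module.End ℂ V) (r : ℕ)
    {t : ℂ} {v : V} (hv : T v = t • v) :
    stepProd T r v = (∏ i ∈ Finset.range r, (t + (2 * i + 1 - r))) • v := by
  have h : ∀ (c : ℕ → ℂ) (m : ℕ), ((List.range m).map fun i => T + c i • (1 : Module.End ℂ V)).prod v
      = (∏ i ∈ Finset.range m, (t + c i)) • v := fun c m => by
    induction m with
    | zero => simp
    | succ m ih =>
      rw [List.prod_range_succ, Finset.prod_range_succ, Module.End.mul_apply, LinearMap.add_apply,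
        LinearMap.smul_apply, Module.End.one_apply, hv, ← add_smul, map_smul, ih, smul_smul,
        mul_comm]
  -- the index of the factors is a complex number, so that the list `0, …, r - 1` is cast first
  simpa only [stepProd, bind_pure_comp, List.map_eq_map, List.map_map, Function.comp_def] using
    h (fun i => 2 * (i : ℂ) + 1 - r) r

theorem opD_apply (hp : 1 ≤ p) (hq : 1 ≤ q) (r : ℕ) {j k : ℕ} {f : kFinite p q}
    (hf : f.1 ∈ kType p q j k) : opD p q r f = ((eigD p q r j k : ℝ) : ℂ) • f := by
  have hB := opB_apply hp hf
  have hC := opC_apply hq hf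
  have h1 : (opC p q - opB p q) f = ((shifted q k : ℂ) - shifted p j) • f := by
    rw [LinearMap.sub_apply, hB, hC]
    exact (sub_smul _ _ f).symm
  have h2 : (opC p q + opB p q) f = ((shifted q k : ℂ) + shifted p j) • f := by
    rw [LinearMap.add_apply, hB, hC, add_smul]
  rw [opD, Module.End.mul_apply, stepProd_apply _ r h1, map_smul, stepProd_apply _ r h2, smul_smul,
    eigD, mul_comm]
  push_cast
  rfl

theorem evalComm_apply_eigen {V : Type*} [AddCommGroup V] [Module ℂ V] {a b : Module.End ℂ V}
    {α β : ℂ} {v : V} (ha : a v = α • v) (hb : b v = β • v) (P : MvPolynomial (Fin 2) ℝ) :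
    evalComm a b P v = MvPolynomial.eval₂ Complex.ofRealHom ![α, β] P • v := by
  have hpow : ∀ {c : Module.End ℂ V} {γ : ℂ}, c v = γ • v → ∀ n : ℕ, (c ^ n) v = γ ^ n • v :=
    fun {c γ} hc n => by
      induction n with
      | zero => simp
      | succ n ih => rw [pow_succ', Module.End.mul_apply, ih, map_smul, hc, smul_smul, pow_succ]
  simp only [evalComm, LinearMap.sum_apply, LinearMap.smul_apply, Module.End.mul_apply, hpow hb,
    map_smul, hpow ha, smul_smul, MvPolynomial.eval₂_eq', Finset.sum_smul, Fin.prod_univ_two,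
    Matrix.cons_val_zero, Matrix.cons_val_one, Complex.ofRealHom_eq_coe]
  refine Finset.sum_congr rfl fun m _ => ?_
  congr 1; ring

/-- The differential operator `D = P(Δ_{S^p}, Δ_{S^q})` on smooth functions. -/
def diffD (p q r : ℕ) : Module.End ℂ (SmoothFun p q) :=
  evalComm (lapPOp p q) (lapQOp p q) (covPoly p q r)

theorem diffD_apply (r : ℕ) {j k : ℕ} {u : SmoothFun p q} (hu : u ∈ kT p q j k) :
    diffD p q r u = ((eigD p q r j k : ℝ) : ℂ) • u := by
  rw [diffD, evalComm_apply_eigen (lapPOp_of_mem_kT hu) (lapQOp_of_mem_kT hu),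
    eval_covPoly Complex.ofRealHom p q (J := (shifted p j : ℂ)) (K := (shifted q k : ℂ)) ?_ ?_ r,
    eigD]
  · push_cast; rfl
  · have := eigLap_add_sq p j
    simpa using this
  · have := eigLap_add_sq q k
    simpa using this

theorem polyOp_add (P : MvPolynomial (Fin 2) ℝ) {f g : Prd p q → ℂ} (hf : Smooth f)
    (hg : Smooth g) : polyOp P (f + g) = polyOp P f + polyOp P g := by
  have h := congrArg (fun u : SmoothFun p q => u.1)
    (map_add (evalComm (lapPOp p q) (lapQOp p q) P) (SmoothFun.of hf) (SmoothFun.of hg))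
  rw [SmoothFun.add_val] at h
  exact (polyOp_eq_evalComm P (SmoothFun.of hf + SmoothFun.of hg)).trans (h.trans
    (congrArg₂ (· + ·) (polyOp_eq_evalComm P (SmoothFun.of hf)).symm
      (polyOp_eq_evalComm P (SmoothFun.of hg)).symm))

/-- On `K`-finite functions the operator `D`, defined through square roots, is the differential operator
`P(Δ_{S^p}, Δ_{S^q})`, since the two have the same eigenvalues
on the `V(j,k)`. -/
theorem opD_eq_polyOp (hp : 1 ≤ p) (hq : 1 ≤ q) (r : ℕ) (f : kFinite p q) :
    (opD p q r f).1 = polyOp (covPoly p q r) f.1 := by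
  have h := kFinite_induction (φ := fun f => ∃ hf : f ∈ kFinite p q,
    (opD p q r ⟨f, hf⟩).1 = polyOp (covPoly p q r) f) (fun j k u hu => ?_)
    (fun u v ⟨hu, hu'⟩ ⟨hv, hv'⟩ => ⟨Submodule.add_mem _ hu hv, ?_⟩) f.2
  · exact h.2
  · have hk : u ∈ kFinite p q := Submodule.mem_iSup_of_mem j (Submodule.mem_iSup_of_mem k hu)
    refine ⟨hk, ?_⟩
    rw [opD_apply hp hq r (f := ⟨u, hk⟩) hu]
    have h1 := polyOp_eq_evalComm (covPoly p q r) (SmoothFun.of (Smooth.of_mem_kType hu))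
    have h2 := diffD_apply r (u := SmoothFun.of (Smooth.of_mem_kType hu)) hu
    exact (h1.trans (congrArg Subtype.val h2)).symm
  · rw [polyOp_add _ (.of_mem_kFinite hu) (.of_mem_kFinite hv), ← hu', ← hv']
    exact congrArg Subtype.val (map_add (opD p q r) ⟨u, hu⟩ ⟨v, hv⟩)

theorem diffD_mem_kPar (r : ℕ) {n : ℕ} {u : SmoothFun p q} (hu : u ∈ kPar p q n) :
    diffD p q r u ∈ kPar p q n := by
  refine kPar_induction (φ := fun u => diffD p q r u ∈ kPar p q n) (fun j k hjk u hu => ?_) ?_ ?_ hu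
  · rw [diffD_apply r hu]; exact Submodule.smul_mem _ _ (kT_le_kPar hjk hu)
  · rw [map_zero]; exact Submodule.zero_mem _
  · intro u v hu hv; rw [map_add]; exact Submodule.add_mem _ hu hv

/-- An element of `𝓔^ε` as a smooth function. -/
def parIncl (p q : ℕ) (ε : Fin 2) : kFinitePar p q ε →ₗ[ℂ] SmoothFun p q where
  toFun f := SmoothFun.of (Smooth.of_mem_kFinite (kFinitePar_le p q ε f.2))
  map_add' _ _ := rfl
  map_smul' _ _ := rfl

/-- The restriction of `D` to `𝓔^ε`. -/
def parD (p q r : ℕ) (ε : Fin 2) : Module.End ℂ (kFinitePar p q ε) where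
  toFun f := ⟨(diffD p q r (parIncl p q ε f)).1, mem_kPar.mp (diffD_mem_kPar r (mem_kPar.mpr f.2))⟩
  map_add' f g := Subtype.ext (congrArg (fun u : SmoothFun p q => u.1)
    (map_add (diffD p q r ∘ₗ parIncl p q ε) f g))
  map_smul' c f := Subtype.ext (congrArg (fun u : SmoothFun p q => u.1)
    (map_smul (diffD p q r ∘ₗ parIncl p q ε) c f))

theorem parD_val (r : ℕ) {ε : Fin 2} (f : kFinitePar p q ε) :
    (parD p q r ε f).1 = polyOp (covPoly p q r) f.1 :=
  (polyOp_eq_evalComm (covPoly p q r) (parIncl p q ε f)).symm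

/-- The differential operator commutes with rotations, since these preserve the `V(j,k)`. -/
theorem polyOp_rotAct (hp : 1 ≤ p) (hq : 1 ≤ q) (r : ℕ) {f : Prd p q → ℂ} (hf : f ∈ kFinite p q)
    (u : Amb p ≃ₗᵢ[ℝ] Amb p) (v : Amb q ≃ₗᵢ[ℝ] Amb q) :
    polyOp (covPoly p q r) (rotAct u v f) = rotAct u v (polyOp (covPoly p q r) f) := by
  have h := kFinite_induction (φ := fun f => f ∈ kFinite p q ∧ rotAct u v f ∈ kFinite p q ∧
    polyOp (covPoly p q r) (rotAct u v f) = rotAct u v (polyOp (covPoly p q r) f))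
    (fun j k f hf => ?_) (fun f g ⟨hf, hf', hf''⟩ ⟨hg, hg', hg''⟩ =>
      ⟨Submodule.add_mem _ hf hg, Submodule.add_mem _ hf' hg', ?_⟩) hf
  · exact h.2.2
  · have hk : ∀ f ∈ kType p q j k, f ∈ kFinite p q := fun f hf =>
      Submodule.mem_iSup_of_mem j (Submodule.mem_iSup_of_mem k hf)
    have hP : ∀ f ∈ kType p q j k, polyOp (covPoly p q r) f = ((eigD p q r j k : ℝ) : ℂ) • f :=
      fun f hf => by
        rw [← opD_eq_polyOp hp hq r ⟨f, hk f hf⟩, opD_apply hp hq r (f := ⟨f, hk f hf⟩) hf]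
        rfl
    refine ⟨hk f hf, hk _ (rotAct_mem_kType hf u v), ?_⟩
    rw [hP _ (rotAct_mem_kType hf u v), hP f hf]
    rfl
  · have hadd := polyOp_add (covPoly p q r) (.of_mem_kFinite hf) (.of_mem_kFinite hg)
    have hadd' := polyOp_add (covPoly p q r) (.of_mem_kFinite hf') (.of_mem_kFinite hg')
    rw [hadd]
    refine hadd'.trans ?_
    rw [hf'', hg'']
    rfl

theorem isIntertwinor_parD (hp : 1 ≤ p) (hq : 1 ≤ q) (r : ℕ) (ε : Fin 2) :
    IsIntertwinor p q r ε (parD p q r ε) := by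
  refine ⟨fun u v _ _ f g hg => ?_, fun X f g hg => ?_⟩
  · rw [parD_val, parD_val, hg, polyOp_rotAct hp hq r (kFinitePar_le p q ε f.2)]
  · rw [parD_val, parD_val, hg]
    exact polyOp_covariant r (.of_mem_kFinite (kFinitePar_le p q ε f.2)) X

theorem isSpectralFunction_eigD (hp : 1 ≤ p) (hq : 1 ≤ q) (r : ℕ) (ε : Fin 2) :
    IsSpectralFunction p q r ε (fun j k => ((eigD p q r j k : ℝ) : ℂ)) :=
  ⟨parD p q r ε, isIntertwinor_parD hp hq r ε, fun _ _ _ f hf =>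
    Subtype.ext (congrArg (fun u : SmoothFun p q => u.1)
      (diffD_apply r (u := parIncl p q ε f) hf))⟩

/-! ### The Gamma function expression -/

theorem gamma_add_nat (r : ℕ) {z : ℝ} (hz : ∀ i : ℕ, z + i ≠ 0) :
    Real.Gamma (z + r) = (∏ i ∈ Finset.range r, (z + i)) * Real.Gamma z := by
  induction r with
  | zero => simp
  | succ r ih =>
    rw [Finset.prod_range_succ, Nat.cast_succ, ← add_assoc, Real.Gamma_add_one (hz r), ih]
    ring

/-- Near any real number `c`, apart from `c` itself, there are no poles of the Gamma function, and
there `Γ(z + r) / Γ(z)` is a polynomial. -/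
theorem eventually_gamma_div (c : ℝ) (r : ℕ) : ∀ᶠ t in 𝓝[≠] (0 : ℝ),
    Real.Gamma (c + r + t) / Real.Gamma (c + t) = ∏ i ∈ Finset.range r, (c + i + t) := by
  have h : ∀ᶠ t in 𝓝[≠] (0 : ℝ), ∀ i : ℕ, c + t + i ≠ 0 := by
    have hball : ∀ᶠ t in 𝓝[≠] (0 : ℝ), |t| < 1 / 2 :=
      nhdsWithin_le_nhds ((continuous_abs.tendsto' (0 : ℝ) 0 abs_zero).eventually_lt_const
        (by norm_num))
    by_cases hc : ∃ m : ℤ, c = m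
    · obtain ⟨m, rfl⟩ := hc
      filter_upwards [hball, self_mem_nhdsWithin] with t ht ht0 i hi
      have e : t = ((-(m + i) : ℤ) : ℝ) := by push_cast; linarith
      rw [e] at ht ht0
      have h1 : |(-(m + i) : ℤ)| < 1 := by
        have : ((|(-(m + i) : ℤ)| : ℤ) : ℝ) < 1 := by rw [Int.cast_abs]; linarith
        exact_mod_cast this
      exact ht0 (by rw [Int.abs_lt_one_iff.mp h1]; simp)
    · have hcl : IsClosed (Set.range ((↑) : ℤ → ℝ)) := Int.isClosedEmbedding_coe_real.isClosed_range
      have h1 : ∀ᶠ x in 𝓝 c, x ∉ Set.range ((↑) : ℤ → ℝ) :=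
        hcl.isOpen_compl.mem_nhds fun ⟨m, hm⟩ => hc ⟨m, hm.symm⟩
      have h2 : Tendsto (fun t : ℝ => c + t) (𝓝 0) (𝓝 c) :=
        (continuous_const.add continuous_id).tendsto' _ _ (add_zero c)
      filter_upwards [nhdsWithin_le_nhds (h2.eventually h1)] with t ht i hi
      exact ht ⟨-i, by push_cast; linarith⟩
  filter_upwards [h] with t ht
  have hΓ : Real.Gamma (c + t) ≠ 0 := Real.Gamma_ne_zero fun m hm => ht m (by rw [hm]; ring)
  rw [show c + r + t = c + t + r by ring, gamma_add_nat r ht, mul_div_cancel_right₀ _ hΓ]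
  exact Finset.prod_congr rfl fun i _ => by ring

theorem tendsto_gammaQuot (p q r j k : ℕ) :
    Tendsto (gammaQuot p q r j k) (𝓝[≠] 0) (𝓝 (eigD p q r j k / 4 ^ r)) := by
  set c₁ := (shifted q k + shifted p j + 1 - r) / 2 with h₁
  set c₂ := (shifted q k - shifted p j + 1 - r) / 2 with h₂
  have hlim : Tendsto (fun t : ℝ => (∏ i ∈ Finset.range r, (c₁ + i + t)) *
      ∏ i ∈ Finset.range r, (c₂ + i + t)) (𝓝[≠] 0) (𝓝 (eigD p q r j k / 4 ^ r)) := by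
    have hcont : Continuous fun t : ℝ => (∏ i ∈ Finset.range r, (c₁ + i + t)) *
      ∏ i ∈ Finset.range r, (c₂ + i + t) := by fun_prop
    refine (hcont.tendsto' 0 _ ?_).mono_left nhdsWithin_le_nhds
    have e : ∀ s : ℝ, ∏ i ∈ Finset.range r, ((s + 1 - r) / 2 + i + 0) =
        (∏ i ∈ Finset.range r, (s + (2 * i + 1 - r))) / 2 ^ r := fun s => by
      have h2 : (2 : ℝ) ^ r = ∏ i ∈ Finset.range r, (2 : ℝ) := by simp
      rw [eq_div_iff (by positivity), h2, ← Finset.prod_mul_distrib]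
      exact Finset.prod_congr rfl fun i _ => by ring
    rw [h₁, h₂, e, e, eigD, div_mul_div_comm, ← mul_pow]
    norm_num
  refine hlim.congr' ?_
  filter_upwards [eventually_gamma_div c₁ r, eventually_gamma_div c₂ r] with t ht₁ ht₂
  rw [gammaQuot, ← ht₁, ← ht₂, div_mul_div_comm, h₁, h₂]
  congr 3 <;> ring_nf

/-! ### Multiplication by a coordinate is injective on each component -/

/-- `j` and `j'` differ by one. -/
def Nbr (j j' : ℕ) : Prop := j' = j + 1 ∨ j = j' + 1

/-- If one of the two components of all `x_i u` vanishes, then `[Δ, x_i] u` is a fixed multiple of `x_i u`;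
multiplying by `x_i` and summing gives `(λ'' - λ) u = p u`, where `λ` and `λ''` are the eigenvalues
of `Δ_{S^p}` on `u` and on the remaining component, and `λ'' - λ ≠ p`. -/
theorem mulX_inl_of_pr_eq_zero (hp : 1 ≤ p) (hq : 1 ≤ q) {j j' k : ℕ} (hj : Nbr j j')
    {u : SmoothFun p q} (hu : u ∈ kT p q j k)
    (h : ∀ i, pr p q j' k (mulX (.inl i) u) = 0) : u = 0 := by
  have hsq : ∑ i, mulX (.inl i) (mulX (.inl i) u) = u := by
    have := LinearMap.congr_fun (sphereRel_inl (p := p) (q := q)).sum_xx u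
    simpa only [LinearMap.sum_apply, Module.End.mul_apply, Module.End.one_apply] using this
  have hcomm : ∑ i, mulX (.inl i) (lapPOp p q (mulX (.inl i) u) - mulX (.inl i) (lapPOp p q u)) =
      (p : ℂ) • u := by
    have := LinearMap.congr_fun ((sphereRel_inl (p := p) (q := q)).sum_x_comm rfl) u
    change (∑ i, mulX (.inl i) * (lapPOp p q * mulX (.inl i) - mulX (.inl i) * lapPOp p q) :
      Module.End ℂ (SmoothFun p q)) u = _ at this
    have e := natCast_mul_end_apply p (1 : Module.End ℂ (SmoothFun p q)) u
    rw [mul_one, Module.End.one_apply] at e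
    rw [e] at this
    simpa only [LinearMap.sum_apply, Module.End.mul_apply, LinearMap.sub_apply] using this
  -- the component `j''` in which `x_i u` lies; for `j = 0` there is none
  obtain ⟨j'', hx, hne⟩ : ∃ j'', (∀ i, mulX (.inl i) u ∈ kT p q j'' k) ∧
      (eigLap p j'' - eigLap p j ≠ p ∨ u = 0) := by
    rcases hj with rfl | rfl
    · refine ⟨j - 1, fun i => ?_, ?_⟩
      · obtain ⟨u₁, h₁, u₂, h₂, he, h0⟩ := mulX_inl_mem hp i hu
        have h3 := h i
        rw [he, map_add, pr_self h₁, pr_of_ne hp hq (by simp) h₂, add_zero] at h3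
        rw [he, h3, zero_add]; exact h₂
      · rcases Nat.eq_zero_or_pos j with rfl | hj
        · right
          rw [← hsq]
          refine Finset.sum_eq_zero fun i _ => ?_
          obtain ⟨u₁, h₁, u₂, h₂, he, h0⟩ := mulX_inl_mem hp i hu
          have h3 := h i
          rw [he, h0 rfl, add_zero, pr_self h₁] at h3
          rw [he, h0 rfl, h3, add_zero, map_zero]
        · left
          intro he
          have := congrArg Complex.re he
          rw [Complex.sub_re, eigLap_re, eigLap_re, Complex.natCast_re] at this
          push_cast [show 1 ≤ j from hj] at this
          have h1 : (1 : ℝ) ≤ j := by exact_mod_cast hj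
          have h2 : (1 : ℝ) ≤ p := by exact_mod_cast hp
          nlinarith
    · refine ⟨j' + 2, fun i => ?_, ?_⟩
      · obtain ⟨u₁, h₁, u₂, h₂, he, h0⟩ := mulX_inl_mem hp i hu
        rw [Nat.add_sub_cancel] at h₂
        have h3 := h i
        rw [he, map_add, pr_of_ne hp hq (by simp; omega) h₁, pr_self h₂, zero_add] at h3
        rw [he, h3, add_zero]; exact h₁
      · left
        intro he
        have := congrArg Complex.re he
        rw [Complex.sub_re, eigLap_re, eigLap_re, Complex.natCast_re] at this
        push_cast at this
        have h1 : (0 : ℝ) ≤ j' := Nat.cast_nonneg j'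
        nlinarith
  rcases hne with hne | h0
  · have h1 : (eigLap p j'' - eigLap p j) • u = (p : ℂ) • u := by
      rw [← hcomm]
      conv_lhs => rw [← hsq, Finset.smul_sum]
      refine Finset.sum_congr rfl fun i _ => ?_
      rw [lapPOp_of_mem_kT (hx i), lapPOp_of_mem_kT hu, map_smul, ← sub_smul, map_smul]
    have h2 : (eigLap p j'' - eigLap p j - p) • u = 0 := by rw [sub_smul, h1, sub_self]
    exact (smul_eq_zero.mp h2).resolve_left (sub_ne_zero.mpr hne)
  · exact h0

/-- The statement for the second factor. -/
theorem mulX_inr_of_pr_eq_zero (hp : 1 ≤ p) (hq : 1 ≤ q) {j k k' : ℕ} (hk : Nbr k k')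
    {u : SmoothFun p q} (hu : u ∈ kT p q j k)
    (h : ∀ l, pr p q j k' (mulX (.inr l) u) = 0) : u = 0 := by
  have hsq : ∑ i, mulX (.inr i) (mulX (.inr i) u) = u := by
    have := LinearMap.congr_fun (sphereRel_inr (p := p) (q := q)).sum_xx u
    simpa only [LinearMap.sum_apply, Module.End.mul_apply, Module.End.one_apply] using this
  have hcomm : ∑ i, mulX (.inr i) (lapQOp p q (mulX (.inr i) u) - mulX (.inr i) (lapQOp p q u)) =
      (q : ℂ) • u := by
    have := LinearMap.congr_fun ((sphereRel_inr (p := p) (q := q)).sum_x_comm rfl) u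
    change (∑ i, mulX (.inr i) * (lapQOp p q * mulX (.inr i) - mulX (.inr i) * lapQOp p q) :
      Module.End ℂ (SmoothFun p q)) u = _ at this
    have e := natCast_mul_end_apply q (1 : Module.End ℂ (SmoothFun p q)) u
    rw [mul_one, Module.End.one_apply] at e
    rw [e] at this
    simpa only [LinearMap.sum_apply, Module.End.mul_apply, LinearMap.sub_apply] using this
  -- the other component `k''`
  obtain ⟨k'', hx, hne⟩ : ∃ k'', (∀ i, mulX (.inr i) u ∈ kT p q j k'') ∧
      (eigLap q k'' - eigLap q k ≠ q ∨ u = 0) := by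
    rcases hk with rfl | rfl
    · refine ⟨k - 1, fun i => ?_, ?_⟩
      · obtain ⟨u₁, h₁, u₂, h₂, he, h0⟩ := mulX_inr_mem hq i hu
        have h3 := h i
        rw [he, map_add, pr_self h₁, pr_of_ne hp hq (by simp) h₂, add_zero] at h3
        rw [he, h3, zero_add]; exact h₂
      · rcases Nat.eq_zero_or_pos k with rfl | hk
        · right
          rw [← hsq]
          refine Finset.sum_eq_zero fun i _ => ?_
          obtain ⟨u₁, h₁, u₂, h₂, he, h0⟩ := mulX_inr_mem hq i hu
          have h3 := h i
          rw [he, h0 rfl, add_zero, pr_self h₁] at h3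
          rw [he, h0 rfl, h3, add_zero, map_zero]
        · left
          intro he
          have := congrArg Complex.re he
          rw [Complex.sub_re, eigLap_re, eigLap_re, Complex.natCast_re] at this
          push_cast [show 1 ≤ k from hk] at this
          have h1 : (1 : ℝ) ≤ k := by exact_mod_cast hk
          have h2 : (1 : ℝ) ≤ q := by exact_mod_cast hq
          nlinarith
    · refine ⟨k' + 2, fun i => ?_, ?_⟩
      · obtain ⟨u₁, h₁, u₂, h₂, he, h0⟩ := mulX_inr_mem hq i hu
        rw [Nat.add_sub_cancel] at h₂
        have h3 := h i
        rw [he, map_add, pr_of_ne hp hq (by simp; omega) h₁, pr_self h₂, zero_add] at h3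
        rw [he, h3, add_zero]; exact h₁
      · left
        intro he
        have := congrArg Complex.re he
        rw [Complex.sub_re, eigLap_re, eigLap_re, Complex.natCast_re] at this
        push_cast at this
        have h1 : (0 : ℝ) ≤ k' := Nat.cast_nonneg k'
        nlinarith
  rcases hne with hne | h0
  · have h1 : (eigLap q k'' - eigLap q k) • u = (q : ℂ) • u := by
      rw [← hcomm]
      conv_lhs => rw [← hsq, Finset.smul_sum]
      refine Finset.sum_congr rfl fun i _ => ?_
      rw [lapQOp_of_mem_kT (hx i), lapQOp_of_mem_kT hu, map_smul, ← sub_smul, map_smul]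
    have h2 : (eigLap q k'' - eigLap q k - q) • u = 0 := by rw [sub_smul, h1, sub_self]
    exact (smul_eq_zero.mp h2).resolve_left (sub_ne_zero.mpr hne)
  · exact h0

theorem pr_mulX_inr_mulX_inl (hp : 1 ≤ p) (hq : 1 ≤ q) {j j' k k' : ℕ}
    (i : Fin (p + 1)) (l : Fin (q + 1)) {u : SmoothFun p q} (hu : u ∈ kT p q j k) :
    pr p q j' k' (mulX (.inr l) (mulX (.inl i) u)) =
      pr p q j' k' (mulX (.inr l) (pr p q j' k (mulX (.inl i) u))) := by
  -- components of `x_i u` outside `V(j',k)` do not contribute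
  have key : ∀ {m : ℕ} {v : SmoothFun p q}, v ∈ kT p q m k →
      pr p q j' k' (mulX (.inr l) v) = pr p q j' k' (mulX (.inr l) (pr p q j' k v)) := by
    intro m v hv
    by_cases hm : m = j'
    · subst hm; rw [pr_self hv]
    · rw [pr_of_ne hp hq (by simp [hm]) hv, map_zero, map_zero]
      obtain ⟨v₁, h₁, v₂, h₂, he, -⟩ := mulX_inr_mem hq l hv
      rw [he, map_add, pr_of_ne hp hq (by simp [hm]) h₁, pr_of_ne hp hq (by simp [hm]) h₂, add_zero]
  obtain ⟨u₁, h₁, u₂, h₂, he, -⟩ := mulX_inl_mem hp i hu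
  rw [he]
  simp only [map_add, key h₁, key h₂]

/-- For each component, the multiplications by the conformal factors `x_i y_l` followed by the projection
to it are jointly injective on `V(j,k)`. -/
theorem eq_zero_of_pr_mulX (hp : 1 ≤ p) (hq : 1 ≤ q) {j j' k k' : ℕ} (hj : Nbr j j')
    (hk : Nbr k k') {u : SmoothFun p q} (hu : u ∈ kT p q j k)
    (h : ∀ i l, pr p q j' k' (mulX (.inr l) (mulX (.inl i) u)) = 0) : u = 0 := by
  refine mulX_inl_of_pr_eq_zero hp hq hj hu fun i => ?_
  refine mulX_inr_of_pr_eq_zero hp hq hk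
    (pr_mem hp hq j' k (mulX_mem_kPar hp hq _ (kT_le_kPar rfl hu))) fun l => ?_
  rw [← pr_mulX_inr_mulX_inl hp hq i l hu]
  exact h i l

/-! ### Consequences of the intertwining relation -/

/-- `A` restricts to an intertwinor of order `2 r` on the sum of the `V(j,k)` with `j + k ≡ n` modulo
`2`. The values of `A` on other functions are arbitrary, and only the relation with the Lie algebra
is recorded: it implies all that is needed about `K`. -/
structure Intertwines (p q r n : ℕ) (A : Module.End ℂ (SmoothFun p q)) : Prop where
  mem : ∀ u ∈ kPar p q n, A u ∈ kPar p q n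
  conf : ∀ X : lieG p q, ∀ u ∈ kPar p q n,
    A (confOp (((p : ℂ) + q) / 2 - r) X u) = confOp (((p : ℂ) + q) / 2 + r) X (A u)

theorem Intertwines.sub {r n : ℕ} {A B : Module.End ℂ (SmoothFun p q)}
    (hA : Intertwines p q r n A) (hB : Intertwines p q r n B) (c : ℂ) :
    Intertwines p q r n (A - c • B) where
  mem u hu := Submodule.sub_mem _ (hA.mem u hu) (Submodule.smul_mem _ c (hB.mem u hu))
  conf X u hu := by
    simp only [LinearMap.sub_apply, LinearMap.smul_apply, hA.conf X u hu, hB.conf X u hu, map_sub,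
      map_smul]

theorem intertwines_diffD (r n : ℕ) : Intertwines p q r n (diffD p q r) where
  mem _ hu := diffD_mem_kPar r hu
  conf X u _ := LinearMap.congr_fun (confOp_intertwine r X) u

theorem mem_lieG {M : Matrix (Fin (p + 1) ⊕ Fin (q + 1)) (Fin (p + 1) ⊕ Fin (q + 1)) ℝ}
    (h : ∀ a b, M b a * Sum.elim (fun _ => (1 : ℝ)) (fun _ => -1) b =
      -(Sum.elim (fun _ => (1 : ℝ)) (fun _ => -1) a * M a b)) : M ∈ lieG p q := by
  refine (mem_skewAdjointMatricesSubmodule _ _).mpr ?_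
  refine Matrix.ext fun a b => ?_
  simpa [LieAlgebra.Orthogonal.indefiniteDiagonal, Matrix.mul_diagonal,
    Matrix.diagonal_mul] using h a b

/-- The infinitesimal rotation of the first sphere in the plane of `x_i` and `x_k`. -/
def rotInl (i k : Fin (p + 1)) : lieG p q :=
  ⟨Matrix.single (.inl i) (.inl k) 1 - Matrix.single (.inl k) (.inl i) 1, mem_lieG fun a b => by
    rcases a with a | a <;> rcases b with b | b <;>
      simp [Matrix.single_apply, and_comm]⟩

/-- The infinitesimal rotation of the second sphere in the plane of `y_i` and `y_k`. -/
def rotInr (i k : Fin (q + 1)) : lieG p q :=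
  ⟨Matrix.single (.inr i) (.inr k) 1 - Matrix.single (.inr k) (.inr i) 1, mem_lieG fun a b => by
    rcases a with a | a <;> rcases b with b | b <;>
      simp [Matrix.single_apply, and_comm]⟩

/-- The infinitesimal boost in the plane of `x_i` and `y_l`. -/
def boostElt (i : Fin (p + 1)) (l : Fin (q + 1)) : lieG p q :=
  ⟨Matrix.single (.inl i) (.inr l) 1 + Matrix.single (.inr l) (.inl i) 1, mem_lieG fun a b => by
    rcases a with a | a <;> rcases b with b | b <;>
      simp [Matrix.single_apply, and_comm]
    split_ifs <;> simp⟩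

theorem sum_sum_single_smul {ι M : Type*} [Fintype ι] [DecidableEq ι] [AddCommGroup M] [Module ℂ M]
    (s t : ι) (F : ι → ι → M) :
    ∑ b, ∑ c, ((Matrix.single s t (1 : ℝ) b c : ℝ) : ℂ) • F b c = F s t := by
  rw [Finset.sum_eq_single s, Finset.sum_eq_single t]
  · simp
  · intro c _ hc
    simp [hc.symm]
  · simp
  · intro b _ hb
    refine Finset.sum_eq_zero fun c _ => ?_
    simp [hb.symm]
  · simp

theorem sum_inl_eq (M : Fin (p + 1) ⊕ Fin (q + 1) → Fin (p + 1) ⊕ Fin (q + 1) → ℂ) :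
    ∑ i, ∑ b, M (.inl i) b • (mulX (p := p) (q := q) (.inl i) * mulX b) =
      ∑ a, ∑ b, M a b • (if a.isLeft then mulX a * mulX b else 0) := by
  rw [Fintype.sum_sum_type]
  simp

theorem confOp_rotInl (a : ℂ) (i k : Fin (p + 1)) :
    confOp a (rotInl (q := q) i k) = rotOp (.inl k) (.inl i) := by
  rw [confOp, sum_inl_eq fun a b => ((rotInl (q := q) i k).1 a b : ℂ)]
  simp only [rotInl, Matrix.sub_apply, Complex.ofReal_sub, sub_smul, Finset.sum_sub_distrib,
    sum_sum_single_smul]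
  simp [rotOp, mulX_comm (Sum.inl i) (Sum.inl k)]

theorem confOp_rotInr (a : ℂ) (i k : Fin (q + 1)) :
    confOp a (rotInr (p := p) i k) = rotOp (.inr k) (.inr i) := by
  rw [confOp, sum_inl_eq fun a b => ((rotInr (p := p) i k).1 a b : ℂ)]
  simp only [rotInr, Matrix.sub_apply, Complex.ofReal_sub, sub_smul, Finset.sum_sub_distrib,
    sum_sum_single_smul]
  simp [rotOp]

theorem confOp_boostElt (a : ℂ) (i : Fin (p + 1)) (l : Fin (q + 1)) :
    confOp a (boostElt i l) = boostOp a i l := by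
  rw [confOp, sum_inl_eq fun a b => ((boostElt i l).1 a b : ℂ)]
  simp only [boostElt, Matrix.add_apply, Complex.ofReal_add, add_smul, Finset.sum_add_distrib,
    sum_sum_single_smul]
  simp [boostOp]

section

variable {r n : ℕ} {A : Module.End ℂ (SmoothFun p q)}

/-- The Laplacian of the first factor is the Casimir operator of its rotations, with which intertwinors
commute since rotations have conformal factor zero. -/
theorem Intertwines.lapPOp (hp : 1 ≤ p) (hq : 1 ≤ q) (hA : Intertwines p q r n A)
    {u : SmoothFun p q} (hu : u ∈ kPar p q n) : A (lapPOp p q u) = lapPOp p q (A u) := by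
  have hrot : ∀ i k, ∀ u ∈ kPar p q n, rotOp (.inl i) (.inl k) u ∈ kPar p q n ∧
      A (rotOp (.inl i) (.inl k) u) = rotOp (.inl i) (.inl k) (A u) := fun i k u hu => by
    have h := hA.conf (rotInl k i) u hu
    have h' := confOp_mem_kPar hp hq 0 (rotInl k i) hu
    rw [confOp_rotInl] at h'
    rw [confOp_rotInl, confOp_rotInl] at h
    exact ⟨h', h⟩
  have hc : ∀ v : SmoothFun p q, (2 : ℂ) • SphereProduct.lapPOp p q v =
      -∑ i, ∑ j, rotOp (.inl i) (.inl j) (rotOp (.inl i) (.inl j) v) := fun v => by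
    have h := LinearMap.congr_fun ((sphereRel_inl (p := p) (q := q)).casimir
      (A := SphereProduct.lapPOp p q) rfl) v
    have e := natCast_mul_end_apply 2 (SphereProduct.lapPOp p q) v
    rw [Nat.cast_ofNat, Nat.cast_ofNat] at e
    rw [LinearMap.neg_apply, e] at h
    rw [← neg_eq_iff_eq_neg.mpr h]
    simp only [LinearMap.sum_apply, Module.End.mul_apply]
    rfl
  refine smul_right_injective _ (two_ne_zero (α := ℂ)) ?_
  change (2 : ℂ) • _ = (2 : ℂ) • _
  rw [← map_smul, hc, hc, map_neg, map_sum]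
  congr 1
  refine Finset.sum_congr rfl fun i _ => ?_
  rw [map_sum]
  refine Finset.sum_congr rfl fun j _ => ?_
  rw [(hrot i j _ (hrot i j u hu).1).2, (hrot i j u hu).2]

theorem Intertwines.lapQOp (hp : 1 ≤ p) (hq : 1 ≤ q) (hA : Intertwines p q r n A)
    {u : SmoothFun p q} (hu : u ∈ kPar p q n) : A (lapQOp p q u) = lapQOp p q (A u) := by
  have hrot : ∀ i k, ∀ u ∈ kPar p q n, rotOp (.inr i) (.inr k) u ∈ kPar p q n ∧
      A (rotOp (.inr i) (.inr k) u) = rotOp (.inr i) (.inr k) (A u) := fun i k u hu => by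
    have h := hA.conf (rotInr k i) u hu
    have h' := confOp_mem_kPar hp hq 0 (rotInr k i) hu
    rw [confOp_rotInr] at h'
    rw [confOp_rotInr, confOp_rotInr] at h
    exact ⟨h', h⟩
  have hc : ∀ v : SmoothFun p q, (2 : ℂ) • SphereProduct.lapQOp p q v =
      -∑ i, ∑ j, rotOp (.inr i) (.inr j) (rotOp (.inr i) (.inr j) v) := fun v => by
    have h := LinearMap.congr_fun ((sphereRel_inr (p := p) (q := q)).casimir
      (A := SphereProduct.lapQOp p q) rfl) v
    have e := natCast_mul_end_apply 2 (SphereProduct.lapQOp p q) v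
    rw [Nat.cast_ofNat, Nat.cast_ofNat] at e
    rw [LinearMap.neg_apply, e] at h
    rw [← neg_eq_iff_eq_neg.mpr h]
    simp only [LinearMap.sum_apply, Module.End.mul_apply]
    rfl
  refine smul_right_injective _ (two_ne_zero (α := ℂ)) ?_
  change (2 : ℂ) • _ = (2 : ℂ) • _
  rw [← map_smul, hc, hc, map_neg, map_sum]
  congr 1
  refine Finset.sum_congr rfl fun i _ => ?_
  rw [map_sum]
  refine Finset.sum_congr rfl fun j _ => ?_
  rw [(hrot i j _ (hrot i j u hu).1).2, (hrot i j u hu).2]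

/-- Intertwinors preserve the `K`-types: they commute with rotations, hence with the Casimir
operators of the two factors. -/
theorem Intertwines.mem_kT (hp : 1 ≤ p) (hq : 1 ≤ q) (hA : Intertwines p q r n A) {j k : ℕ}
    (hjk : (j + k) % 2 = n % 2) {u : SmoothFun p q} (hu : u ∈ kT p q j k) : A u ∈ kT p q j k := by
  have hu' := kT_le_kPar hjk hu
  refine mem_kT_of_eigen hp hq (hA.mem u hu') ?_ ?_
  · rw [← hA.lapPOp hp hq hu', lapPOp_of_mem_kT hu, map_smul]
  · rw [← hA.lapQOp hp hq hu', lapQOp_of_mem_kT hu, map_smul]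

theorem Intertwines.pr (hp : 1 ≤ p) (hq : 1 ≤ q) (hA : Intertwines p q r n A) {j k : ℕ}
    {u : SmoothFun p q} (hu : u ∈ kPar p q n) : A (pr p q j k u) = pr p q j k (A u) := by
  refine kPar_induction (φ := fun u => A (SphereProduct.pr p q j k u) =
    SphereProduct.pr p q j k (A u)) (fun j' k' hjk u hu => ?_) ?_ ?_ hu
  · by_cases h : (j', k') = (j, k)
    · obtain ⟨rfl, rfl⟩ := Prod.mk.inj h
      rw [pr_self hu, pr_self (hA.mem_kT hp hq hjk hu)]
    · rw [pr_of_ne hp hq h hu, pr_of_ne hp hq h (hA.mem_kT hp hq hjk hu), map_zero]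
  · simp only [map_zero]
  · intro u v hu hv; simp only [map_add, hu, hv]

/-- The relation between the values of an intertwinor on two components that are linked by the
conformal factor `x_i y_l`. With `c = (N' - N) / 2`, where `N` is the eigenvalue of
`Δ_{S^p} + Δ_{S^q}`, the commutator of that operator with `x_i y_l` acts between the two components
as `2 c x_i y_l`. -/
theorem Intertwines.link (hp : 1 ≤ p) (hq : 1 ≤ q) (hA : Intertwines p q r n A) {j k j' k' : ℕ}
    (hjk : (j + k) % 2 = n % 2) {c : ℂ}
    (hc : eigLap p j' + eigLap q k' - (eigLap p j + eigLap q k) = 2 * c)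
    (i : Fin (p + 1)) (l : Fin (q + 1)) {u : SmoothFun p q} (hu : u ∈ kT p q j k) :
    (c - r) • A (SphereProduct.pr p q j' k' (mulX (.inr l) (mulX (.inl i) u))) =
      (c + r) • SphereProduct.pr p q j' k' (mulX (.inr l) (mulX (.inl i) (A u))) := by
  have hpar : ∀ {v : SmoothFun p q}, v ∈ kT p q j k → mulX (.inr l) (mulX (.inl i) v) ∈ kPar p q n :=
    fun hv => by
      rw [← kPar_congr (show (n + 1 + 1) % 2 = n % 2 by omega)]
      exact mulX_mem_kPar hp hq _ (mulX_mem_kPar hp hq _ (kT_le_kPar hjk hv))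
  have hboost : ∀ (a : ℂ) {v : SmoothFun p q}, v ∈ kT p q j k →
      (2 : ℂ) • SphereProduct.pr p q j' k' (boostOp a i l v) = ((p : ℂ) + q - 2 * a - 2 * c) •
        SphereProduct.pr p q j' k' (mulX (.inr l) (mulX (.inl i) v)) := fun a {v} hv => by
    have h := LinearMap.congr_fun (boostOp_eq a i l) v
    rw [mulX_comm] at h
    simp only [LinearMap.smul_apply, LinearMap.add_apply, LinearMap.neg_apply, LinearMap.sub_apply,
      Module.End.mul_apply, lapPOp_of_mem_kT hv, lapQOp_of_mem_kT hv, map_smul, map_add] at h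
    rw [← map_smul, h, map_add, map_neg, map_sub, map_add, map_add, pr_lapPOp hp hq _ _ (hpar hv),
      pr_lapQOp hp hq _ _ (hpar hv), map_smul, map_smul, map_smul, ← add_smul, ← add_smul,
      ← sub_smul, hc, ← neg_smul, ← add_smul]
    congr 1; ring
  have hu' := kT_le_kPar hjk hu
  have h1 := hA.conf (boostElt i l) u hu'
  rw [confOp_boostElt, confOp_boostElt] at h1
  have hb : boostOp (((p : ℂ) + q) / 2 - r) i l u ∈ kPar p q n := by
    rw [← confOp_boostElt]; exact confOp_mem_kPar hp hq _ _ hu'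
  have h2 := congrArg (fun v => (2 : ℂ) • SphereProduct.pr p q j' k' v) h1
  beta_reduce at h2
  rw [hboost _ (hA.mem_kT hp hq hjk hu), ← hA.pr hp hq hb, ← map_smul A, hboost _ hu, map_smul] at h2
  refine smul_right_injective _ (neg_ne_zero.mpr (two_ne_zero (α := ℂ))) ?_
  change (-2 : ℂ) • _ = (-2 : ℂ) • _
  rw [smul_smul, smul_smul]
  convert h2 using 2 <;> ring

/-- If an intertwinor vanishes on one component, then also on a linked one. -/
theorem Intertwines.step (hp : 1 ≤ p) (hq : 1 ≤ q) (hA : Intertwines p q r n A) {j k j' k' : ℕ}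
    (hjk : (j + k) % 2 = n % 2) (hj : Nbr j j') (hk : Nbr k k') {c : ℂ}
    (hc : eigLap p j' + eigLap q k' - (eigLap p j + eigLap q k) = 2 * c) (hcr : c + r ≠ 0)
    (h0 : ∀ u ∈ kT p q j' k', A u = 0) : ∀ u ∈ kT p q j k, A u = 0 := by
  intro u hu
  refine eq_zero_of_pr_mulX hp hq hj hk (hA.mem_kT hp hq hjk hu) fun i l => ?_
  have h := hA.link hp hq hjk hc i l hu
  rw [h0 _ (pr_mem hp hq j' k' (mulX_mem_kPar hp hq _ (mulX_mem_kPar hp hq _ (kT_le_kPar hjk hu)))),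
    smul_zero] at h
  exact (smul_eq_zero.mp h.symm).resolve_left hcr

end

/-! ### Intertwinors are determined by one component -/

theorem eigLap_succ_sub (n j : ℕ) : eigLap n (j + 1) - eigLap n j = 2 * j + n := by
  simp only [eigLap]; push_cast; ring

/-- The genericity hypothesis: `(K - J + 1 - r) / 2` is not an integer on the components of
parity `n`. -/
def Generic (p q r n : ℕ) : Prop :=
  ∀ j k, (j + k) % 2 = n % 2 → ∀ m : ℤ, shifted q k - shifted p j + 1 - r ≠ 2 * m

theorem generic_of_ne {r : ℕ} {ε : Fin 2}
    (h : ∀ m : ℤ, ((q : ℝ) - p) / 2 + (ε : ℕ) + 1 - r ≠ 2 * m) : Generic p q r ε := by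
  intro j k hjk m hm
  have hε : (ε : ℕ) < 2 := ε.2
  obtain ⟨t, ht⟩ : ∃ t : ℤ, (k : ℤ) - j = (ε : ℕ) + 2 * t := ⟨((k : ℤ) - j - (ε : ℕ)) / 2, by omega⟩
  have ht' : (k : ℝ) - j = (ε : ℕ) + 2 * t := by exact_mod_cast ht
  refine h (m - t) ?_
  rw [shifted, shifted] at hm
  push_cast
  linarith

section

variable {r n : ℕ} {A : Module.End ℂ (SmoothFun p q)}

/-- Here `c + r = K + J + 1 + r > 0` for the `J`, `K` of `V(j,k)`. -/
theorem Intertwines.step_down (hp : 1 ≤ p) (hq : 1 ≤ q) (hA : Intertwines p q r n A) {j k : ℕ}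
    (hjk : (j + k) % 2 = n % 2) (h0 : ∀ u ∈ kT p q (j + 1) (k + 1), A u = 0) :
    ∀ u ∈ kT p q j k, A u = 0 := by
  refine hA.step hp hq hjk (.inl rfl) (.inl rfl) (c := ((j + k + ((p : ℝ) + q) / 2 : ℝ) : ℂ)) ?_ ?_ h0
  · have h1 := eigLap_succ_sub p j
    have h2 := eigLap_succ_sub q k
    push_cast
    linear_combination h1 + h2
  · have h1 : (1 : ℝ) ≤ p := by exact_mod_cast hp
    have h : (0 : ℝ) < j + k + ((p : ℝ) + q) / 2 + r := by positivity
    exact_mod_cast h.ne'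

/-- Here `-(c + r) = K + J + 1 - r` for the `J`, `K` of `V(j,k)`, which is positive as `j + k ≥ r`. -/
theorem Intertwines.step_up (hp : 1 ≤ p) (hq : 1 ≤ q) (hA : Intertwines p q r n A) {j k : ℕ}
    (hjk : (j + k) % 2 = n % 2) (hr : r ≤ j + k) (h0 : ∀ u ∈ kT p q j k, A u = 0) :
    ∀ u ∈ kT p q (j + 1) (k + 1), A u = 0 := by
  refine hA.step hp hq (by omega) (.inr rfl) (.inr rfl)
    (c := ((-(j + k + ((p : ℝ) + q) / 2) : ℝ) : ℂ)) ?_ ?_ h0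
  · have h1 := eigLap_succ_sub p j
    have h2 := eigLap_succ_sub q k
    push_cast
    linear_combination -h1 - h2
  · have h1 : (1 : ℝ) ≤ p := by exact_mod_cast hp
    have h2 : (r : ℝ) ≤ j + k := by exact_mod_cast hr
    have h3 : (0 : ℝ) ≤ q := Nat.cast_nonneg q
    have h : -(j + k + ((p : ℝ) + q) / 2) + r ≠ 0 := by linarith
    exact_mod_cast h

/-- Here `c + r` is nonzero by the genericity hypothesis. -/
theorem Intertwines.step_right (hp : 1 ≤ p) (hq : 1 ≤ q) (hA : Intertwines p q r n A)
    (hg : Generic p q r n) {j k : ℕ} (hjk : (j + k + 1) % 2 = n % 2)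
    (h0 : ∀ u ∈ kT p q (j + 1) k, A u = 0) : ∀ u ∈ kT p q j (k + 1), A u = 0 := by
  refine hA.step hp hq (by omega) (.inl rfl) (.inr rfl)
    (c := ((j - k + ((p : ℝ) - q) / 2 : ℝ) : ℂ)) ?_ ?_ h0
  · have h1 := eigLap_succ_sub p j
    have h2 := eigLap_succ_sub q k
    push_cast
    linear_combination h1 - h2
  · have h : j - k + ((p : ℝ) - q) / 2 + r ≠ 0 := fun h => by
      refine hg j (k + 1) (by omega) 1 ?_
      rw [shifted, shifted]
      push_cast
      linarith
    exact_mod_cast h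

/-- Here `c + r` is nonzero by the genericity hypothesis. -/
theorem Intertwines.step_left (hp : 1 ≤ p) (hq : 1 ≤ q) (hA : Intertwines p q r n A)
    (hg : Generic p q r n) {j k : ℕ} (hjk : (j + k + 1) % 2 = n % 2)
    (h0 : ∀ u ∈ kT p q j (k + 1), A u = 0) : ∀ u ∈ kT p q (j + 1) k, A u = 0 := by
  refine hA.step hp hq (by omega) (.inr rfl) (.inl rfl)
    (c := ((k - j + ((q : ℝ) - p) / 2 : ℝ) : ℂ)) ?_ ?_ h0
  · have h1 := eigLap_succ_sub p j
    have h2 := eigLap_succ_sub q k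
    push_cast
    linear_combination h2 - h1
  · have h : k - j + ((q : ℝ) - p) / 2 + r ≠ 0 := fun h => by
      refine hg (j + 1) k (by omega) (-r) ?_
      rw [shifted, shifted]
      push_cast
      linarith
    exact_mod_cast h

/-- An intertwinor that vanishes on `V(s,0)` vanishes everywhere. From `V(s,0)` the vanishing spreads
along the antidiagonal `j + k = s`, from there downwards, and upwards to all components except those
with `j = 0` or `k = 0`, which are reached from their neighbours on the same antidiagonal. The upward
steps need `j + k ≥ r`, hence `s ≥ r`. -/
theorem Intertwines.eq_zero (hp : 1 ≤ p) (hq : 1 ≤ q) (hA : Intertwines p q r n A)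
    (hg : Generic p q r n) {s : ℕ} (hs : s % 2 = n % 2) (hrs : r ≤ s)
    (h0 : ∀ u ∈ kT p q s 0, A u = 0) {u : SmoothFun p q} (hu : u ∈ kPar p q n) : A u = 0 := by
  have hdiag : ∀ k j, j + k = s → ∀ u ∈ kT p q j k, A u = 0 := by
    intro k
    induction k with
    | zero => rintro j rfl; exact h0
    | succ k ih => exact fun j hj => hA.step_right hp hq hg (by omega) (ih (j + 1) (by omega))
  have hdown : ∀ d j k, j + k + 2 * d = s → ∀ u ∈ kT p q j k, A u = 0 := by
    intro d
    induction d with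
    | zero => exact fun j k hjk => hdiag k j hjk
    | succ d ih =>
      exact fun j k hjk => hA.step_down hp hq (by omega) (ih (j + 1) (k + 1) (by omega))
  have hup : ∀ d j k, j + k = s + 2 * d → ∀ u ∈ kT p q j k, A u = 0 := by
    intro d
    induction d with
    | zero => exact fun j k hjk => hdiag k j hjk
    | succ d ih =>
      have hpos : ∀ j k, j + 1 + (k + 1) = s + 2 * (d + 1) →
          ∀ u ∈ kT p q (j + 1) (k + 1), A u = 0 := fun j k hjk =>
        hA.step_up hp hq (by omega) (by omega) (ih j k (by omega))
      intro j k hjk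
      rcases j with _ | j
      · obtain ⟨k, rfl⟩ : ∃ k', k = k' + 2 := ⟨k - 2, by omega⟩
        exact hA.step_right hp hq hg (by omega) (hpos 0 k (by omega))
      · rcases k with _ | k
        · obtain ⟨j, rfl⟩ : ∃ j', j = j' + 1 := ⟨j - 1, by omega⟩
          exact hA.step_left hp hq hg (by omega) (hpos j 0 (by omega))
        · exact hpos j k hjk
  refine kPar_induction (φ := fun u => A u = 0) (fun j k hjk u hu => ?_) (map_zero A)
    (fun u v hu hv => by rw [map_add, hu, hv, add_zero]) hu
  rcases le_total (j + k) s with h | h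
  · exact hdown ((s - (j + k)) / 2) j k (by omega) u hu
  · exact hup ((j + k - s) / 2) j k (by omega) u hu

end

/-! ### Intertwinors act by a scalar on `V(s,0)` -/

/-- The functions `h(x) η(y)^t` with `h ∈ E(m)`, where `η = y₀ + i y₁`. -/
def IsNull (m t : ℕ) (u : SmoothFun p q) : Prop :=
  ∃ h ∈ sphHarm p m, u.1 = fun z => h z.1 * (nullCrd q ^ t) z.2

theorem IsNull.mem_kT (hq : 1 ≤ q) {m t : ℕ} {u : SmoothFun p q} (hu : IsNull m t u) :
    u ∈ kT p q m t := by
  obtain ⟨h, hh, hu⟩ := hu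
  exact Submodule.subset_span ⟨h, hh, _, nullCrd_pow_mem hq t, hu⟩

theorem IsNull.sub_smul {m t : ℕ} {u v : SmoothFun p q} (hu : IsNull m t u) (hv : IsNull m t v)
    (c : ℂ) : IsNull m t (u - c • v) := by
  obtain ⟨h, hh, hu⟩ := hu
  obtain ⟨g, hg, hv⟩ := hv
  refine ⟨h - c • g, Submodule.sub_mem _ hh (Submodule.smul_mem _ c hg), ?_⟩
  funext z
  simp only [SmoothFun.sub_val, SmoothFun.smul_val, Pi.sub_apply, Pi.smul_apply, hu, hv,
    smul_eq_mul]
  ring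

theorem IsNull.smul {m t : ℕ} {u : SmoothFun p q} (hu : IsNull m t u) (c : ℂ) :
    IsNull m t (c • u) := by
  obtain ⟨h, hh, hu⟩ := hu
  refine ⟨c • h, Submodule.smul_mem _ c hh, ?_⟩
  funext z
  simp only [SmoothFun.smul_val, Pi.smul_apply, hu, smul_eq_mul]
  ring

/-- Functions in `V(s,0)` depend on `x` only. -/
theorem isNull_of_mem_kT (hq : 1 ≤ q) {s : ℕ} {u : SmoothFun p q} (hu : u ∈ kT p q s 0) :
    IsNull s 0 u := by
  have hu' : u.1 ∈ kType p q s 0 := hu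
  have key : ∀ w ∈ kType p q s 0, ∃ h ∈ sphHarm p s, w = fun z => h z.1 := by
    intro w hw
    induction hw using Submodule.span_induction with
    | mem u hu =>
      obtain ⟨f, hf, g, hg, rfl⟩ := hu
      refine ⟨g (basePt q) • f, Submodule.smul_mem _ _ hf, funext fun z => ?_⟩
      rw [Pi.smul_apply, smul_eq_mul, mul_comm, sphHarm_zero_const hq hg z.2 (basePt q)]
    | zero => exact ⟨0, Submodule.zero_mem _, rfl⟩
    | add u v _ _ hu hv =>
      obtain ⟨f, hf, rfl⟩ := hu
      obtain ⟨g, hg, rfl⟩ := hv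
      exact ⟨f + g, Submodule.add_mem _ hf hg, rfl⟩
    | smul c u _ hu =>
      obtain ⟨f, hf, rfl⟩ := hu
      exact ⟨c • f, Submodule.smul_mem _ c hf, rfl⟩
  obtain ⟨h, hh, he⟩ := key _ hu'
  exact ⟨h, hh, by simpa using he⟩

/-- Multiplication by `x_i η`. -/
def mulNull (i : Fin (p + 1)) : Module.End ℂ (SmoothFun p q) :=
  mulX (.inr 0) * mulX (.inl i) + Complex.I • (mulX (.inr 1) * mulX (.inl i))

theorem mulNull_apply (i : Fin (p + 1)) (u : SmoothFun p q) (z : Prd p q) :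
    (mulNull i u).1 z = crdS i z.1 * nullCrd q z.2 * u.1 z := by
  simp only [mulNull, LinearMap.add_apply, LinearMap.smul_apply, SmoothFun.add_val,
    SmoothFun.smul_val, Pi.add_apply, Pi.smul_apply, Module.End.mul_apply, mulX_apply, nullCrd,
    smul_eq_mul]
  have e : ∀ k, crd (p := p) (.inr k) z = crdS k z.2 := fun _ => rfl
  have e' : ∀ k, crd (q := q) (.inl k) z = crdS k z.1 := fun _ => rfl
  rw [e, e, e']; ring

/-- Multiplication by `x_i η` and projection to `V(m,t+1)` multiply by `η` the component of `x_i u` in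
`V(m,t)`, and this component can be recovered from the result. -/
theorem IsNull.pr_mulNull (hp : 1 ≤ p) (hq : 1 ≤ q) {m t : ℕ} {u : SmoothFun p q}
    (hu : IsNull (m + 1) t u) (i : Fin (p + 1)) :
    IsNull m (t + 1) (pr p q m (t + 1) (mulNull i u)) ∧
      (pr p q m (t + 1) (mulNull i u) = 0 → pr p q m t (mulX (.inl i) u) = 0) := by
  obtain ⟨h, hh, hu⟩ := hu
  obtain ⟨a, ha, b, hb, he, -⟩ := crdS_mul_mem hp i hh
  rw [Nat.add_sub_cancel] at hb
  have hsm : ∀ {f : Sph p → ℂ}, SmoothSph f → ∀ t,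
      Smooth (fun z : Prd p q => f z.1 * (nullCrd q ^ t) z.2) := fun hf t =>
    Smooth.mul hf.fst (smoothSph_nullCrd_pow t).snd
  have hxh : ∀ x, crdS i x * h x = a x + b x := fun x => congrFun he x
  have e1 : mulNull i u = SmoothFun.of (hsm ha.1 (t + 1)) + SmoothFun.of (hsm hb.1 (t + 1)) :=
    Subtype.ext (funext fun z => by
      rw [mulNull_apply, hu]
      change crdS i z.1 * nullCrd q z.2 * (h z.1 * nullCrd q z.2 ^ t) =
        a z.1 * nullCrd q z.2 ^ (t + 1) + b z.1 * nullCrd q z.2 ^ (t + 1)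
      linear_combination nullCrd q z.2 ^ (t + 1) * hxh z.1)
  have e2 : mulX (.inl i) u = SmoothFun.of (hsm ha.1 t) + SmoothFun.of (hsm hb.1 t) :=
    Subtype.ext (funext fun z => by
      rw [mulX_apply, hu]
      change crdS i z.1 * (h z.1 * nullCrd q z.2 ^ t) =
        a z.1 * nullCrd q z.2 ^ t + b z.1 * nullCrd q z.2 ^ t
      linear_combination nullCrd q z.2 ^ t * hxh z.1)
  have hna : ∀ t, SmoothFun.of (hsm ha.1 t) ∈ kT p q (m + 1 + 1) t := fun t =>
    IsNull.mem_kT hq ⟨a, ha, rfl⟩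
  have hnb : ∀ t, IsNull m t (SmoothFun.of (hsm hb.1 t)) := fun t => ⟨b, hb, rfl⟩
  have e3 : pr p q m (t + 1) (mulNull i u) = SmoothFun.of (hsm hb.1 (t + 1)) := by
    rw [e1, map_add, pr_of_ne hp hq (by simp; omega) (hna _), zero_add, pr_self ((hnb _).mem_kT hq)]
  have e4 : pr p q m t (mulX (.inl i) u) = SmoothFun.of (hsm hb.1 t) := by
    rw [e2, map_add, pr_of_ne hp hq (by simp; omega) (hna _), zero_add, pr_self ((hnb _).mem_kT hq)]
  refine ⟨by rw [e3]; exact hnb _, fun h0 => ?_⟩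
  rw [e3] at h0
  have hb0 : ∀ x, b x = 0 := fun x => by
    have := congrFun (congrArg Subtype.val h0) (x, basePt q)
    change b x * nullCrd q (basePt q) ^ (t + 1) = 0 at this
    rwa [nullCrd_basePt hq, one_pow, mul_one] at this
  rw [e4]
  refine Subtype.ext (funext fun z => ?_)
  change b z.1 * _ = 0
  rw [hb0, zero_mul]

/-- The multiplications by `x_i η`, followed by the projection to `V(m,t+1)`, are jointly injective. -/
theorem IsNull.eq_zero (hp : 1 ≤ p) (hq : 1 ≤ q) {m t : ℕ} {u : SmoothFun p q}
    (hu : IsNull (m + 1) t u) (h : ∀ i, pr p q m (t + 1) (mulNull i u) = 0) : u = 0 :=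
  mulX_inl_of_pr_eq_zero hp hq (.inr rfl) (hu.mem_kT hq) fun i => (hu.pr_mulNull hp hq i).2 (h i)

section

variable {r n : ℕ} {A : Module.End ℂ (SmoothFun p q)}

/-- On the functions `h(x) η(y)^t` in `V(m,t)` that an intertwinor maps to such functions, it acts by a
scalar. For `m = 0` these functions are the multiples of `η^t`; the multiplications by `x_i η`
followed by the projection to the next component are jointly injective and reduce `m`. -/
theorem Intertwines.scalar_of_isNull (hp : 1 ≤ p) (hq : 1 ≤ q) (hA : Intertwines p q r n A)
    (hg : Generic p q r n) (m : ℕ) : ∀ t, (m + t) % 2 = n % 2 →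
      ∃ κ : ℂ, ∀ u, IsNull m t u → IsNull m t (A u) → A u = κ • u := by
  induction m with
  | zero =>
    intro t ht
    by_cases h : ∃ u, IsNull 0 t u ∧ IsNull 0 t (A u) ∧ u ≠ 0
    · obtain ⟨u, hu, hAu, hne⟩ := h
      have hform : ∀ v : SmoothFun p q, IsNull 0 t v → ∃ c : ℂ, v.1 = fun z => c * (nullCrd q ^ t) z.2 :=
        fun v ⟨h, hh, hv⟩ => ⟨h (basePt p), by
          rw [hv]; funext z; rw [sphHarm_zero_const hp hh z.1 (basePt p)]⟩
      obtain ⟨c, hc⟩ := hform u hu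
      obtain ⟨d, hd⟩ := hform _ hAu
      have hc0 : c ≠ 0 := fun h0 => hne (Subtype.ext (by rw [hc, h0]; funext z; simp))
      have hmul : ∀ v : SmoothFun p q, IsNull 0 t v → ∃ e : ℂ, v = e • u := fun v hv => by
        obtain ⟨e, he⟩ := hform v hv
        refine ⟨e * c⁻¹, Subtype.ext ?_⟩
        rw [SmoothFun.smul_val, he, hc]
        funext z
        simp only [Pi.smul_apply, smul_eq_mul]
        rw [← mul_assoc, inv_mul_cancel_right₀ hc0]
      obtain ⟨κ, hκ⟩ := hmul _ hAu
      refine ⟨κ, fun v hv _ => ?_⟩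
      obtain ⟨e, rfl⟩ := hmul v hv
      rw [map_smul, hκ, smul_comm]
    · push Not at h
      exact ⟨0, fun u hu hAu => by rw [h u hu hAu, map_zero, smul_zero]⟩
  | succ m ih =>
    intro t ht
    obtain ⟨κ, hκ⟩ := ih (t + 1) (by omega)
    set c : ℝ := t - m + ((q : ℝ) - p) / 2 with hcdef
    have hc : eigLap p m + eigLap q (t + 1) - (eigLap p (m + 1) + eigLap q t) = 2 * (c : ℂ) := by
      have h1 := eigLap_succ_sub p m
      have h2 := eigLap_succ_sub q t
      rw [hcdef]
      push_cast
      linear_combination h2 - h1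
    -- `c ± r` are the factors in the link relation between `V(m+1,t)` and `V(m,t+1)`
    have hminus : (c : ℂ) - r ≠ 0 := by
      have h : c - r ≠ 0 := fun h => by
        refine hg (m + 1) t (by omega) 0 ?_
        rw [shifted, shifted]; push_cast; linarith
      exact_mod_cast h
    have hplus : (c : ℂ) + r ≠ 0 := by
      have h : c + r ≠ 0 := fun h => by
        refine hg (m + 1) t (by omega) (-r) ?_
        rw [shifted, shifted]; push_cast; linarith
      exact_mod_cast h
    have hlink : ∀ i, ∀ u : SmoothFun p q, IsNull (m + 1) t u →
        (c - r : ℂ) • A (SphereProduct.pr p q m (t + 1) (mulNull i u)) =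
          (c + r : ℂ) • SphereProduct.pr p q m (t + 1) (mulNull i (A u)) := fun i u hu => by
      have h0 := hA.link hp hq (j' := m) (k' := t + 1) ht hc i 0 (hu.mem_kT hq)
      have h1 := hA.link hp hq (j' := m) (k' := t + 1) ht hc i 1 (hu.mem_kT hq)
      simp only [mulNull, LinearMap.add_apply, LinearMap.smul_apply, Module.End.mul_apply, map_add,
        map_smul, smul_add, h0]
      rw [smul_comm, h1, smul_comm]
    refine ⟨((c : ℂ) + r)⁻¹ * (c - r) * κ, fun u hu hAu => ?_⟩
    rw [← sub_eq_zero]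
    refine (hAu.sub_smul hu _).eq_zero hp hq fun i => ?_
    have h1 := hlink i u hu
    have hN := (hu.pr_mulNull hp hq i).1
    have hN' := (hAu.pr_mulNull hp hq i).1
    have h2 : A (SphereProduct.pr p q m (t + 1) (mulNull i u)) =
        (((c : ℂ) - r)⁻¹ * (c + r)) • SphereProduct.pr p q m (t + 1) (mulNull i (A u)) := by
      rw [mul_smul, ← h1, smul_smul, inv_mul_cancel₀ hminus, one_smul]
    have h3 := hκ _ hN (by rw [h2]; exact hN'.smul _)
    rw [h3] at h1
    rw [map_sub, map_sub, map_smul, map_smul, mul_assoc, mul_smul, mul_smul, h1, smul_smul,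
      inv_mul_cancel₀ hplus, one_smul, sub_self]

/-- An intertwinor and `D` are both scalars on `V(s,0)`, and the scalar of `D` is not zero; the difference
of the intertwinor and a multiple of `D` then vanishes on `V(s,0)`. -/
theorem Intertwines.eq_smul_diffD (hp : 1 ≤ p) (hq : 1 ≤ q) (hA : Intertwines p q r n A)
    (hg : Generic p q r n) : ∃ c : ℂ, ∀ u ∈ kPar p q n, A u = c • diffD p q r u := by
  obtain ⟨s, hs, hrs⟩ : ∃ s, s % 2 = n % 2 ∧ r ≤ s := ⟨2 * r + n, by omega, by omega⟩
  obtain ⟨κ, hκ⟩ := hA.scalar_of_isNull hp hq hg s 0 hs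
  have hd : eigD p q r s 0 ≠ 0 := by
    refine mul_ne_zero (Finset.prod_ne_zero_iff.mpr fun i _ => ?_)
      (Finset.prod_ne_zero_iff.mpr fun i _ h => ?_)
    · have h1 : (r : ℝ) ≤ s := by exact_mod_cast hrs
      have h2 := shifted_nonneg hq 0
      have h3 : (1 : ℝ) ≤ p := by exact_mod_cast hp
      have h4 : (0 : ℝ) ≤ i := Nat.cast_nonneg i
      rw [shifted] at *
      rw [shifted]
      have : (0 : ℝ) < ((0 : ℕ) + ((q : ℝ) - 1) / 2) + (s + ((p : ℝ) - 1) / 2) + (2 * i + 1 - r) := by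
        linarith
      exact this.ne'
    · refine hg s 0 hs (-i) ?_
      push_cast
      linarith
  have hd' : ((eigD p q r s 0 : ℝ) : ℂ) ≠ 0 := by exact_mod_cast hd
  refine ⟨κ * ((eigD p q r s 0 : ℝ) : ℂ)⁻¹, fun u hu => ?_⟩
  rw [← sub_eq_zero]
  refine (hA.sub (intertwines_diffD r n) _).eq_zero hp hq hg hs hrs (fun v hv => ?_) hu
  rw [LinearMap.sub_apply, LinearMap.smul_apply, diffD_apply r hv,
    hκ v (isNull_of_mem_kT hq hv) (isNull_of_mem_kT hq (hA.mem_kT hp hq hs hv)), smul_smul,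
    inv_mul_cancel_right₀ hd', sub_self]

end

/-- Every intertwinor on `𝓔^ε` is a multiple of `D`. -/
theorem IsIntertwinor.eq_smul (hp : 1 ≤ p) (hq : 1 ≤ q) {r : ℕ} {ε : Fin 2}
    (hε : ∀ m : ℤ, ((q : ℝ) - p) / 2 + (ε : ℕ) + 1 - r ≠ 2 * m)
    {A : Module.End ℂ (kFinitePar p q ε)} (hA : IsIntertwinor p q r ε A) :
    ∃ c : ℂ, ∀ f, A f = c • parD p q r ε f := by
  have hinj : Function.Injective (parIncl p q ε) := fun f g h =>
    Subtype.ext (congrArg (fun u : SmoothFun p q => u.1) h)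
  obtain ⟨g, hg⟩ := LinearMap.exists_leftInverse_of_injective (parIncl p q ε)
    (LinearMap.ker_eq_bot.mpr hinj)
  -- `g` is a linear retraction of `C^∞` onto `𝓔^ε`; which one is chosen does not matter
  let A' : Module.End ℂ (SmoothFun p q) := parIncl p q ε ∘ₗ A ∘ₗ g
  have hA' : ∀ f, A' (parIncl p q ε f) = parIncl p q ε (A f) := fun f => by
    have : g (parIncl p q ε f) = f := LinearMap.congr_fun hg f
    simp only [A', LinearMap.comp_apply, this]
  have hlift : ∀ u ∈ kPar p q ε, ∃ f, parIncl p q ε f = u := fun u hu =>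
    ⟨⟨u.1, mem_kPar.mp hu⟩, rfl⟩
  have hmem : ∀ f, parIncl p q ε f ∈ kPar p q ε := fun f => mem_kPar.mpr f.2
  have hI : Intertwines p q r ε A' := by
    refine ⟨fun u hu => ?_, fun X u hu => ?_⟩
    · obtain ⟨f, rfl⟩ := hlift u hu
      rw [hA']; exact hmem _
    · obtain ⟨f, rfl⟩ := hlift u hu
      obtain ⟨g, hg⟩ := hlift _ (confOp_mem_kPar hp hq (((p : ℂ) + q) / 2 - r) X hu)
      have c1 : ((p : ℂ) + q) / 2 - r = (((((p : ℝ) + q) / 2 - r : ℝ)) : ℂ) := by push_cast; ring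
      have c2 : ((p : ℂ) + q) / 2 + r = (((((p : ℝ) + q) / 2 + r : ℝ)) : ℂ) := by push_cast; ring
      have h := hA.2 X f g (by
        have h := congrArg (fun u : SmoothFun p q => u.1) hg
        rw [c1] at h
        exact h.trans (confOp_apply _ X _))
      rw [← hg, hA', hA', c2]
      exact Subtype.ext (h.trans (confOp_apply _ X (parIncl p q ε (A f))).symm)
  obtain ⟨c, hc⟩ := hI.eq_smul_diffD hp hq (generic_of_ne hε)
  refine ⟨c, fun f => hinj ?_⟩
  rw [← hA', hc _ (hmem f)]
  rfl

/-- The values of a spectral function are read off at the nonzero vectors `ζ(x)^j η(y)^k` of `V(j,k)`. -/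
theorem IsSpectralFunction.eq_mul (hp : 1 ≤ p) (hq : 1 ≤ q) {r : ℕ} {ε : Fin 2}
    (hε : ∀ m : ℤ, ((q : ℝ) - p) / 2 + (ε : ℕ) + 1 - r ≠ 2 * m)
    {Z : ℕ → ℕ → ℂ} (hZ : IsSpectralFunction p q r ε Z) :
    ∃ c : ℂ, ∀ j k, (j + k) % 2 = (ε : ℕ) → Z j k = c * ((eigD p q r j k : ℝ) : ℂ) := by
  obtain ⟨A, hA, hAZ⟩ := hZ
  obtain ⟨c, hc⟩ := hA.eq_smul hp hq hε
  refine ⟨c, fun j k hjk => ?_⟩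
  have hu : (fun z : Prd p q => (nullCrd p ^ j) z.1 * (nullCrd q ^ k) z.2) ∈ kType p q j k :=
    Submodule.subset_span ⟨_, nullCrd_pow_mem hp j, _, nullCrd_pow_mem hq k, rfl⟩
  let f : kFinitePar p q ε := ⟨_, Submodule.mem_iSup_of_mem j (Submodule.mem_iSup_of_mem k
    (Submodule.mem_iSup_of_mem hjk hu))⟩
  have h1 := hAZ j k hjk f hu
  rw [hc f] at h1
  have h2 := congrFun (congrArg Subtype.val h1) (basePt p, basePt q)
  have h3 := congrFun (congrArg (fun u : SmoothFun p q => u.1)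
    (diffD_apply r (u := parIncl p q ε f) hu)) (basePt p, basePt q)
  change c * (diffD p q r (parIncl p q ε f)).1 (basePt p, basePt q) =
    Z j k * (nullCrd p (basePt p) ^ j * nullCrd q (basePt q) ^ k) at h2
  change (diffD p q r (parIncl p q ε f)).1 (basePt p, basePt q) =
    ((eigD p q r j k : ℝ) : ℂ) * (nullCrd p (basePt p) ^ j * nullCrd q (basePt q) ^ k) at h3
  rw [h3] at h2
  simpa [nullCrd_basePt hp, nullCrd_basePt hq] using h2.symm

/-! ### Stereographic coordinates -/

/-- The inverse of the stereographic projection from `-z`, which takes `z` to `0`, in the coordinates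
given by a basis `b` of the orthogonal complement of `z`. -/
def stereo {n : ℕ} (b : Fin n → Amb n) (z : Amb n) (x : Fin n → ℝ) : Amb n :=
  (∑ i, x i ^ 2 + 4)⁻¹ • ((4 : ℝ) • ∑ i, x i • b i + (4 - ∑ i, x i ^ 2) • z)

/-- The manifold chart of the sphere around `z` is the stereographic projection from `-z`, in the
coordinates of some orthonormal basis of the orthogonal complement of `z`. -/
theorem exists_chart_frame {n : ℕ} (z : Sph n) : ∃ b : Fin n → Amb n,
    (∀ i j, ⟪b i, b j⟫_ℝ = if i = j then 1 else 0) ∧ (∀ i, ⟪b i, (z : Amb n)⟫_ℝ = 0) ∧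
    chartAt (EuclideanSpace ℝ (Fin n)) z z = 0 ∧
    ∀ x : EuclideanSpace ℝ (Fin n),
      ((chartAt (EuclideanSpace ℝ (Fin n)) z).symm x : Amb n) = stereo b z x := by
  have := fact_finrank n
  set B := OrthonormalBasis.fromOrthogonalSpanSingleton (𝕜 := ℝ) (E := Amb n) n
    (ne_zero_of_mem_unit_sphere (-z)) with hB
  have hchart : chartAt (EuclideanSpace ℝ (Fin n)) z = stereographic' n (-z) := rfl
  refine ⟨fun i => (B i : Amb n), fun i j => ?_, fun i => ?_, ?_, fun x => ?_⟩
  · have := orthonormal_iff_ite.mp B.orthonormal i j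
    exact this
  · have h := Submodule.mem_orthogonal_singleton_iff_inner_left.mp (B i).2
    simpa using h
  · rw [hchart, stereographic']
    change B.repr (stereographic (norm_eq_of_mem_sphere (-z)) z) = 0
    rw [stereographic_neg_apply, map_zero]
  · rw [hchart, stereographic'_symm_apply]
    have hU : ((B.repr.symm x : (ℝ ∙ ((-z : Sph n) : Amb n))ᗮ) : Amb n) = ∑ i, x i • (B i : Amb n) := by
      rw [← B.sum_repr_symm]
      exact (map_sum (Submodule.subtype _) _ _).trans rfl
    have hn : ‖((B.repr.symm x : (ℝ ∙ ((-z : Sph n) : Amb n))ᗮ) : Amb n)‖ ^ 2 = ∑ i, x i ^ 2 := by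
      rw [Submodule.norm_coe, LinearIsometryEquiv.norm_map, EuclideanSpace.norm_sq_eq]
      simp
    simp only [← hB]
    rw [hn, hU, stereo]
    generalize (∑ i, x i • (B i : Amb n)) = β
    change _ + _ • (_ • -(z : Amb n)) = _
    module

/-- A partial derivative is the derivative along a coordinate line. -/
theorem pd_eq {ι E : Type*} [Fintype ι] [DecidableEq ι] [NormedAddCommGroup E] [NormedSpace ℝ E]
    {a : ι} {F : (ι → ℝ) → E} {w : ι → ℝ} {d : E} (hF : DifferentiableAt ℝ F w)
    (hd : HasDerivAt (fun t : ℝ => F (w + t • (Pi.single a 1 : ι → ℝ))) d 0) : pd a F w = d := by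
  rw [pd, ← hF.lineDeriv_eq_fderiv]
  exact hd.deriv

theorem stereo_contDiff {n : ℕ} (b : Fin n → Amb n) (z : Amb n) : ContDiff ℝ ∞ (stereo b z) := by
  have hQ : ContDiff ℝ ∞ fun x : Fin n → ℝ => ∑ i, x i ^ 2 :=
    ContDiff.sum fun i _ => (contDiff_apply ℝ ℝ i).pow 2
  have hβ : ContDiff ℝ ∞ fun x : Fin n → ℝ => ∑ i, x i • b i :=
    ContDiff.sum fun i _ => (contDiff_apply ℝ ℝ i).smul contDiff_const
  refine ContDiff.smul ((hQ.add contDiff_const).inv fun x => ?_)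
    ((hβ.const_smul (4 : ℝ)).add ((contDiff_const.sub hQ).smul contDiff_const))
  have : 0 ≤ ∑ i, x i ^ 2 := Finset.sum_nonneg fun i _ => sq_nonneg _
  positivity

/-- The partial derivative `∂_i` of `stereo b z` at `x`. -/
def stereoDer {n : ℕ} (b : Fin n → Amb n) (z : Amb n) (i : Fin n) (x : Fin n → ℝ) : Amb n :=
  (4 * (∑ i, x i ^ 2 + 4)⁻¹) • b i -
    (8 * ((∑ i, x i ^ 2 + 4)⁻¹) ^ 2 * x i) • (∑ i, x i • b i + (2 : ℝ) • z)

theorem hasDerivAt_stereo {n : ℕ} (b : Fin n → Amb n) (z : Amb n) (i : Fin n) (x : Fin n → ℝ) :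
    HasDerivAt (fun t : ℝ => stereo b z (x + t • (Pi.single i 1 : Fin n → ℝ))) (stereoDer b z i x) 0 := by
  have hQ : ∀ t : ℝ, ∑ k, (x + t • (Pi.single i 1 : Fin n → ℝ)) k ^ 2 =
      ∑ k, x k ^ 2 + (2 * x i * t + t ^ 2) := fun t => by
    have : ∀ k, (x + t • (Pi.single i 1 : Fin n → ℝ)) k ^ 2 =
        x k ^ 2 + if k = i then 2 * x i * t + t ^ 2 else 0 := fun k => by
      by_cases hk : k = i
      · subst hk; simp; ring
      · simp [hk]
    simp only [this, Finset.sum_add_distrib, Finset.sum_ite_eq', Finset.mem_univ, if_true]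
  have hβ : ∀ t : ℝ, ∑ k, (x + t • (Pi.single i 1 : Fin n → ℝ)) k • b k = ∑ k, x k • b k + t • b i :=
    fun t => by
      have : ∀ k, (x + t • (Pi.single i 1 : Fin n → ℝ)) k • b k =
          x k • b k + if k = i then t • b i else 0 := fun k => by
        by_cases hk : k = i
        · subst hk; simp [add_smul]
        · simp [hk]
      simp only [this, Finset.sum_add_distrib, Finset.sum_ite_eq', Finset.mem_univ, if_true]
  simp only [stereo, hQ, hβ]
  set Q := ∑ k, x k ^ 2 with hQd
  set β := ∑ k, x k • b k with hβd
  have hQ0 : 0 ≤ Q := Finset.sum_nonneg fun i _ => sq_nonneg _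
  have h1 : HasDerivAt (fun t : ℝ => 2 * x i * t + t ^ 2) (2 * x i) 0 := by
    simpa using ((hasDerivAt_id' (0 : ℝ)).const_mul (2 * x i)).fun_add (hasDerivAt_pow 2 (0 : ℝ))
  have h2 : HasDerivAt (fun t : ℝ => (Q + (2 * x i * t + t ^ 2) + 4)⁻¹)
      (-(2 * x i) / (Q + 4) ^ 2) 0 := by
    have := ((h1.const_add Q).add_const 4).fun_inv (by simp; positivity)
    simpa using this
  have h3 : HasDerivAt (fun t : ℝ => (4 : ℝ) • (β + t • b i) + (4 - (Q + (2 * x i * t + t ^ 2))) • z)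
      ((4 : ℝ) • b i + (-(2 * x i)) • z) 0 := by
    have e1 : HasDerivAt (fun t : ℝ => (4 : ℝ) • (β + t • b i)) ((4 : ℝ) • b i) 0 := by
      simpa using (((hasDerivAt_id' (0 : ℝ)).smul_const (b i)).const_add β).fun_const_smul (4 : ℝ)
    exact e1.fun_add (((h1.const_add Q).const_sub 4).smul_const z)
  have h4 := h2.fun_smul h3
  refine h4.congr_deriv ?_
  simp only [stereoDer, ← hQd, ← hβd]
  have hs : (Q + 4) ≠ 0 := by positivity
  simp only [mul_zero, add_zero, ne_eq, OfNat.ofNat_ne_zero, not_false_eq_true, zero_pow, zero_smul,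
    smul_add, smul_smul]
  match_scalars <;> field_simp <;> ring

/-- The inverse stereographic projection is conformal, with factor `16 / (|x|² + 4)²`. -/
theorem inner_stereoDer {n : ℕ} {b : Fin n → Amb n} {z : Amb n}
    (hb : ∀ i j, ⟪b i, b j⟫_ℝ = if i = j then 1 else 0) (hbz : ∀ i, ⟪b i, z⟫_ℝ = 0)
    (hz : ⟪z, z⟫_ℝ = 1) (i j : Fin n) (x : Fin n → ℝ) :
    ⟪stereoDer b z i x, stereoDer b z j x⟫_ℝ =
      if i = j then 16 / (∑ i, x i ^ 2 + 4) ^ 2 else 0 := by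
  set Q := ∑ k, x k ^ 2 with hQd
  set β := ∑ k, x k • b k with hβd
  have hQ0 : 0 ≤ Q := Finset.sum_nonneg fun i _ => sq_nonneg _
  have hs : (Q + 4) ≠ 0 := by positivity
  have h1 : ∀ i, ⟪b i, β⟫_ℝ = x i := fun i => by
    simp [hβd, inner_sum, inner_smul_right, hb]
  have h1' : ∀ i, ⟪β, b i⟫_ℝ = x i := fun i => by rw [real_inner_comm, h1]
  have h2 : ⟪β, β⟫_ℝ = Q := by
    have h : ∀ v, ⟪β, v⟫_ℝ = ∑ k, x k * ⟪b k, v⟫_ℝ := fun v => by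
      simp [hβd, sum_inner, inner_smul_left]
    simp only [h β, h1, hQd, pow_two]
  have h3 : ⟪β, z⟫_ℝ = 0 := by simp [hβd, sum_inner, inner_smul_left, hbz]
  have h3' : ⟪z, β⟫_ℝ = 0 := by rw [real_inner_comm, h3]
  have hbz' : ∀ i, ⟪z, b i⟫_ℝ = 0 := fun i => by rw [real_inner_comm, hbz]
  simp only [stereoDer, ← hQd, ← hβd, inner_sub_left, inner_sub_right, inner_smul_left,
    inner_smul_right, inner_add_left, inner_add_right, h1, h1', h2, h3, h3', hbz, hbz', hz, hb,
    conj_trivial]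
  split_ifs with hij
  · subst hij; field_simp; ring
  · field_simp; ring

/-- The Laplacian of the sphere at `x` in terms of an orthonormal basis of the tangent space: the
second derivative of the homogeneous extension in the radial direction vanishes. -/
theorem sphLap_eq_sum_frame {n : ℕ} {f : Sph n → ℂ} (hf : SmoothSph f) (x : Sph n)
    {b : Fin n → Amb n} (hb : ∀ i j, ⟪b i, b j⟫_ℝ = if i = j then 1 else 0)
    (hbx : ∀ i, ⟪b i, (x : Amb n)⟫_ℝ = 0) :
    sphLap f x = -∑ i, fderiv ℝ (fderiv ℝ (homExt f)) x (b i) (b i) := by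
  have := fact_finrank n
  have hx0 := ne_zero_of_mem_unit_sphere x
  have hxx : ⟪(x : Amb n), (x : Amb n)⟫_ℝ = 1 := by
    rw [real_inner_self_eq_norm_sq, mem_sphere_zero_iff_norm.mp x.2, one_pow]
  have ho : Orthonormal ℝ (Fin.cons (x : Amb n) b : Fin (n + 1) → Amb n) := by
    rw [orthonormal_iff_ite]
    intro i j
    refine Fin.cases ?_ (fun i => ?_) i <;> refine Fin.cases ?_ (fun j => ?_) j
    · simp
    · simpa [(Fin.succ_ne_zero j).symm] using (real_inner_comm _ _).trans (hbx j)
    · simpa [Fin.succ_ne_zero i] using hbx i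
    · simpa using hb i j
  let B : OrthonormalBasis (Fin (n + 1)) ℝ (Amb n) :=
    (basisOfOrthonormalOfCardEqFinrank ho (by simp)).toOrthonormalBasis (by simpa using ho)
  have hB : ⇑B = Fin.cons (x : Amb n) b := by simp [B]
  have h2 : DifferentiableAt ℝ (fderiv ℝ (homExt f)) (x : Amb n) :=
    ((homExt_contDiffAt hf hx0).fderiv_right (m := ∞) le_rfl).differentiableAt (by simp)
  have hrad : fderiv ℝ (fderiv ℝ (homExt f)) x (x : Amb n) (x : Amb n) = 0 := by
    have h3 := (h2.hasFDerivAt.clm_apply (hasFDerivAt_id (x : Amb n))).congr_of_eventuallyEq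
      (f₁ := fun _ => (0 : ℂ)) ?_
    · have h4 := congrArg (fun L : Amb n →L[ℝ] ℂ => L x) (h3.unique (hasFDerivAt_const 0 _))
      simpa [fderiv_homExt_self hf hx0] using h4
    · filter_upwards [eventually_ne_nhds hx0] with v hv
      exact (fderiv_homExt_self hf hv).symm
  rw [sphLap, InnerProductSpace.laplacian_eq_iteratedFDeriv_orthonormalBasis _ B]
  simp only [iteratedFDeriv_two_apply, hB, Fin.sum_univ_succ, Fin.cons_zero, Fin.cons_succ,
    Matrix.cons_val_zero, Matrix.cons_val_one, hrad, zero_add]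

theorem fderiv_fderiv_homExt_fst {f : Prd p q → ℂ} (hf : Smooth f) (z : Prd p q) (u : Amb p) :
    fderiv ℝ (fderiv ℝ (homExt fun x => f (x, z.2))) z.1 u u =
      fderiv ℝ (fderiv ℝ (homExt₂ f)) (emb z) (u, 0) (u, 0) := by
  have hx : ∀ v : Amb p, homExt (fun x => f (x, z.2)) v =
      homExt₂ f (ContinuousLinearMap.inl ℝ (Amb p) (Amb q) v + (0, (z.2 : Amb q))) := fun v => by
    rw [homExt_slice_fst]; simp
  have hz : ContinuousLinearMap.inl ℝ (Amb p) (Amb q) z.1 + (0, (z.2 : Amb q)) = emb z := by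
    simp [emb]
  have h := iteratedFDeriv_two_comp_affine (F := homExt₂ f) _ _
    (by rw [hz]; exact homExt₂_contDiffAt_emb hf z) u u
  rw [hz, ← funext hx, iteratedFDeriv_two_apply] at h
  simpa using h

theorem fderiv_fderiv_homExt_snd {f : Prd p q → ℂ} (hf : Smooth f) (z : Prd p q) (u : Amb q) :
    fderiv ℝ (fderiv ℝ (homExt fun y => f (z.1, y))) z.2 u u =
      fderiv ℝ (fderiv ℝ (homExt₂ f)) (emb z) (0, u) (0, u) := by
  have hx : ∀ v : Amb q, homExt (fun y => f (z.1, y)) v =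
      homExt₂ f (ContinuousLinearMap.inr ℝ (Amb p) (Amb q) v + ((z.1 : Amb p), 0)) := fun v => by
    rw [homExt_slice_snd]; simp
  have hz : ContinuousLinearMap.inr ℝ (Amb p) (Amb q) z.2 + ((z.1 : Amb p), 0) = emb z := by
    simp [emb]
  have h := iteratedFDeriv_two_comp_affine (F := homExt₂ f) _ _
    (by rw [hz]; exact homExt₂_contDiffAt_emb hf z) u u
  rw [hz, ← funext hx, iteratedFDeriv_two_apply] at h
  simpa using h

/-! ### The curvature of a product of spheres in stereographic coordinates -/

section Curvature

variable {ι : Type*} [Fintype ι]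

/-- The sum of the squares of the coordinates that belong to the same sphere as the `i`-th one. -/
def blockSq (blk : ι → Bool) (i : ι) (w : ι → ℝ) : ℝ := ∑ k, if blk k = blk i then w k ^ 2 else 0

variable {blk : ι → Bool}

theorem blockSq_nonneg (i : ι) (w : ι → ℝ) : 0 ≤ blockSq blk i w :=
  Finset.sum_nonneg fun k _ => by split_ifs <;> positivity

theorem blockSq_add_ne (i : ι) (w : ι → ℝ) : blockSq blk i w + 4 ≠ 0 := by
  have := blockSq_nonneg (blk := blk) i w
  positivity

@[simp] theorem blockSq_zero (i : ι) : blockSq blk i 0 = 0 := by simp [blockSq]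

theorem blockSq_congr {i j : ι} (h : blk i = blk j) (w : ι → ℝ) :
    blockSq blk i w = blockSq blk j w := by simp only [blockSq, h]

theorem differentiable_blockSq (i : ι) : Differentiable ℝ (blockSq blk i) := by
  unfold blockSq
  refine Differentiable.fun_sum fun k _ => ?_
  split_ifs <;> fun_prop

variable [DecidableEq ι] {s : Bool → ℝ}

/-- The metric coefficients of a product of two round spheres, multiplied by the constants `s`, in
stereographic coordinates: `blk` tells the sphere to which a coordinate belongs. -/
def stereoMetric (blk : ι → Bool) (s : Bool → ℝ) (w : ι → ℝ) : Matrix ι ι ℝ :=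
  Matrix.diagonal fun i => s (blk i) * (16 / (blockSq blk i w + 4) ^ 2)

theorem blockSq_line (i a : ι) (w : ι → ℝ) (t : ℝ) :
    blockSq blk i (w + t • (Pi.single a 1 : ι → ℝ)) =
      blockSq blk i w + if blk a = blk i then 2 * w a * t + t ^ 2 else 0 := by
  have : ∀ k, (if blk k = blk i then (w + t • (Pi.single a 1 : ι → ℝ)) k ^ 2 else 0) =
      (if blk k = blk i then w k ^ 2 else 0) +
        if k = a then (if blk a = blk i then 2 * w a * t + t ^ 2 else 0) else 0 := fun k => by
    by_cases hk : k = a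
    · subst hk
      by_cases h : blk k = blk i
      · simp only [h, if_true, Pi.add_apply, Pi.smul_apply, Pi.single_eq_same, smul_eq_mul]
        ring
      · simp [h]
    · simp [hk]
  simp only [blockSq, this, Finset.sum_add_distrib, Finset.sum_ite_eq', Finset.mem_univ, if_true]

theorem stereoMetric_inv (hs : ∀ c, s c ≠ 0) (w : ι → ℝ) :
    (stereoMetric blk s w)⁻¹ =
      Matrix.diagonal fun i => (s (blk i))⁻¹ * ((blockSq blk i w + 4) ^ 2 / 16) := by
  refine Matrix.inv_eq_right_inv ?_
  rw [stereoMetric, Matrix.diagonal_mul_diagonal, ← Matrix.diagonal_one]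
  congr 1
  funext i
  have h1 := hs (blk i)
  have h2 := blockSq_add_ne (blk := blk) i w
  field_simp

theorem pd_stereoMetric (a i j : ι) (w : ι → ℝ) :
    pd a (fun w => stereoMetric blk s w i j) w =
      if i = j ∧ blk a = blk i then -(s (blk i) * (64 * w a / (blockSq blk i w + 4) ^ 3)) else 0 := by
  by_cases hij : i = j
  · subst hij
    simp only [stereoMetric, Matrix.diagonal_apply_eq, true_and]
    have hne := fun w => blockSq_add_ne (blk := blk) i w
    refine pd_eq ?_ ?_
    · have := differentiable_blockSq (blk := blk) i w
      have h2 := pow_ne_zero 2 (hne w)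
      fun_prop (disch := assumption)
    · simp only [blockSq_line]
      split_ifs with h
      · have h1 : HasDerivAt (fun t : ℝ => 2 * w a * t + t ^ 2) (2 * w a) 0 := by
          simpa using ((hasDerivAt_id' (0 : ℝ)).const_mul (2 * w a)).fun_add (hasDerivAt_pow 2 (0 : ℝ))
        have h2 := (((((h1.const_add (blockSq blk i w)).add_const 4).fun_pow 2).fun_inv
          (by simpa using hne w)).const_mul 16).const_mul (s (blk i))
        simp only [← div_eq_mul_inv] at h2
        refine h2.congr_deriv ?_
        have := hne w
        simp
        field_simp
        ring
      · simpa using hasDerivAt_const (0 : ℝ) _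
  · simp only [stereoMetric, Matrix.diagonal_apply_ne _ hij, hij, false_and, if_false]
    simp [pd]

theorem christoffel_stereoMetric (hs : ∀ c, s c ≠ 0) (k i j : ι) (w : ι → ℝ) :
    christoffel (stereoMetric blk s) k i j w = -(2 / (blockSq blk k w + 4)) *
      ((if j = k ∧ blk i = blk k then w i else 0) + (if i = k ∧ blk j = blk k then w j else 0) -
        if i = j ∧ blk i = blk k then w k else 0) := by
  rw [christoffel, stereoMetric_inv hs, Finset.sum_eq_single k
    (fun l _ hl => by rw [Matrix.diagonal_apply_ne _ hl.symm, zero_mul]) (by simp)]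
  rw [Matrix.diagonal_apply_eq, pd_stereoMetric, pd_stereoMetric, pd_stereoMetric]
  have h1 := hs (blk k)
  have h2 := blockSq_add_ne (blk := blk) k w
  have e1 : (if j = k ∧ blk i = blk j then
      -(s (blk j) * (64 * w i / (blockSq blk j w + 4) ^ 3)) else 0) =
      -(s (blk k) * (64 / (blockSq blk k w + 4) ^ 3)) * if j = k ∧ blk i = blk k then w i else 0 := by
    by_cases h : j = k
    · subst h; split_ifs <;> ring
    · simp [h]
  have e2 : (if i = k ∧ blk j = blk i then
      -(s (blk i) * (64 * w j / (blockSq blk i w + 4) ^ 3)) else 0) =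
      -(s (blk k) * (64 / (blockSq blk k w + 4) ^ 3)) * if i = k ∧ blk j = blk k then w j else 0 := by
    by_cases h : i = k
    · subst h; split_ifs <;> ring
    · simp [h]
  have e3 : (if i = j ∧ blk k = blk i then
      -(s (blk i) * (64 * w k / (blockSq blk i w + 4) ^ 3)) else 0) =
      -(s (blk k) * (64 / (blockSq blk k w + 4) ^ 3)) * if i = j ∧ blk i = blk k then w k else 0 := by
    by_cases h : blk i = blk k
    · simp only [h, blockSq_congr h]; split_ifs <;> ring
    · simp [h, Ne.symm h]
  rw [e1, e2, e3]
  field_simp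
  ring

theorem pd_christoffel_stereoMetric (hs : ∀ c, s c ≠ 0) (l k i j : ι) :
    pd l (christoffel (stereoMetric blk s) k i j) 0 = -(1 / 2) *
      ((if j = k ∧ blk i = blk k then (if i = l then 1 else 0) else 0) +
        (if i = k ∧ blk j = blk k then (if j = l then 1 else 0) else 0) -
        if i = j ∧ blk i = blk k then (if k = l then 1 else 0) else 0) := by
  rw [funext (christoffel_stereoMetric hs k i j)]
  refine pd_eq ?_ ?_
  · have := differentiable_blockSq (blk := blk) k 0
    have h2 := blockSq_add_ne (blk := blk) k 0
    refine DifferentiableAt.fun_mul (by fun_prop (disch := assumption)) ?_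
    refine DifferentiableAt.fun_sub (DifferentiableAt.fun_add ?_ ?_) ?_ <;> split_ifs <;> fun_prop
  · have hL : ∀ (P : Prop) [Decidable P] (a : ι) (t : ℝ),
        (if P then ((0 : ι → ℝ) + t • (Pi.single l 1 : ι → ℝ)) a else 0) =
          t * if P then (if a = l then 1 else 0) else 0 := fun P _ a t => by
      simp [Pi.single_apply]
    simp only [hL, ← mul_add, ← mul_sub, blockSq_line, blockSq_zero, Pi.zero_apply]
    generalize ((if j = k ∧ blk i = blk k then (if i = l then (1 : ℝ) else 0) else 0) +
        (if i = k ∧ blk j = blk k then (if j = l then 1 else 0) else 0) -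
        if i = j ∧ blk i = blk k then (if k = l then 1 else 0) else 0) = c
    -- a product with a factor `t` has at `t = 0` the other factor as its derivative
    have h1 : ContinuousAt (fun t : ℝ => -(2 / (0 + (if blk l = blk k then 2 * 0 * t + t ^ 2 else 0)
        + 4)) * c) 0 := by
      split_ifs
      · have : ∀ t : ℝ, 0 + (2 * 0 * t + t ^ 2) + 4 ≠ 0 := fun t => by
          rw [mul_zero, zero_mul]; positivity
        fun_prop (disch := first | assumption | simp)
      · fun_prop
    rw [hasDerivAt_iff_tendsto_slope_zero]
    have h2 : -(2 / (0 + (if blk l = blk k then 2 * 0 * (0:ℝ) + 0 ^ 2 else 0) + 4)) * c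
        = -(1 / 2) * c := by split_ifs <;> norm_num
    rw [ContinuousAt, h2] at h1
    refine (h1.mono_left nhdsWithin_le_nhds).congr' ?_
    filter_upwards [self_mem_nhdsWithin] with t ht
    have ht : t ≠ 0 := ht
    simp only [zero_add, zero_mul, mul_zero, sub_zero, smul_eq_mul]
    field_simp

/-- The metric of a round sphere of dimension `d` has Ricci curvature `d - 1` times the metric, and
multiplying the metric by a constant does not change the Ricci curvature. -/
theorem ricci_stereoMetric (hs : ∀ c, s c ≠ 0) (i j : ι) :
    ricci (stereoMetric blk s) i j 0 =
      if i = j then (∑ k, if blk i = blk k then (1 : ℝ) else 0) - 1 else 0 := by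
  have h0 : ∀ k i j, christoffel (stereoMetric blk s) k i j 0 = 0 := fun k i j => by
    rw [christoffel_stereoMetric hs]; simp
  simp only [ricci, pd_christoffel_stereoMetric hs, h0, mul_zero, sub_zero, Finset.sum_const_zero,
    add_zero]
  by_cases hij : i = j
  · subst hij
    refine (Finset.sum_congr rfl fun k _ => (?_ : _ =
      (if blk i = blk k then (1 : ℝ) else 0) - if i = k then 1 else 0)).trans ?_
    · by_cases h : i = k
      · subst h; norm_num
      · simp only [h, Ne.symm h, false_and, if_false, if_true, true_and]
        split_ifs <;> norm_num
    · simp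
  · refine (Finset.sum_eq_zero fun k _ => ?_).trans (if_neg hij).symm
    by_cases h : i = k
    · subst h; simp [hij, Ne.symm hij]
    · simp [h, hij]

theorem scalarCurv_stereoMetric (hs : ∀ c, s c ≠ 0) :
    scalarCurv (stereoMetric blk s) 0 =
      ∑ i, (s (blk i))⁻¹ * ((∑ k, if blk i = blk k then (1 : ℝ) else 0) - 1) := by
  simp only [scalarCurv, ricci_stereoMetric hs, stereoMetric_inv hs, Matrix.diagonal_apply,
    blockSq_zero]
  refine Finset.sum_congr rfl fun i _ => ?_
  simp only [ite_mul, zero_mul, Finset.sum_ite_eq, Finset.mem_univ, if_true]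
  norm_num

theorem boxCoord_stereoMetric (hs : ∀ c, s c ≠ 0) (F : (ι → ℝ) → ℂ) :
    boxCoord (stereoMetric blk s) F 0 = -∑ a, (((s (blk a))⁻¹ : ℝ) : ℂ) * pd a (pd a F) 0 := by
  have h0 : ∀ k i j, christoffel (stereoMetric blk s) k i j 0 = 0 := fun k i j => by
    rw [christoffel_stereoMetric hs]; simp
  simp only [boxCoord, h0, stereoMetric_inv hs, Matrix.diagonal_apply, blockSq_zero]
  congr 1
  refine Finset.sum_congr rfl fun i _ => ?_
  rw [Finset.sum_eq_single i (fun j _ hj => by simp [Ne.symm hj]) (by simp)]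
  norm_num

end Curvature

/-! ### The conformal Laplacian -/

theorem stereo_zero {n : ℕ} (b : Fin n → Amb n) (z : Amb n) : stereo b z 0 = z := by
  simp [stereo, smul_smul]

theorem stereoDer_zero {n : ℕ} (b : Fin n → Amb n) (z : Amb n) (i : Fin n) :
    stereoDer b z i 0 = b i := by
  simp [stereoDer]

/-- In stereographic coordinates centred at `z` the second derivatives at `0` are normal to the
sphere. -/
theorem hasDerivAt_stereoDer {n : ℕ} (b : Fin n → Amb n) (z : Amb n) (i : Fin n) :
    HasDerivAt (fun t : ℝ => stereoDer b z i (t • (Pi.single i 1 : Fin n → ℝ))) (-z) 0 := by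
  have hQ : ∀ t : ℝ, ∑ k, (t • (Pi.single i 1 : Fin n → ℝ)) k ^ 2 = t ^ 2 := fun t => by
    simp [Pi.single_apply]
  have hβ : ∀ t : ℝ, ∑ k, (t • (Pi.single i 1 : Fin n → ℝ)) k • b k = t • b i := fun t => by
    simp [Pi.single_apply]
  have hi : ∀ t : ℝ, (t • (Pi.single i 1 : Fin n → ℝ)) i = t := fun t => by simp
  simp only [stereoDer, hQ, hβ, hi]
  have h1 : HasDerivAt (fun t : ℝ => (t ^ 2 + 4)⁻¹) 0 0 := by
    simpa using ((hasDerivAt_pow 2 (0 : ℝ)).add_const 4).fun_inv (by norm_num)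
  have h2 : HasDerivAt (fun t : ℝ => 8 * ((t ^ 2 + 4)⁻¹) ^ 2 * t) (1 / 2) 0 :=
    (((h1.fun_pow 2).const_mul 8).fun_mul (hasDerivAt_id' 0)).congr_deriv (by norm_num)
  have h3 := ((h1.const_mul 4).smul_const (b i)).fun_sub
    (h2.fun_smul (((hasDerivAt_id' (0 : ℝ)).smul_const (b i)).add_const ((2 : ℝ) • z)))
  refine h3.congr_deriv ?_
  simp [smul_smul]

section Frames

variable {b : Fin p → Amb p} {b' : Fin q → Amb q} {z : Prd p q}

/-- The product of two inverse stereographic projections. -/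
def stereo₂ (b : Fin p → Amb p) (b' : Fin q → Amb q) (z : Prd p q) (w : Fin p ⊕ Fin q → ℝ) :
    Amb p × Amb q :=
  (stereo b z.1 fun i => w (.inl i), stereo b' z.2 fun j => w (.inr j))

/-- The partial derivative `∂_a` of `stereo₂ b b' z` at `w`. -/
def stereoDer₂ (b : Fin p → Amb p) (b' : Fin q → Amb q) (z : Prd p q) (a : Fin p ⊕ Fin q)
    (w : Fin p ⊕ Fin q → ℝ) : Amb p × Amb q :=
  a.elim (fun i => (stereoDer b z.1 i fun i => w (.inl i), 0))
    fun j => (0, stereoDer b' z.2 j fun j => w (.inr j))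

theorem stereo₂_contDiff : ContDiff ℝ ∞ (stereo₂ b b' z) :=
  ((stereo_contDiff b z.1).comp (contDiff_pi.mpr fun i => contDiff_apply ℝ ℝ (Sum.inl i))).prodMk
    ((stereo_contDiff b' z.2).comp (contDiff_pi.mpr fun j => contDiff_apply ℝ ℝ (Sum.inr j)))

theorem line_inl_inl (w : Fin p ⊕ Fin q → ℝ) (t : ℝ) (i : Fin p) :
    (fun k => (w + t • (Pi.single (.inl i) 1 : Fin p ⊕ Fin q → ℝ)) (.inl k)) =
      (fun k => w (.inl k)) + t • (Pi.single i 1 : Fin p → ℝ) := by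
  funext k; simp [Pi.single_apply]

theorem line_inl_inr (w : Fin p ⊕ Fin q → ℝ) (t : ℝ) (i : Fin p) :
    (fun k => (w + t • (Pi.single (.inl i) 1 : Fin p ⊕ Fin q → ℝ)) (.inr k)) =
      fun k => w (.inr k) := by
  funext k; simp

theorem line_inr_inl (w : Fin p ⊕ Fin q → ℝ) (t : ℝ) (j : Fin q) :
    (fun k => (w + t • (Pi.single (.inr j) 1 : Fin p ⊕ Fin q → ℝ)) (.inl k)) =
      fun k => w (.inl k) := by
  funext k; simp

theorem line_inr_inr (w : Fin p ⊕ Fin q → ℝ) (t : ℝ) (j : Fin q) :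
    (fun k => (w + t • (Pi.single (.inr j) 1 : Fin p ⊕ Fin q → ℝ)) (.inr k)) =
      (fun k => w (.inr k)) + t • (Pi.single j 1 : Fin q → ℝ) := by
  funext k; simp [Pi.single_apply]

theorem hasDerivAt_stereo₂ (a : Fin p ⊕ Fin q) (w : Fin p ⊕ Fin q → ℝ) :
    HasDerivAt (fun t : ℝ => stereo₂ b b' z (w + t • (Pi.single a 1 : Fin p ⊕ Fin q → ℝ)))
      (stereoDer₂ b b' z a w) 0 := by
  rcases a with i | j
  · simp only [stereo₂, line_inl_inl, line_inl_inr]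
    exact (hasDerivAt_stereo b z.1 i _).prodMk (hasDerivAt_const 0 _)
  · simp only [stereo₂, line_inr_inl, line_inr_inr]
    exact (hasDerivAt_const 0 _).prodMk (hasDerivAt_stereo b' z.2 j _)

/-- The position vector of the factor of `S^p × S^q` that the coordinate with index `a` belongs to. -/
def blockPos (z : Prd p q) (a : Fin p ⊕ Fin q) : Amb p × Amb q :=
  a.elim (fun _ => ((z.1 : Amb p), 0)) fun _ => (0, (z.2 : Amb q))

theorem hasDerivAt_stereoDer₂ (a : Fin p ⊕ Fin q) :
    HasDerivAt (fun t : ℝ => stereoDer₂ b b' z a (0 + t • (Pi.single a 1 : Fin p ⊕ Fin q → ℝ)))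
      (-blockPos z a) 0 := by
  have h0 : (fun k : Fin p => (0 : Fin p ⊕ Fin q → ℝ) (.inl k)) = 0 := rfl
  have h0' : (fun k : Fin q => (0 : Fin p ⊕ Fin q → ℝ) (.inr k)) = 0 := rfl
  rcases a with i | j
  · simp only [stereoDer₂, Sum.elim_inl, line_inl_inl]
    simp only [h0, zero_add]
    refine ((hasDerivAt_stereoDer b z.1 i).prodMk (hasDerivAt_const 0 (0 : Amb q))).congr_deriv ?_
    simp [blockPos]
  · simp only [stereoDer₂, Sum.elim_inr, line_inr_inr]
    simp only [h0', zero_add]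
    refine ((hasDerivAt_const 0 (0 : Amb p)).prodMk (hasDerivAt_stereoDer b' z.2 j)).congr_deriv ?_
    simp [blockPos]

theorem coord_eq_zero (h : chartAt (EuclideanSpace ℝ (Fin p)) z.1 z.1 = 0)
    (h' : chartAt (EuclideanSpace ℝ (Fin q)) z.2 z.2 = 0) : coord z = 0 := by
  rw [coord, h, h']
  funext a
  rcases a with i | j <;> rfl

theorem emb_param
    (h : ∀ x, ((chartAt (EuclideanSpace ℝ (Fin p)) z.1).symm x : Amb p) = stereo b z.1 x)
    (h' : ∀ x, ((chartAt (EuclideanSpace ℝ (Fin q)) z.2).symm x : Amb q) = stereo b' z.2 x)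
    (w : Fin p ⊕ Fin q → ℝ) : emb (param z w) = stereo₂ b b' z w :=
  Prod.ext (h _) (h' _)

/-- In the chart around `z` the metric `-g_{S^p} + g_{S^q}` is conformally flat on each factor. -/
theorem metricCoeff_eq (hb : ∀ i j, ⟪b i, b j⟫_ℝ = if i = j then 1 else 0)
    (hbz : ∀ i, ⟪b i, (z.1 : Amb p)⟫_ℝ = 0) (hb' : ∀ i j, ⟪b' i, b' j⟫_ℝ = if i = j then 1 else 0)
    (hbz' : ∀ i, ⟪b' i, (z.2 : Amb q)⟫_ℝ = 0) (hw : ∀ w, emb (param z w) = stereo₂ b b' z w) :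
    metricCoeff z = stereoMetric Sum.isLeft fun c => if c then -1 else 1 := by
  have hN : Differentiable ℝ (stereo₂ b b' z) := stereo₂_contDiff.differentiable (by simp)
  have h1 : ∀ a w, pd a (fun w => ((param z w).1 : Amb p)) w = (stereoDer₂ b b' z a w).1 :=
    fun a w => by
      rw [show (fun w => ((param z w).1 : Amb p)) = fun w => (stereo₂ b b' z w).1 from
        funext fun w => congrArg Prod.fst (hw w)]
      exact pd_eq (hN w).fst (hasDerivAt_stereo₂ a w).fst
  have h2 : ∀ a w, pd a (fun w => ((param z w).2 : Amb q)) w = (stereoDer₂ b b' z a w).2 :=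
    fun a w => by
      rw [show (fun w => ((param z w).2 : Amb q)) = fun w => (stereo₂ b b' z w).2 from
        funext fun w => congrArg Prod.snd (hw w)]
      exact pd_eq (hN w).snd (hasDerivAt_stereo₂ a w).snd
  have hz1 : ⟪(z.1 : Amb p), (z.1 : Amb p)⟫_ℝ = 1 := by
    rw [real_inner_self_eq_norm_sq, mem_sphere_zero_iff_norm.mp z.1.2, one_pow]
  have hz2 : ⟪(z.2 : Amb q), (z.2 : Amb q)⟫_ℝ = 1 := by
    rw [real_inner_self_eq_norm_sq, mem_sphere_zero_iff_norm.mp z.2.2, one_pow]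
  funext w
  ext a c
  simp only [metricCoeff, Matrix.of_apply, h1, h2, stereoMetric, Matrix.diagonal_apply, blockSq]
  rcases a with i | i <;> rcases c with j | j
  · simp only [stereoDer₂, Sum.elim_inl, inner_zero_left, add_zero, inner_stereoDer hb hbz hz1]
    simp [Fintype.sum_sum_type, neg_ite]
  · simp [stereoDer₂]
  · simp [stereoDer₂]
  · simp only [stereoDer₂, Sum.elim_inr, inner_zero_left, neg_zero, zero_add,
      inner_stereoDer hb' hbz' hz2]
    simp [Fintype.sum_sum_type]

/-- The second derivatives of `f` in the chart around `z` are those of the homogeneous extension in the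
directions of the basis. -/
theorem pd_pd_param {f : Prd p q → ℂ} (hf : Smooth f)
    (hw : ∀ w, emb (param z w) = stereo₂ b b' z w) (a : Fin p ⊕ Fin q) :
    pd a (pd a fun w => f (param z w)) 0 = fderiv ℝ (fderiv ℝ (homExt₂ f)) (emb z)
      (stereoDer₂ b b' z a 0) (stereoDer₂ b b' z a 0) := by
  have hN : Differentiable ℝ (stereo₂ b b' z) := stereo₂_contDiff.differentiable (by simp)
  have hF : (fun w => f (param z w)) = homExt₂ f ∘ stereo₂ b b' z := by
    funext w; simp only [Function.comp, ← hw, homExt₂_emb]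
  have hH : ∀ w, DifferentiableAt ℝ (homExt₂ f) (stereo₂ b b' z w) := fun w => by
    rw [← hw]; exact homExt₂_differentiableAt hf _
  have hH2 : ∀ w, DifferentiableAt ℝ (fderiv ℝ (homExt₂ f)) (stereo₂ b b' z w) := fun w => by
    rw [← hw]
    exact ((homExt₂_contDiffAt_emb hf _).fderiv_right (m := ∞) le_rfl).differentiableAt (by simp)
  have hFd : ContDiff ℝ ∞ (fun w => f (param z w)) := by
    rw [hF, contDiff_iff_contDiffAt]
    intro w
    refine ContDiffAt.comp w ?_ stereo₂_contDiff.contDiffAt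
    rw [← hw]; exact homExt₂_contDiffAt_emb hf _
  have h1 : (pd a fun w => f (param z w)) = fun w =>
      fderiv ℝ (homExt₂ f) (stereo₂ b b' z w) (stereoDer₂ b b' z a w) := by
    funext w
    refine pd_eq (hFd.differentiable (by simp) w) ?_
    change HasDerivAt (fun t : ℝ => (fun w => f (param z w))
      (w + t • (Pi.single a 1 : Fin p ⊕ Fin q → ℝ))) _ 0
    rw [hF]
    have h := hasDerivAt_stereo₂ (b := b) (b' := b') (z := z) a w
    have h0 : w + (0 : ℝ) • (Pi.single a 1 : Fin p ⊕ Fin q → ℝ) = w := by simp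
    have hd := (hH w).hasFDerivAt
    rw [← h0] at hd
    have h3 := hd.comp_hasDerivAt (0 : ℝ) h
    simp only [h0] at h3
    exact h3
  have hz0 : stereo₂ b b' z 0 = emb z := Prod.ext (stereo_zero _ _) (stereo_zero _ _)
  refine pd_eq ?_ ?_
  · exact ((hFd.fderiv_right (m := ∞) le_rfl).differentiable (by simp) 0).clm_apply
      (differentiableAt_const _)
  · rw [h1]
    have h := hasDerivAt_stereo₂ (b := b) (b' := b') (z := z) a 0
    have h0 : (0 : Fin p ⊕ Fin q → ℝ) + (0 : ℝ) • (Pi.single a 1 : Fin p ⊕ Fin q → ℝ) = 0 := by simp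
    have hd := (hH2 0).hasFDerivAt
    rw [← h0] at hd
    have h3 : HasDerivAt (fun t : ℝ => fderiv ℝ (homExt₂ f)
        (stereo₂ b b' z (0 + t • (Pi.single a 1 : Fin p ⊕ Fin q → ℝ))))
        (fderiv ℝ (fderiv ℝ (homExt₂ f)) (emb z) (stereoDer₂ b b' z a 0)) 0 := by
      have h3 := hd.comp_hasDerivAt (0 : ℝ) h
      simp only [h0, hz0] at h3
      exact h3
    refine (h3.clm_apply (hasDerivAt_stereoDer₂ a)).congr_deriv ?_
    -- the second derivative of the chart is normal, and `homExt₂ f` is constant along the normals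
    have hrad : fderiv ℝ (homExt₂ f) (emb z) (blockPos z a) = 0 := by
      rcases a with i | j
      · exact fderiv_radial_fst hf z
      · exact fderiv_radial_snd hf z
    simp only [h0, hz0, map_neg, hrad, neg_zero, add_zero]

end Frames

/-- For `r = 1` the operator is the conformal Laplacian. The constants agree since
`(n - 2) / (4 (n - 1)) · (q (q - 1) - p (p - 1)) = ((q - 1)² - (p - 1)²) / 4`. -/
theorem polyOp_covPoly_one (hp : 1 ≤ p) (hq : 1 ≤ q) {f : Prd p q → ℂ} (hf : Smooth f) :
    polyOp (covPoly p q 1) f = confLaplacian f := by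
  funext z
  obtain ⟨b, hb, hbz, hc, hx⟩ := exists_chart_frame z.1
  obtain ⟨b', hb', hbz', hc', hx'⟩ := exists_chart_frame z.2
  have hw := emb_param (z := z) hx hx'
  have hs : ∀ c : Bool, (if c then (-1 : ℝ) else 1) ≠ 0 := fun c => by cases c <;> norm_num
  have hP : polyOp (covPoly p q 1) f z =
      lapQ f z - lapP f z + ((((q : ℂ) - 1) / 2) ^ 2 - (((p : ℂ) - 1) / 2) ^ 2) * f z := by
    have h := congrFun (polyOp_eq_evalComm (covPoly p q 1) (SmoothFun.of hf)) z
    rw [evalComm_covPoly_one] at h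
    refine h.trans ?_
    have h1 := congrFun (lapPOp_apply (SmoothFun.of hf)) z
    have h2 := congrFun (lapQOp_apply (SmoothFun.of hf)) z
    exact congrArg₂ (· + ·) (congrArg₂ (· - ·) h2 h1) rfl
  have hLP : lapP f z = -∑ i, fderiv ℝ (fderiv ℝ (homExt₂ f)) (emb z) (b i, 0) (b i, 0) := by
    rw [lapP, sphLap_eq_sum_frame (hf.slice_fst z.2) z.1 hb hbz]
    simp only [fderiv_fderiv_homExt_fst hf]
  have hLQ : lapQ f z = -∑ i, fderiv ℝ (fderiv ℝ (homExt₂ f)) (emb z) (0, b' i) (0, b' i) := by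
    rw [lapQ, sphLap_eq_sum_frame (hf.slice_snd z.1) z.2 hb' hbz']
    simp only [fderiv_fderiv_homExt_snd hf]
  have h0 : ∀ n, (fun _ : Fin n => (0 : ℝ)) = 0 := fun n => rfl
  rw [hP, confLaplacian, metricCoeff_eq hb hbz hb' hbz' hw, coord_eq_zero hc hc',
    boxCoord_stereoMetric hs, scalarCurv_stereoMetric hs, hLP, hLQ]
  simp only [pd_pd_param hf hw, Fintype.sum_sum_type, stereoDer₂, Sum.elim_inl, Sum.elim_inr,
    Pi.zero_apply, h0, stereoDer_zero]
  have hn : (p : ℂ) + q - 1 ≠ 0 := by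
    have : ((p + q - 1 : ℕ) : ℂ) ≠ 0 := by exact_mod_cast (by omega : p + q - 1 ≠ 0)
    rwa [Nat.cast_sub (by omega), Nat.cast_add, Nat.cast_one] at this
  simp
  left
  field_simp
  ring

end SphereProduct

end

theorem mainTheorem2 (p q r : ℕ) (hp : 1 ≤ p) (hq : 1 ≤ q) (hr : 1 ≤ r) :
    -- `D` is a conformally covariant differential operator of order `2r`,
    -- and for `r = 1` it is the conformal Laplacian
    (∃ P : MvPolynomial (Fin 2) ℝ, P.totalDegree = r ∧
      (∀ f : SphereProduct.kFinite p q,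
        (SphereProduct.opD p q r f : SphereProduct.Prd p q → ℂ) = SphereProduct.polyOp P f) ∧
      (∀ f : SphereProduct.Prd p q → ℂ, SphereProduct.Smooth f →
        ∀ X : SphereProduct.lieG p q,
          SphereProduct.polyOp P (SphereProduct.confRep (((p : ℝ) + q) / 2 - r) X f) =
            SphereProduct.confRep (((p : ℝ) + q) / 2 + r) X (SphereProduct.polyOp P f)) ∧
      (r = 1 → ∀ f : SphereProduct.Prd p q → ℂ, SphereProduct.Smooth f →
        SphereProduct.polyOp P f = SphereProduct.confLaplacian f)) ∧
    -- the eigenvalue of `D` on `V(j,k)`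
    (∀ (j k : ℕ) (f : SphereProduct.kFinite p q),
      (f : SphereProduct.Prd p q → ℂ) ∈ SphereProduct.kType p q j k →
        SphereProduct.opD p q r f = ((SphereProduct.eigD p q r j k : ℝ) : ℂ) • f) ∧
    -- the Gamma function formula for the spectral function is a multiple of this eigenvalue
    (∀ j k : ℕ, Filter.Tendsto (SphereProduct.gammaQuot p q r j k) (nhdsWithin 0 {0}ᶜ)
      (nhds (SphereProduct.eigD p q r j k / 4 ^ r))) ∧
    ∀ ε : Fin 2,
      -- `𝓔^ε` is stable under `K` and `𝔤`
      (∀ f ∈ SphereProduct.kFinitePar p q ε,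
        (∀ (u : SphereProduct.Amb p ≃ₗᵢ[ℝ] SphereProduct.Amb p)
            (v : SphereProduct.Amb q ≃ₗᵢ[ℝ] SphereProduct.Amb q),
          SphereProduct.IsRot u → SphereProduct.IsRot v →
            SphereProduct.rotAct u v f ∈ SphereProduct.kFinitePar p q ε) ∧
        ∀ (a : ℝ) (X : SphereProduct.lieG p q),
          SphereProduct.confRep a X f ∈ SphereProduct.kFinitePar p q ε) ∧
      -- the eigenvalue of `D` is a spectral function on `𝓔^ε`
      SphereProduct.IsSpectralFunction p q r ε
        (fun j k => ((SphereProduct.eigD p q r j k : ℝ) : ℂ)) ∧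
      -- and every intertwinor, every spectral function, is a constant multiple of it
      ((∀ m : ℤ, ((q : ℝ) - p) / 2 + (ε : ℕ) + 1 - r ≠ 2 * m) →
        (∀ A : Module.End ℂ (SphereProduct.kFinitePar p q ε),
          SphereProduct.IsIntertwinor p q r ε A →
            ∃ c : ℂ, ∀ f : SphereProduct.kFinitePar p q ε,
              (A f : SphereProduct.Prd p q → ℂ) =
                c • (SphereProduct.opD p q r
                  (Submodule.inclusion (SphereProduct.kFinitePar_le p q ε) f) :
                    SphereProduct.Prd p q → ℂ)) ∧
        ∀ Z : ℕ → ℕ → ℂ, SphereProduct.IsSpectralFunction p q r ε Z →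
          ∃ c : ℂ, ∀ j k, (j + k) % 2 = (ε : ℕ) →
            Z j k = c * ((SphereProduct.eigD p q r j k : ℝ) : ℂ)) := by
  refine ⟨⟨SphereProduct.covPoly p q r, SphereProduct.totalDegree_covPoly p q r,
    SphereProduct.opD_eq_polyOp hp hq r, fun f hf X => SphereProduct.polyOp_covariant r hf X, ?_⟩,
    fun j k f hf => SphereProduct.opD_apply hp hq r hf, SphereProduct.tendsto_gammaQuot p q r,
    fun ε => ⟨fun f hf => ⟨fun u v _ _ => SphereProduct.rotAct_mem_kFinitePar hf u v,
      fun a X => SphereProduct.confRep_mem_kFinitePar hp hq a X hf⟩,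
      SphereProduct.isSpectralFunction_eigD hp hq r ε, fun hε => ⟨fun A hA => ?_,
        fun Z hZ => hZ.eq_mul hp hq hε⟩⟩⟩
  · rintro rfl f hf
    exact SphereProduct.polyOp_covPoly_one hp hq hf
  · obtain ⟨c, hc⟩ := hA.eq_smul hp hq hε
    refine ⟨c, fun f => ?_⟩
    rw [hc f, SphereProduct.opD_eq_polyOp hp hq r, Submodule.coe_smul, SphereProduct.parD_val,
      Submodule.coe_inclusion]
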